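/- **Setting.** Let $\kappa$ be the security parameter; the parameters $n,\ell,\sigma,L,\delta,s\in\mathbb N$ and $\eta\in\mathbb Z$ below depend on $\kappa$, with $n$ polynomially bounded. *(2,2)-threshold Paillier.* Key generation draws uniformly $(p,q,p',q')$ such that $p,q$ are odd primes of $2\kappa$ bits, $p',q'$ are odd integers of $\lfloor (n-4\kappa)/2\rfloor-1$ bits, $p,q,p',q'$ are pairwise coprime, and $P=2pp'+1$, $Q=2qq'+1$ are primes (such a tuple is supposed to exist for all large $\kappa$). Put $N=PQ$, $\alpha=pq$, $\beta=\frac{(P-1)(Q-1)}{4pq}$, $h=-y^{2\beta}\bmod N$ with $y$ uniform in $\mathbb Z_N^*$. The public key is $(h,N)$, the private key is $\alpha$, and the threshold keys are $sk_1$, uniform in $\{0,\dots,2^\sigma-1\}$, and $sk_2=((2\alpha)^{-1}\bmod N)\cdot 2\alpha-sk_1+\eta\cdot 2\alpha N$. Encryption is $\mathrm{Enc}(m)=(1+N)^m(h^r\bmod N)^N\bmod N^2$ with $r$ uniform in $\{0,1\}^{4\kappa}$; decryption is $\mathrm{Dec}(c)=\frac{(c^{2\alpha}\bmod N^2)-1}{N}(2\alpha)^{-1}\bmod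 N$; partial decryption is $c\mapsto c^{sk_i}\bmod N^2$; threshold decryption is $(M_1,M_2)\mapsto\frac{(M_1M_2\bmod N^2)-1}{N}\bmod N$. Write $⟦m⟧$ for an encryption of $m$; an element of $\mathbb Z_N$ is read as the integer of smallest absolute value in its class. *Protocol BatchSMUL.* The constants $L,\delta,s,\sigma,\ell$ are public and shared by the servers $S_1$ (holding $sk_1$) and $S_2$ (holding $sk_2$). $S_1$ holds $⟦x_i⟧,⟦y_i⟧$, $1\le i\le s$. 1. $S_1$ draws $r_{i,1},r_{i,2}$ uniformly from $\{0,1\}^\sigma$, computes $⟦X_i⟧=⟦x_i⟧⟦\delta⟧⟦r_{i,1}⟧$, $⟦Y_i⟧=⟦y_i⟧⟦\delta⟧⟦r_{i,2}⟧$ and $⟦C⟧=\prod_{i=1}^s⟦X_i⟧^{L^{2i-1}}⟦Y_i⟧^{L^{2i-2}}$, and sends $⟦C⟧$ and $⟦C_1⟧=⟦C⟧^{sk_1}$ to $S_2$. 2. $S_2$ obtains $C$ by threshold decryption of $⟦C_1⟧$ and $⟦C⟧^{sk_2}$, computes $c_i=\lfloor (C\bmod L^{2i})/L^{2(i-1)}\rfloor$,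 $u_i=\lfloor c_i/L\rfloor-\delta$, $v_i=(c_i\bmod L)-\delta$, and returns fresh encryptions $⟦u_iv_i⟧$. 3. $S_1$ outputs $⟦u_iv_i⟧\cdot(⟦x_i⟧⟦\delta⟧)^{-r_{i,2}}\cdot(⟦y_i⟧⟦\delta⟧)^{-r_{i,1}}\cdot⟦-r_{i,1}r_{i,2}⟧\cdot⟦\delta(r_{i,1}+r_{i,2})⟧$ for $1\le i\le s$. *Assumptions.* For all $\kappa$: $1\le s\le\lfloor |N|/(2|L|)\rfloor$ for every modulus $N$ that can be generated ($|\cdot|$ is the bit length), $L\ge 2^{\sigma+2}$, $\ell<\sigma$ and $0\le\delta\le 2^\ell$; moreover $2^{\ell}/2^{\sigma}$ is negligible in $\kappa$. The cryptosystem is semantically secure: given only the public key, encryptions of any two messages of at most $n$ bits (one pair for every $\kappa$) are computationally indistinguishable. Adversaries are non-uniform probabilistic polynomial-time algorithms. **Statement.** For plaintexts $x_i,y_i\in[-2^\ell,2^\ell]$ with $x_i+\delta\ge0$ and $y_i+\delta\ge0$, BatchSMUL securely computes $⟦x_1y_1⟧,\dots,⟦x_sy_s⟧$ against non-colluding semi-honest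 servers: (a) for all keys and all random choices, the $i$-th output of $S_1$ decrypts to $x_iy_i$, for $1\le i\le s$; (b) for each server $S_j$, $j\in\{1,2\}$, there is a probabilistic polynomial-time simulator that is given only $\kappa$, the public parameters (including $\delta$), the public key and $sk_j$, and whose output is, for all such families of plaintexts, computationally indistinguishable from the view of $S_j$ in the protocol with fresh keys and freshly encrypted inputs. The view consists of the public key, $sk_j$, the randomness of $S_j$, the messages it receives and, for $j=1$, its input ciphertexts. Thus neither server learns anything about the $x_i$ and $y_i$ beyond what the public $\delta$ tells. -/

import Mathlib

noncomputable section

namespace BatchSMUL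

/-! ### A machine model with a step count

Probabilistic programs over binary trees with integer leaves.  Costs are logarithmic: every
primitive instruction is charged one plus the number of bits of the data it is applied to. -/

/-- Data: integers and pairs. -/
inductive Val : Type
  | num (z : ℤ) : Val
  | pair (a b : Val) : Val

namespace Val

/-- Bit size of a datum. -/
def size : Val → ℕ
  | num z => 1 + Nat.size z.natAbs
  | pair a b => 1 + a.size + b.size

/-- The integer at a leaf (`0` for a pair). -/
def toInt : Val → ℤ
  | num z => z
  | pair _ _ => 0

/-- First component (`0` for an integer). -/
def fst : Val → Val
  | num _ => num 0
  | pair a _ => a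

/-- Second component (`0` for an integer). -/
def snd : Val → Val
  | num _ => num 0
  | pair _ b => b

/-- `1` for a pair, `0` for an integer. -/
def isPair : Val → Val
  | num _ => num 0
  | pair _ _ => num 1

/-- The answer "1" of a distinguisher. -/
def isOne : Val → Bool
  | num z => decide (z = 1)
  | pair _ _ => false

/-- Lists of data as data. -/
def ofList : List Val → Val
  | [] => num 0
  | a :: l => pair a (ofList l)

/-- Natural numbers as data. -/
def ofNat (k : ℕ) : Val := num (k : ℤ)

end Val

/-- The arithmetic instructions; `div` and `mod` are Euclidean division and remainder,
and return `0` when the divisor is `0`. -/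
inductive Arith : Type
  | add | sub | mul | div | mod

/-- Meaning of the arithmetic instructions. -/
def Arith.eval : Arith → ℤ → ℤ → ℤ
  | add, a, b => a + b
  | sub, a, b => a - b
  | mul, a, b => a * b
  | div, a, b => a / b
  | mod, a, b => if b = 0 then 0 else a % b

/-- Probabilistic programs, transforming a datum.  `loop f` maps `(k, v)` to the result of
running `f` consecutively `k` times from `v`; as polynomial-time algorithms can be clocked,
bounded iteration is no restriction on polynomial-time computation. -/
inductive Prog : Type
  | id : Prog
  | const (z : ℤ) : Prog
  | fst : Prog
  | snd : Prog
  | isPair : Prog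
  | arith (o : Arith) : Prog
  | coin : Prog
  | pair (f g : Prog) : Prog
  | comp (f g : Prog) : Prog
  | ifPos (c f g : Prog) : Prog
  | loop (f : Prog) : Prog

/-- Run `step` consecutively `k` times and add up the costs. -/
def iterate (step : Val → PMF (Val × ℕ)) : ℕ → Val → PMF (Val × ℕ)
  | 0, v => PMF.pure (v, 0)
  | k + 1, v => (step v).bind fun a => (iterate step k a.1).map fun b => (b.1, a.2 + b.2)

/-- The joint distribution of the result and the running time of a program.
`comp f g` runs `f` first. -/
def Prog.run : Prog → Val → PMF (Val × ℕ)
  | .id, v => PMF.pure (v, 1 + v.size)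
  | .const z, v => PMF.pure (.num z, 1 + v.size + Nat.size z.natAbs)
  | .fst, v => PMF.pure (v.fst, 1 + v.size)
  | .snd, v => PMF.pure (v.snd, 1 + v.size)
  | .isPair, v => PMF.pure (v.isPair, 1 + v.size)
  | .arith o, v => PMF.pure (.num (o.eval v.fst.toInt v.snd.toInt), 1 + v.size)
  | .coin, v => (PMF.uniformOfFintype Bool).map fun b => (.num (if b then 1 else 0), 1 + v.size)
  | .pair f g, v => (f.run v).bind fun a => (g.run v).map fun b =>
      (.pair a.1 b.1, 1 + v.size + a.2 + b.2)
  | .comp f g, v => (f.run v).bind fun a => (g.run a.1).map fun b => (b.1, 1 + a.2 + b.2)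
  | .ifPos c f g, v => (c.run v).bind fun a =>
      ((if 0 < a.1.toInt then f.run v else g.run v).map fun b => (b.1, 1 + v.size + a.2 + b.2))
  | .loop f, v => (iterate f.run v.fst.toInt.toNat v.snd).map fun b => (b.1, 1 + v.size + b.2)

/-! ### Negligible functions and computational indistinguishability -/

/-- `f` tends to `0` faster than the inverse of every polynomial. -/
def Negligible (f : ℕ → ℝ) : Prop :=
  Asymptotics.SuperpolynomialDecay Filter.atTop (fun κ : ℕ => (κ : ℝ)) f

/-- A function bounded by a polynomial. -/
def PolyBounded (f : ℕ → ℕ) : Prop := ∃ p : Polynomial ℕ, ∀ κ, f κ ≤ p.eval κ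

/-- On security parameter `κ` and an argument `v` in `I κ`, the program always halts within a
number of steps polynomial in `κ` and in the size of `v`. -/
def PolyTimeOn (f : Prog) (I : ℕ → Set Val) : Prop :=
  ∃ p : Polynomial ℕ, ∀ κ, ∀ v ∈ I κ, ∀ o ∈ (f.run (.pair (.ofNat κ) v)).support,
    o.2 ≤ p.eval (κ + v.size)

/-- A non-uniform probabilistic polynomial-time algorithm: a program, together with an advice
of polynomial size for every security parameter. -/
structure Adversary where
  prog : Prog
  advice : ℕ → Val
  polyAdvice : PolyBounded fun κ => (advice κ).size
  polyTime : ∃ p : Polynomial ℕ, ∀ κ v,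
    ∀ o ∈ (prog.run (.pair (.ofNat κ) (.pair (advice κ) v))).support, o.2 ≤ p.eval (κ + v.size)

/-- The probability that the adversary answers `1` on security parameter `κ` and a sample
of `X`. -/
def Adversary.prob (A : Adversary) (κ : ℕ) (X : PMF Val) : ℝ :=
  ((X.bind fun v => (A.prog.run (.pair (.ofNat κ) (.pair (A.advice κ) v))).map
    fun o => o.1.isOne) true).toReal

/-- Computational indistinguishability of two ensembles. -/
def CompIndist (X Y : ℕ → PMF Val) : Prop :=
  ∀ A : Adversary, Negligible fun κ => |A.prob κ (X κ) - A.prob κ (Y κ)|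

/-! ### The (2,2)-threshold Paillier cryptosystem -/

/-- Public key `(h, N)`. -/
structure PublicKey where
  N : ℕ
  h : (ZMod N)ˣ

/-- Ciphertexts are the elements of `ℤ_{N²}^*`. -/
abbrev Ciphertext (pk : PublicKey) : Type := (ZMod (pk.N ^ 2))ˣ

/-- The unit `1 + N` of `ℤ_{N²}`. -/
def onePlusN (N : ℕ) : (ZMod (N ^ 2))ˣ :=
  ZMod.unitOfCoprime (1 + N) (by simp)

/-- `u mod N`, for `u ∈ ℤ_N^*`, as an element of `ℤ_{N²}^*`. -/
def liftUnit {N : ℕ} (u : (ZMod N)ˣ) : (ZMod (N ^ 2))ˣ :=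
  ZMod.unitOfCoprime (u : ZMod N).val ((ZMod.val_coe_unit_coprime u).pow_right 2)

/-- `Enc(pk, m)` with randomness `r`: `(1 + N)^m * (h^r mod N)^N mod N²`.  The result depends
only on `m mod N`; a negative `m` stands for its class modulo `N`. -/
def enc (pk : PublicKey) (m : ℤ) (r : ℕ) : Ciphertext pk :=
  onePlusN pk.N ^ m * liftUnit (pk.h ^ r) ^ pk.N

/-- `((c mod N²) - 1) / N mod N`. -/
def logN {pk : PublicKey} (c : Ciphertext pk) : ZMod pk.N :=
  ((((c : ZMod (pk.N ^ 2)).val - 1) / pk.N : ℕ) : ZMod pk.N)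

/-- Decryption with the private key `α`. -/
def dec {pk : PublicKey} (α : ℕ) (c : Ciphertext pk) : ZMod pk.N :=
  logN (c ^ (2 * α)) * ((2 * α : ℕ) : ZMod pk.N)⁻¹

/-- Partial decryption. -/
def pdec {pk : PublicKey} (ski : ℤ) (c : Ciphertext pk) : Ciphertext pk := c ^ ski

/-- Threshold decryption. -/
def tdec {pk : PublicKey} (M₁ M₂ : Ciphertext pk) : ZMod pk.N := logN (M₁ * M₂)

/-- What `NGen` generates: the numbers `p, q, p', q'`. -/
structure Factors where
  p : ℕ
  q : ℕ
  p' : ℕ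
  q' : ℕ

namespace Factors

/-- `P = 2pp' + 1`. -/
def P (t : Factors) : ℕ := 2 * t.p * t.p' + 1

/-- `Q = 2qq' + 1`. -/
def Q (t : Factors) : ℕ := 2 * t.q * t.q' + 1

/-- `N = PQ`. -/
def N (t : Factors) : ℕ := t.P * t.Q

instance (t : Factors) : NeZero t.N := ⟨by simp [N, P, Q]⟩

/-- `α = pq`. -/
def α (t : Factors) : ℕ := t.p * t.q

/-- `β = (P - 1)(Q - 1) / (4pq)`. -/
def β (t : Factors) : ℕ := (t.P - 1) * (t.Q - 1) / (4 * t.p * t.q)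

/-- The acceptance conditions of `NGen` with `l(κ) = 4κ` and `n(κ) = n`: `p` and `q` are odd
primes of `l(κ)/2` bits, `p'` and `q'` are odd integers of `(n - l(κ))/2 - 1` bits, the four are
pairwise coprime, and `P` and `Q` are primes. -/
def Accepted (n κ : ℕ) (t : Factors) : Prop :=
  (t.p.Prime ∧ Odd t.p ∧ t.p.size = 2 * κ) ∧
  (t.q.Prime ∧ Odd t.q ∧ t.q.size = 2 * κ) ∧
  (Odd t.p' ∧ t.p'.size = (n - 4 * κ) / 2 - 1) ∧
  (Odd t.q' ∧ t.q'.size = (n - 4 * κ) / 2 - 1) ∧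
  [t.p, t.q, t.p', t.q'].Pairwise Nat.Coprime ∧
  t.P.Prime ∧ t.Q.Prime

theorem finite_accepted (n κ : ℕ) : {t : Factors | t.Accepted n κ}.Finite := by
  have hf : Function.Injective fun t : Factors => (t.p, t.q, t.p', t.q') := by
    rintro ⟨a, b, c, d⟩ ⟨a', b', c', d'⟩ h
    simpa using h
  refine Set.Finite.of_finite_image (f := fun t : Factors => (t.p, t.q, t.p', t.q')) ?_ hf.injOn
  refine Set.Finite.subset (Set.finite_Iio (2 ^ (2 * κ)) |>.prod <|
    (Set.finite_Iio (2 ^ (2 * κ))).prod <| (Set.finite_Iio (2 ^ ((n - 4 * κ) / 2 - 1))).prod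
    (Set.finite_Iio (2 ^ ((n - 4 * κ) / 2 - 1)))) ?_
  rintro _ ⟨t, ⟨⟨-, -, h1⟩, ⟨-, -, h2⟩, ⟨-, h3⟩, ⟨-, h4⟩, -⟩, rfl⟩
  exact ⟨Nat.size_le.1 h1.le, Nat.size_le.1 h2.le, Nat.size_le.1 h3.le, Nat.size_le.1 h4.le⟩

end Factors

open Classical in
/-- `NGen`: rejection sampling, that is, a uniformly distributed accepted tuple.  (If there is
none, the algorithm does not terminate and the value here is irrelevant.) -/
def nGen (n κ : ℕ) : PMF Factors :=
  if h : (Factors.finite_accepted n κ).toFinset.Nonempty then PMF.uniformOfFinset _ h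
  else PMF.pure ⟨0, 0, 0, 0⟩

/-- The parameters for one security parameter: `n` determines the bit length of the modulus, the
plaintexts are in `[-2^ℓ, 2^ℓ]`, blinding factors have `σ` bits, `L` is the packing base, `δ`
the shift, `s` the number of pairs, and `η` the integer used for splitting the private key. -/
structure Params where
  n : ℕ
  ℓ : ℕ
  σ : ℕ
  L : ℕ
  δ : ℕ
  s : ℕ
  η : ℤ

/-- Public key, private key and threshold keys. -/
structure Keys where
  pk : PublicKey
  sk : ℕ
  sk₁ : ℤ
  sk₂ : ℤ

/-- The keys determined by the random choices `(p, q, p', q')`, `y` and `sk₁`: `h = -y^(2β)`,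
`α = pq`, and `sk₂ = ((2α)⁻¹ mod N) * 2α - sk₁ + η * 2α * N`. -/
def mkKeys (η : ℤ) (t : Factors) (y : (ZMod t.N)ˣ) (sk₁ : ℕ) : Keys where
  pk := ⟨t.N, -y ^ (2 * t.β)⟩
  sk := t.α
  sk₁ := sk₁
  sk₂ := ((((2 * t.α : ℕ) : ZMod t.N)⁻¹).val : ℤ) * (2 * t.α) - sk₁ + η * (2 * t.α) * t.N

/-- `KeyGen`. -/
def keyGen (P : Params) (κ : ℕ) : PMF Keys :=
  (nGen P.n κ).bind fun t => (PMF.uniformOfFintype (ZMod t.N)ˣ).bind fun y =>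
    (PMF.uniformOfFintype (Fin (2 ^ P.σ))).map fun sk₁ => mkKeys P.η t y sk₁

/-- The randomness of one encryption, `l(κ) = 4κ` bits. -/
abbrev EncCoin (κ : ℕ) : Type := Fin (2 ^ (4 * κ))

/-- A public key as a datum. -/
def PublicKey.toVal (pk : PublicKey) : Val :=
  .pair (.ofNat (pk.h : ZMod pk.N).val) (.ofNat pk.N)

/-- A ciphertext as a datum. -/
def ctVal {pk : PublicKey} (c : Ciphertext pk) : Val := .ofNat (c : ZMod (pk.N ^ 2)).val

/-- A public key and a fresh encryption of `m` under it. -/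
def encEnsemble (P : Params) (κ : ℕ) (m : ℤ) : PMF Val :=
  (keyGen P κ).bind fun k => (PMF.uniformOfFintype (EncCoin κ)).map fun r =>
    .pair k.pk.toVal (ctVal (enc k.pk m r))

/-- Semantic security of the cryptosystem in the form of indistinguishability of encryptions:
given the public key, encryptions of any two messages of at most `n(κ)` bits are computationally
indistinguishable. -/
def SemanticallySecure (par : ℕ → Params) : Prop :=
  ∀ m₀ m₁ : ℕ → ℤ,
    (∀ κ, (m₀ κ).natAbs < 2 ^ (par κ).n) → (∀ κ, (m₁ κ).natAbs < 2 ^ (par κ).n) →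
    CompIndist (fun κ => encEnsemble (par κ) κ (m₀ κ)) (fun κ => encEnsemble (par κ) κ (m₁ κ))

/-! ### The protocol -/

/-- The randomness of `S₁`. -/
structure S1Coins (P : Params) (κ : ℕ) where
  /-- for `⟦δ⟧` -/
  encδ : EncCoin κ
  /-- the blinding factors `r_{i,1}` -/
  r₁ : Fin P.s → Fin (2 ^ P.σ)
  /-- the blinding factors `r_{i,2}` -/
  r₂ : Fin P.s → Fin (2 ^ P.σ)
  /-- for `⟦r_{i,1}⟧` -/
  encr₁ : Fin P.s → EncCoin κ
  /-- for `⟦r_{i,2}⟧` -/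
  encr₂ : Fin P.s → EncCoin κ
  /-- for `⟦-r_{i,1} r_{i,2}⟧` -/
  encProd : Fin P.s → EncCoin κ
  /-- for `⟦δ (r_{i,1} + r_{i,2})⟧` -/
  encSum : Fin P.s → EncCoin κ

/-- The randomness of `S₂`, for the encryptions of the products. -/
abbrev S2Coins (P : Params) (κ : ℕ) : Type := Fin P.s → EncCoin κ

/-- The randomness of the encryptions of the inputs. -/
abbrev InCoins (P : Params) (κ : ℕ) : Type := (Fin P.s → EncCoin κ) × (Fin P.s → EncCoin κ)

/-- Uniformly distributed randomness of `S₁`. -/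
def s1CoinsDist (P : Params) (κ : ℕ) : PMF (S1Coins P κ) :=
  (PMF.uniformOfFintype (EncCoin κ × (Fin P.s → Fin (2 ^ P.σ)) × (Fin P.s → Fin (2 ^ P.σ)) ×
    (Fin P.s → EncCoin κ) × (Fin P.s → EncCoin κ) × (Fin P.s → EncCoin κ) ×
    (Fin P.s → EncCoin κ))).map fun w =>
      ⟨w.1, w.2.1, w.2.2.1, w.2.2.2.1, w.2.2.2.2.1, w.2.2.2.2.2.1, w.2.2.2.2.2.2⟩

section Protocol

variable (P : Params) {κ : ℕ} (k : Keys)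

/-- The input of `S₁`: encryptions `⟦z_1⟧, …, ⟦z_s⟧`. -/
def encInput (z : Fin P.s → ℤ) (w : Fin P.s → EncCoin κ) (i : Fin P.s) : Ciphertext k.pk :=
  enc k.pk (z i) (w i)

/-- `⟦δ⟧`, computed by `S₁`. -/
def ctδ (c₁ : S1Coins P κ) : Ciphertext k.pk := enc k.pk P.δ c₁.encδ

/-- Step 1: `⟦C⟧ = ∏ ⟦X_i⟧^(L^(2i-1)) * ⟦Y_i⟧^(L^(2i-2))`, with `⟦X_i⟧ = ⟦x_i⟧ * ⟦δ⟧ * ⟦r_{i,1}⟧`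
and `⟦Y_i⟧ = ⟦y_i⟧ * ⟦δ⟧ * ⟦r_{i,2}⟧`; here `i` counts from `0`. -/
def packed (cx cy : Fin P.s → Ciphertext k.pk) (c₁ : S1Coins P κ) : Ciphertext k.pk :=
  ∏ i : Fin P.s,
    (cx i * ctδ P k c₁ * enc k.pk (c₁.r₁ i : ℕ) (c₁.encr₁ i)) ^ P.L ^ (2 * (i : ℕ) + 1) *
    (cy i * ctδ P k c₁ * enc k.pk (c₁.r₂ i : ℕ) (c₁.encr₂ i)) ^ P.L ^ (2 * (i : ℕ))

/-- The message `⟨⟦C⟧, ⟦C_1⟧⟩` of `S₁` to `S₂`. -/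
def msg₁ (cx cy : Fin P.s → Ciphertext k.pk) (c₁ : S1Coins P κ) :
    Ciphertext k.pk × Ciphertext k.pk :=
  (packed P k cx cy c₁, pdec k.sk₁ (packed P k cx cy c₁))

/-- Step 2: `c_i = ⌊(C mod L^(2i)) / L^(2(i-1))⌋`, where `C` is the threshold decryption of the
message received; here `i` counts from `0`. -/
def unpacked (m : Ciphertext k.pk × Ciphertext k.pk) (i : Fin P.s) : ℕ :=
  (tdec m.2 (pdec k.sk₂ m.1)).val % P.L ^ (2 * ((i : ℕ) + 1)) / P.L ^ (2 * (i : ℕ))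

/-- The message `⟦(x_i + r_{i,1}) (y_i + r_{i,2})⟧` of `S₂` to `S₁`, where `S₂` obtains the two
factors as `⌊c_i / L⌋ - δ` and `(c_i mod L) - δ`. -/
def msg₂ (m : Ciphertext k.pk × Ciphertext k.pk) (c₂ : S2Coins P κ) (i : Fin P.s) :
    Ciphertext k.pk :=
  enc k.pk ((((unpacked P k m i / P.L : ℕ) : ℤ) - P.δ) *
    (((unpacked P k m i % P.L : ℕ) : ℤ) - P.δ)) (c₂ i)

/-- Step 3: the output of `S₁`. -/
def output (cx cy : Fin P.s → Ciphertext k.pk) (c₁ : S1Coins P κ)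
    (e : Fin P.s → Ciphertext k.pk) (i : Fin P.s) : Ciphertext k.pk :=
  e i * (cx i * ctδ P k c₁) ^ (-((c₁.r₂ i : ℕ) : ℤ)) * (cy i * ctδ P k c₁) ^ (-((c₁.r₁ i : ℕ) : ℤ))
    * enc k.pk (-((c₁.r₁ i : ℕ) : ℤ) * (c₁.r₂ i : ℕ)) (c₁.encProd i)
    * enc k.pk (P.δ * (((c₁.r₁ i : ℕ) : ℤ) + (c₁.r₂ i : ℕ))) (c₁.encSum i)

/-- The output `⟦x_1 y_1⟧, …, ⟦x_s y_s⟧` of an execution of the protocol. -/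
def execute (x y : Fin P.s → ℤ) (w : InCoins P κ) (c₁ : S1Coins P κ) (c₂ : S2Coins P κ) :
    Fin P.s → Ciphertext k.pk :=
  output P k (encInput P k x w.1) (encInput P k y w.2) c₁
    (msg₂ P k (msg₁ P k (encInput P k x w.1) (encInput P k y w.2) c₁) c₂)

/-- The view of `S₁`: its keys, its input ciphertexts, its randomness and the message received.
(Everything that `S₁` computes is a function of these.) -/
def view₁ (x y : Fin P.s → ℤ) (w : InCoins P κ) (c₁ : S1Coins P κ) (c₂ : S2Coins P κ) : Val :=
  .ofList [k.pk.toVal, .num k.sk₁, .ofNat c₁.encδ,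
    .ofList (List.ofFn fun i => .ofList
      [ctVal (encInput P k x w.1 i), ctVal (encInput P k y w.2 i),
       .ofNat (c₁.r₁ i), .ofNat (c₁.r₂ i), .ofNat (c₁.encr₁ i), .ofNat (c₁.encr₂ i),
       .ofNat (c₁.encProd i), .ofNat (c₁.encSum i),
       ctVal (msg₂ P k (msg₁ P k (encInput P k x w.1) (encInput P k y w.2) c₁) c₂ i)])]

/-- The view of `S₂`: its keys, its randomness and the message received. -/
def view₂ (x y : Fin P.s → ℤ) (w : InCoins P κ) (c₁ : S1Coins P κ) (c₂ : S2Coins P κ) : Val :=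
  .ofList [k.pk.toVal, .num k.sk₂, .ofList (List.ofFn fun i => .ofNat (c₂ i)),
    ctVal (msg₁ P k (encInput P k x w.1) (encInput P k y w.2) c₁).1,
    ctVal (msg₁ P k (encInput P k x w.1) (encInput P k y w.2) c₁).2]

end Protocol

/-! ### Real and simulated views -/

/-- One of the two servers. -/
inductive Server : Type
  | S1 | S2

/-- The threshold key of a server. -/
def Server.key (S : Server) (k : Keys) : ℤ :=
  match S with
  | S1 => k.sk₁
  | S2 => k.sk₂

/-- The view of a server in an execution with honestly generated keys and freshly encrypted
inputs. -/
def realView (S : Server) (P : Params) (κ : ℕ) (x y : Fin P.s → ℤ) : PMF Val :=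
  (keyGen P κ).bind fun k => (PMF.uniformOfFintype (InCoins P κ)).bind fun w =>
    (s1CoinsDist P κ).bind fun c₁ => (PMF.uniformOfFintype (S2Coins P κ)).map fun c₂ =>
      match S with
      | .S1 => view₁ P k x y w c₁ c₂
      | .S2 => view₂ P k x y w c₁ c₂

/-- What a simulator is given: the public parameters, the public key and the threshold key of the
server. It gets nothing that depends on the plaintexts. -/
def simInput (S : Server) (P : Params) (k : Keys) : Val :=
  .ofList [.ofNat P.n, .ofNat P.ℓ, .ofNat P.σ, .ofNat P.L, .ofNat P.δ, .ofNat P.s,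
    k.pk.toVal, .num (S.key k)]

/-- The simulated view of a server. -/
def simView (Sim : Prog) (S : Server) (P : Params) (κ : ℕ) : PMF Val :=
  (keyGen P κ).bind fun k => (Sim.run (.pair (.ofNat κ) (simInput S P k))).map Prod.fst

/-- The plaintexts are in `[-2^ℓ, 2^ℓ]` and become nonnegative by the shift `δ`. -/
def Admissible (P : Params) (z : Fin P.s → ℤ) : Prop :=
  ∀ i, -(2 : ℤ) ^ P.ℓ ≤ z i ∧ z i ≤ 2 ^ P.ℓ ∧ -(P.δ : ℤ) ≤ z i

/-- Every output ciphertext decrypts to the product of the plaintexts (read as the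
representative of smallest absolute value modulo `N`), for all keys and all randomness. -/
def Correct (P : Params) (κ : ℕ) : Prop :=
  ∀ t : Factors, t.Accepted P.n κ → ∀ (y₀ : (ZMod t.N)ˣ) (sk₁ : Fin (2 ^ P.σ)),
  ∀ x y : Fin P.s → ℤ, Admissible P x → Admissible P y →
  ∀ (w : InCoins P κ) (c₁ : S1Coins P κ) (c₂ : S2Coins P κ) (i : Fin P.s),
    (dec (mkKeys P.η t y₀ sk₁).sk
      (execute P (mkKeys P.η t y₀ sk₁) x y w c₁ c₂ i)).valMinAbs = x i * y i

/-- Privacy against a semi-honest server: a probabilistic polynomial-time simulator, which does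
not depend on the plaintexts, produces the view of the server up to computational
indistinguishability. -/
def PrivateAgainst (S : Server) (par : ℕ → Params) : Prop :=
  ∃ Sim : Prog,
    PolyTimeOn Sim (fun κ => {v | ∃ k ∈ (keyGen (par κ) κ).support, v = simInput S (par κ) k}) ∧
    ∀ x y : ∀ κ, Fin (par κ).s → ℤ,
      (∀ κ, Admissible (par κ) (x κ)) → (∀ κ, Admissible (par κ) (y κ)) →
      CompIndist (fun κ => realView S (par κ) κ (x κ) (y κ)) (fun κ => simView Sim S (par κ) κ)

end BatchSMUL

end

namespace BatchSMUL

/-! ### The Paillier cryptosystem -/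

/-! Correctness. In `ZMod (N ^ 2)` the square of N vanishes, so (1 + N)^m = 1 + mN, and the N-th
power of a lifted unit depends only on its residue modulo N, so that u ↦ (u mod N)^N is a
homomorphism. Hence every ciphertext of the protocol has the form `encPow pk m R` with integers m
and R, and the homomorphic operations act linearly on both. As φ(N) = 2β · 2α, h^(2α) = 1, and an
exponent divisible by 2α removes R; this gives `dec_encPow` and, because sk₁ + sk₂ is 2α times an
inverse of 2α modulo N, also `tdec_encPow`. The parameter bounds keep the packed digits below L/2
and the packed integer below N (`packedSum_unpack`), so S₂ recovers exactly x + r₁ and y + r₂. The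
output is correct because (x + r₁)(y + r₂) - r₂(x + δ) - r₁(y + δ) - r₁r₂ + δ(r₁ + r₂) = xy, and
|xy| is less than N/2.

Privacy against S₁. Its key is independent of the public key, and by correctness of the unpacking
the message it receives is a fresh encryption of (x + r₁)(y + r₂). So its view is a function of the
public key, its own coins and 3s ciphertexts with independent randomness. The simulator encrypts
zeros instead. A hybrid over the 3s slots (`abs_accept_hybrid_le`) changes one ciphertext at a time;
the reduction is non-uniform: the hybrid, the slot and all randomness other than the key and the
challenge coin are fixed at the worst choice and given as advice, in the form of a template into
which the challenge is inserted.

Privacy against S₂. This is statistical. S₂ can compute sk₁ as (1 - sk₂) mod N, hence the second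
component of the message from the first. The packed ciphertext is an encryption of the packing of δ
+ x + r₁ and δ + y + r₂ with an explicit integer randomness, which the simulator reproduces exactly,
only with x = y = 0. Removing one summand changes any acceptance probability by at most 2^ℓ / 2^σ
(`abs_accept_mask_le`), and there are 2s of them.

The simulators and the reduction are actual programs. Their result distributions are computed with
`Prog.out`, and their running time with `PolyOn`. The latter composes because a program pays for the
size of its output (`Prog.size_le_cost`); only loops need an invariant, bounding the number of
rounds and the size of the state. -/

theorem natCast_mul_self_eq_zero (N : ℕ) : (N : ZMod (N ^ 2)) * N = 0 := by
  rw [← sq]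
  exact_mod_cast ZMod.natCast_self (N ^ 2)

theorem coe_onePlusN (N : ℕ) : ((onePlusN N : (ZMod (N ^ 2))ˣ) : ZMod (N ^ 2)) = 1 + N := by
  simp [onePlusN]

/-- The binomial expansion stops after the linear term because N² = 0; for negative exponents the
inverse of 1 + N is 1 - N. -/
theorem coe_onePlusN_zpow (N : ℕ) (m : ℤ) :
    ((onePlusN N ^ m : (ZMod (N ^ 2))ˣ) : ZMod (N ^ 2)) = 1 + m * N := by
  have h0 := natCast_mul_self_eq_zero N
  have hinv : ((onePlusN N)⁻¹ : (ZMod (N ^ 2))ˣ) = (1 - N : ZMod (N ^ 2)) := by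
    refine Units.inv_eq_of_mul_eq_one_right ?_
    rw [coe_onePlusN]
    linear_combination -h0
  induction m using Int.induction_on with
  | zero => simp
  | succ i ih =>
    rw [zpow_add_one, Units.val_mul, ih, coe_onePlusN]
    push_cast
    linear_combination (i : ZMod (N ^ 2)) * h0
  | pred i ih =>
    rw [zpow_sub_one, Units.val_mul, ih, hinv]
    push_cast
    linear_combination (i : ZMod (N ^ 2)) * h0

/-- If a ≡ b modulo N, then a^N ≡ b^N modulo N². This makes the N-th power of `liftUnit`
multiplicative, although lifting representatives is not. -/
theorem liftUnit_pow_congr {N : ℕ} [NeZero N] (u : (ZMod N)ˣ) (v : (ZMod (N ^ 2))ˣ)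
    (h : ((u : ZMod N).val : ℤ) ≡ ((v : ZMod (N ^ 2)).val : ℤ) [ZMOD N]) :
    liftUnit u ^ N = v ^ N := by
  ext
  have h1 := dvd_sub_pow_of_dvd_sub (R := ℤ) (p := N) (h.symm.dvd) 1
  rw [pow_one] at h1
  have h2 : (((u : ZMod N).val : ℤ) ^ N : ℤ) ≡ ((v : ZMod (N ^ 2)).val : ℤ) ^ N
      [ZMOD ((N ^ 2 : ℕ) : ℤ)] := by
    refine (Int.modEq_iff_dvd.2 ?_).symm
    push_cast
    simpa using h1
  have h3 := (ZMod.intCast_eq_intCast_iff _ _ _).2 h2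
  push_cast at h3
  have h4 : (((v : ZMod (N ^ 2)).val : ℕ) : ZMod (N ^ 2)) = v := by
    rw [ZMod.natCast_val, ZMod.cast_id]
  rw [h4] at h3
  simpa [liftUnit] using h3

/-- The homomorphism `u ↦ (u mod N)^N mod N²`. -/
def liftPow (N : ℕ) [NeZero N] : (ZMod N)ˣ →* (ZMod (N ^ 2))ˣ :=
  MonoidHom.mk' (fun u => liftUnit u ^ N) fun u v => by
    rw [← mul_pow]
    refine liftUnit_pow_congr _ _ ?_
    rw [← ZMod.intCast_eq_intCast_iff]
    have h : N ∣ N ^ 2 := Dvd.intro_left _ (by ring : N * N = N ^ 2)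
    have h1 : ∀ w : ZMod (N ^ 2), ((w.val : ℤ) : ZMod N) = ZMod.castHom h (ZMod N) w := by
      intro w
      simp
    rw [h1]
    simp [liftUnit, map_mul]

/-- The ciphertext `(1 + N)^m * (h^N)^R`. -/
def encPow (pk : PublicKey) [NeZero pk.N] (m R : ℤ) : Ciphertext pk :=
  onePlusN pk.N ^ m * liftPow pk.N pk.h ^ R

theorem logN_onePlusN_zpow (pk : PublicKey) (hN : 1 < pk.N) (m : ℤ) :
    logN (pk := pk) (onePlusN pk.N ^ m) = (m : ZMod pk.N) := by
  have hN0 : (0 : ℤ) < pk.N := by exact_mod_cast hN.le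
  -- The exponent is replaced by its residue j < N, so that 1 + jN is below N² and is itself the
  -- canonical representative; the natural-number subtraction and division in `logN` are then exact.
  obtain ⟨j, hj⟩ : ∃ j : ℕ, (j : ℤ) = m % pk.N :=
    ⟨(m % pk.N).toNat, Int.toNat_of_nonneg (Int.emod_nonneg _ hN0.ne')⟩
  have hjN : j < pk.N := by exact_mod_cast hj ▸ Int.emod_lt_of_pos m hN0
  have hmj : (m : ZMod pk.N) = j := by
    rw [← Int.cast_natCast, hj, ZMod.intCast_mod]
  have h1 : ((onePlusN pk.N ^ m : Ciphertext pk) : ZMod (pk.N ^ 2)) = ((1 + j * pk.N : ℕ) : _) := by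
    rw [coe_onePlusN_zpow]
    have : m = j + pk.N * (m / pk.N) := by rw [hj]; exact (Int.emod_add_mul_ediv m pk.N).symm
    conv_lhs => rw [this]
    push_cast
    linear_combination ((m / pk.N : ℤ) : ZMod (pk.N ^ 2)) * natCast_mul_self_eq_zero pk.N
  have h2 : 1 + j * pk.N < pk.N ^ 2 := by nlinarith
  rw [logN, h1, ZMod.val_natCast, Nat.mod_eq_of_lt h2, Nat.add_sub_cancel_left,
    Nat.mul_div_cancel _ hN.le, hmj]

section encPow

variable (pk : PublicKey) [NeZero pk.N]

theorem enc_eq_encPow (m : ℤ) (r : ℕ) : enc pk m r = encPow pk m r := by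
  have h : liftUnit (pk.h ^ r) ^ pk.N = liftPow pk.N (pk.h ^ r) := rfl
  rw [enc, encPow, h, map_pow, zpow_natCast]

theorem encPow_mul (m R m' R' : ℤ) :
    encPow pk m R * encPow pk m' R' = encPow pk (m + m') (R + R') := by
  simp only [encPow, zpow_add]
  exact mul_mul_mul_comm _ _ _ _

theorem encPow_zpow (m R e : ℤ) : encPow pk m R ^ e = encPow pk (m * e) (R * e) := by
  simp only [encPow, zpow_mul, mul_zpow]

theorem encPow_pow (m R : ℤ) (e : ℕ) : encPow pk m R ^ e = encPow pk (m * e) (R * e) := by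
  rw [← zpow_natCast, encPow_zpow]

theorem prod_encPow {ι : Type*} (S : Finset ι) (m R : ι → ℤ) :
    ∏ i ∈ S, encPow pk (m i) (R i) = encPow pk (∑ i ∈ S, m i) (∑ i ∈ S, R i) := by
  classical
  induction S using Finset.induction_on with
  | empty => simp [encPow]
  | insert a S ha ih => rw [Finset.prod_insert ha, Finset.sum_insert ha, Finset.sum_insert ha, ih,
      encPow_mul]

/-- The randomness enters only through powers of h^N, which a multiple of 2α annihilates. -/
theorem encPow_zpow_two_mul {α : ℕ} (hα : pk.h ^ (2 * α) = 1) (m R e : ℤ) :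
    encPow pk m R ^ (e * (2 * α : ℕ)) = onePlusN pk.N ^ (m * (e * (2 * α : ℕ))) := by
  have h : liftPow pk.N pk.h ^ ((2 * α : ℕ) : ℤ) = 1 := by
    rw [zpow_natCast, ← map_pow, hα, map_one]
  rw [encPow, mul_zpow, ← zpow_mul, ← zpow_mul, ← mul_assoc R e, mul_comm (R * e), zpow_mul _ _
    (R * e), h, one_zpow, mul_one]

theorem dec_encPow {α : ℕ} (hN : 1 < pk.N) (hα : pk.h ^ (2 * α) = 1)
    (hco : (2 * α).Coprime pk.N) (m R : ℤ) : dec α (encPow pk m R) = (m : ZMod pk.N) := by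
  have h := encPow_zpow_two_mul pk hα m R 1
  rw [one_mul, zpow_natCast] at h
  rw [dec, h, logN_onePlusN_zpow pk hN]
  have hu : ((2 * α : ℕ) : ZMod pk.N) * ((2 * α : ℕ) : ZMod pk.N)⁻¹ = 1 :=
    ZMod.coe_mul_inv_eq_one _ hco
  rw [Int.cast_mul, Int.cast_natCast, mul_assoc, hu, mul_one]

/-- The partial decryptions multiply to the power with exponent sk₁ + sk₂, a multiple of 2α that is
1 modulo N; the term with η vanishes modulo N. -/
theorem tdec_encPow {α : ℕ} (hN : 1 < pk.N) (hα : pk.h ^ (2 * α) = 1)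
    (hco : (2 * α).Coprime pk.N) (m R sk₁ sk₂ η : ℤ)
    (hsk : sk₁ + sk₂ = (((2 * α : ℕ) : ZMod pk.N)⁻¹).val * (2 * α) + η * (2 * α) * pk.N) :
    tdec (pdec sk₁ (encPow pk m R)) (pdec sk₂ (encPow pk m R)) = (m : ZMod pk.N) := by
  have hu : ((2 * α : ℕ) : ZMod pk.N)⁻¹ * ((2 * α : ℕ) : ZMod pk.N) = 1 := by
    rw [mul_comm]; exact ZMod.coe_mul_inv_eq_one _ hco
  have hs : sk₁ + sk₂ = ((((2 * α : ℕ) : ZMod pk.N)⁻¹).val + η * pk.N) * (2 * α : ℕ) := by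
    rw [hsk]; push_cast; ring
  rw [tdec, pdec, pdec, ← zpow_add, hs, encPow_zpow_two_mul pk hα, logN_onePlusN_zpow pk hN]
  have : ((((2 * α : ℕ) : ZMod pk.N)⁻¹).val : ZMod pk.N) = ((2 * α : ℕ) : ZMod pk.N)⁻¹ := by
    rw [ZMod.natCast_val, ZMod.cast_id]
  rw [Int.cast_mul, Int.cast_mul, Int.cast_add, Int.cast_natCast, this, Int.cast_natCast,
    Int.cast_mul η, Int.cast_natCast, ZMod.natCast_self, mul_zero, add_zero, hu, mul_one]

end encPow

/-! ### Generated keys -/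

namespace Factors

variable {n κ : ℕ} {t : Factors}

theorem Accepted.two_mul_p_lt (h : t.Accepted n κ) : t.p < 2 ^ (2 * κ) ∧ t.q < 2 ^ (2 * κ) ∧
    2 ^ (2 * κ) ≤ 2 * t.p ∧ 2 ^ (2 * κ) ≤ 2 * t.q := by
  obtain ⟨⟨hp, -, h1⟩, ⟨hq, -, h2⟩, -⟩ := h
  have aux : ∀ a : ℕ, a.Prime → a.size = 2 * κ → a < 2 ^ (2 * κ) ∧ 2 ^ (2 * κ) ≤ 2 * a := by
    intro a ha h
    refine ⟨Nat.size_le.1 h.le, ?_⟩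
    have hk : 0 < 2 * κ := by rw [← h]; exact Nat.size_pos.2 ha.pos
    obtain ⟨j, hj⟩ : ∃ j, 2 * κ = j + 1 := ⟨2 * κ - 1, by omega⟩
    have : 2 ^ j ≤ a := Nat.lt_size.1 (by omega)
    rw [hj, pow_succ]
    omega
  exact ⟨(aux _ hp h1).1, (aux _ hq h2).1, (aux _ hp h1).2, (aux _ hq h2).2⟩

theorem Accepted.pos_p' (h : t.Accepted n κ) : 0 < t.p' ∧ 0 < t.q' :=
  ⟨h.2.2.1.1.pos, h.2.2.2.1.1.pos⟩

theorem Accepted.one_lt_N (h : t.Accepted n κ) : 1 < t.N :=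
  one_lt_mul'' h.2.2.2.2.2.1.one_lt h.2.2.2.2.2.2.one_lt

/-- P and Q are odd primes, and each exceeds both p and q: since p and q have the same bit length, p
< 2q < Q and q < 2p < P. -/
theorem Accepted.coprime (h : t.Accepted n κ) : (2 * t.α).Coprime t.N := by
  obtain ⟨hp, hq, hp2, hq2⟩ := h.two_mul_p_lt
  obtain ⟨hp', hq'⟩ := h.pos_p'
  have hP : t.p < t.P ∧ t.q < t.P := by
    have : 2 * t.p ≤ 2 * t.p * t.p' := Nat.le_mul_of_pos_right _ hp'
    constructor <;> simp only [P] <;> omega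
  have hQ : t.p < t.Q ∧ t.q < t.Q := by
    have : 2 * t.q ≤ 2 * t.q * t.q' := Nat.le_mul_of_pos_right _ hq'
    constructor <;> simp only [Q] <;> omega
  have h2 : ∀ a, Nat.Coprime 2 (2 * a + 1) := fun a => by simp
  have hPp := h.2.2.2.2.2.1
  have hQp := h.2.2.2.2.2.2
  have hpp := h.1.1
  have hqp := h.2.1.1
  refine Nat.Coprime.mul_left ?_ (Nat.Coprime.mul_left ?_ ?_) <;> refine Nat.Coprime.mul_right ?_ ?_
  · simpa only [P, mul_assoc] using h2 _
  · simpa only [Q, mul_assoc] using h2 _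
  · exact (Nat.coprime_primes hpp hPp).2 hP.1.ne
  · exact (Nat.coprime_primes hpp hQp).2 hQ.1.ne
  · exact (Nat.coprime_primes hqp hPp).2 hP.2.ne
  · exact (Nat.coprime_primes hqp hQp).2 hQ.2.ne

/-- P = Q would give pp' = qq', impossible since p > 1 is coprime to q and q'. -/
theorem Accepted.P_ne_Q (h : t.Accepted n κ) : t.P ≠ t.Q := by
  intro hPQ
  have h1 : t.p * t.p' = t.q * t.q' := by simp only [P, Q, mul_assoc] at hPQ; omega
  have h2 := h.2.2.2.2.1
  simp only [List.pairwise_cons, List.mem_cons] at h2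
  have hpq : t.p.Coprime t.q := h2.1 _ (by simp)
  have hpq' : t.p.Coprime t.q' := h2.1 _ (by simp)
  have h3 : t.p ∣ 1 := by
    have := hpq.mul_right hpq'
    rw [← h1] at this
    exact (Nat.Coprime.eq_one_of_dvd this (Dvd.intro _ rfl)).dvd
  exact h.1.1.one_lt.ne' (Nat.dvd_one.1 h3)

/-- β = p'q', so 2β · 2α = 4pqp'q' = φ(N) and Euler's theorem applies to y; the sign disappears
because 2α is even. -/
theorem Accepted.h_pow (h : t.Accepted n κ) (y : (ZMod t.N)ˣ) :
    (-y ^ (2 * t.β)) ^ (2 * t.α) = 1 := by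
  have hβ : t.β = t.p' * t.q' := by
    simp only [β, P, Q, Nat.add_sub_cancel]
    rw [show 2 * t.p * t.p' * (2 * t.q * t.q') = 4 * t.p * t.q * (t.p' * t.q') by ring]
    exact Nat.mul_div_cancel_left _
      (Nat.mul_pos (Nat.mul_pos (by norm_num) h.1.1.pos) h.2.1.1.pos)
  have htot : Nat.totient t.N = (2 * t.β) * (2 * t.α) := by
    rw [N, Nat.totient_mul ((Nat.coprime_primes h.2.2.2.2.2.1 h.2.2.2.2.2.2).2 h.P_ne_Q),
      Nat.totient_prime h.2.2.2.2.2.1, Nat.totient_prime h.2.2.2.2.2.2, hβ]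
    simp only [P, Q, α, Nat.add_sub_cancel]
    ring
  rw [Even.neg_pow (by simp), ← pow_mul, ← htot, ZMod.pow_totient]

theorem Accepted.size_N_le (h : t.Accepted n κ) : t.N.size ≤ n := by
  obtain ⟨hp, hq, -⟩ := h.two_mul_p_lt
  obtain ⟨hp', hq'⟩ := h.pos_p'
  set d := (n - 4 * κ) / 2 - 1 with hd
  have h1 : t.p' < 2 ^ d := Nat.size_le.1 h.2.2.1.2.le
  have h2 : t.q' < 2 ^ d := Nat.size_le.1 h.2.2.2.1.2.le
  have hdpos : 0 < d := by
    rw [hd, ← h.2.2.1.2]; exact Nat.size_pos.2 hp'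
  have aux : ∀ a b : ℕ, a < 2 ^ (2 * κ) → b < 2 ^ d → 2 * a * b + 1 < 2 ^ (2 * κ + d + 1) := by
    intro a b ha hb
    have : a * b + 1 ≤ 2 ^ (2 * κ) * 2 ^ d := by
      rcases Nat.eq_zero_or_pos b with rfl | hb0
      · rw [mul_zero, zero_add]; exact Nat.mul_pos (by positivity) (by positivity)
      · calc a * b + 1 ≤ a * b + b := by omega
          _ = (a + 1) * b := by ring
          _ ≤ _ := Nat.mul_le_mul ha hb.le
    rw [pow_succ, pow_add]
    nlinarith
  have hP := aux _ _ hp h1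
  have hQ := aux _ _ hq h2
  rw [Nat.size_le]
  calc t.N < 2 ^ (2 * κ + d + 1) * 2 ^ (2 * κ + d + 1) := Nat.mul_lt_mul'' hP hQ
    _ = 2 ^ (2 * (2 * κ + d + 1)) := by rw [← pow_add]; ring_nf
    _ ≤ 2 ^ n := Nat.pow_le_pow_right (by norm_num) (by omega)

end Factors

instance (η : ℤ) (t : Factors) (y : (ZMod t.N)ˣ) (sk₁ : ℕ) : NeZero (mkKeys η t y sk₁).pk.N :=
  inferInstanceAs (NeZero t.N)

theorem mkKeys_sk₁_add_sk₂ (η : ℤ) (t : Factors) (y : (ZMod t.N)ˣ) (sk₁ : ℕ) :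
    (mkKeys η t y sk₁).sk₁ + (mkKeys η t y sk₁).sk₂ =
      (((2 * t.α : ℕ) : ZMod t.N)⁻¹).val * (2 * t.α) + η * (2 * t.α) * t.N := by
  simp only [mkKeys]
  ring

/-! ### Correctness of the protocol -/

/-- The integer `∑ X_i L^(2i+1) + Y_i L^(2i)`. -/
def packedSum (L : ℕ) {s : ℕ} (X Y : Fin s → ℤ) : ℤ :=
  ∑ i, (X i * (L : ℤ) ^ (2 * (i : ℕ) + 1) + Y i * (L : ℤ) ^ (2 * (i : ℕ)))

/-- The randomness is packed with the same powers of L as the plaintext. It is kept as an integer,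
which the simulator for S₂ can compute without knowing the order of h. -/
theorem packed_encInput (P : Params) {κ : ℕ} (k : Keys) [NeZero k.pk.N] (x y : Fin P.s → ℤ)
    (w : InCoins P κ) (c₁ : S1Coins P κ) :
    packed P k (encInput P k x w.1) (encInput P k y w.2) c₁ = encPow k.pk
      (packedSum P.L (fun i => x i + P.δ + (c₁.r₁ i : ℕ)) (fun i => y i + P.δ + (c₁.r₂ i : ℕ)))
      (packedSum P.L (fun i => (w.1 i : ℕ) + (c₁.encδ : ℕ) + (c₁.encr₁ i : ℕ))
        (fun i => (w.2 i : ℕ) + (c₁.encδ : ℕ) + (c₁.encr₂ i : ℕ))) := by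
  simp only [packed, encInput, ctδ, enc_eq_encPow, encPow_mul, encPow_pow, prod_encPow, packedSum]
  simp

/-- The digits of a number in base `B` from their sum. -/
theorem sum_mul_pow_div_mod {s B : ℕ} (D : Fin s → ℕ) (hD : ∀ i, D i < B) (j : Fin s) :
    (∑ i, D i * B ^ (i : ℕ)) / B ^ (j : ℕ) % B = D j := by
  have := congrArg Fin.val (congrFun (finFunctionFinEquiv.left_inv fun i => (⟨D i, hD i⟩ : Fin B)) j)
  simpa [finFunctionFinEquiv] using this

theorem sum_mul_pow_lt {s B : ℕ} (D : Fin s → ℕ) (hD : ∀ i, D i < B) :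
    ∑ i, D i * B ^ (i : ℕ) < B ^ s := by
  have := (finFunctionFinEquiv fun i => (⟨D i, hD i⟩ : Fin B)).isLt
  simpa [finFunctionFinEquiv] using this

theorem pow_size_le_two_mul {N : ℕ} (hN : 0 < N) : 2 ^ N.size ≤ 2 * N := by
  obtain ⟨j, hj⟩ : ∃ j, N.size = j + 1 := ⟨N.size - 1, by have := Nat.size_pos.2 hN; omega⟩
  have : 2 ^ j ≤ N := Nat.lt_size.1 (by omega)
  rw [hj, pow_succ]
  omega

theorem packedSum_unpack {L s N : ℕ} {X Y : Fin s → ℤ} (hN : 0 < N)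
    (hs : s ≤ N.size / (2 * L.size))
    (hX : ∀ i, 0 ≤ X i ∧ 2 * X i + 2 ≤ L) (hY : ∀ i, 0 ≤ Y i ∧ 2 * Y i + 2 ≤ L) (j : Fin s) :
    ((((packedSum L X Y : ℤ) : ZMod N).val % L ^ (2 * ((j : ℕ) + 1)) / L ^ (2 * (j : ℕ)) / L : ℕ)
      : ℤ) = X j ∧
    ((((packedSum L X Y : ℤ) : ZMod N).val % L ^ (2 * ((j : ℕ) + 1)) / L ^ (2 * (j : ℕ)) % L : ℕ)
      : ℤ) = Y j := by
  choose a ha using fun i => Int.eq_ofNat_of_zero_le (hX i).1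
  choose b hb using fun i => Int.eq_ofNat_of_zero_le (hY i).1
  have ha2 : ∀ i, 2 * a i + 2 ≤ L := fun i => by have := (hX i).2; rw [ha] at this; exact_mod_cast this
  have hb2 : ∀ i, 2 * b i + 2 ≤ L := fun i => by have := (hY i).2; rw [hb] at this; exact_mod_cast this
  have hD : ∀ i, 2 * (a i * L + b i) < L ^ 2 := fun i => by nlinarith [ha2 i, hb2 i]
  set C := ∑ i, (a i * L + b i) * (L ^ 2) ^ (i : ℕ) with hC
  have hCs : packedSum L X Y = (C : ℤ) := by
    rw [packedSum, hC]
    push_cast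
    refine Finset.sum_congr rfl fun i _ => ?_
    rw [ha, hb, ← pow_mul, pow_succ]
    ring
  -- Each digit in base L² is below L²/2, so 2C < L^(2s) ≤ 2^|N| ≤ 2N; the factor 2 pays for the gap
  -- between N and 2^|N|.
  have hCN : C < N := by
    have h1 := sum_mul_pow_lt _ hD
    have h2 : ∑ i, 2 * (a i * L + b i) * (L ^ 2) ^ (i : ℕ) = 2 * C := by
      rw [hC, Finset.mul_sum]
      exact Finset.sum_congr rfl fun i _ => mul_assoc _ _ _
    rw [h2] at h1
    have h3 : (L ^ 2) ^ s ≤ 2 ^ N.size := by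
      calc (L ^ 2) ^ s = L ^ (2 * s) := (pow_mul _ _ _).symm
        _ ≤ (2 ^ L.size) ^ (2 * s) := Nat.pow_le_pow_left (Nat.lt_size_self L).le _
        _ = 2 ^ (s * (2 * L.size)) := by rw [← pow_mul]; ring_nf
        _ ≤ 2 ^ N.size := Nat.pow_le_pow_right (by norm_num)
          ((Nat.mul_le_mul_right _ hs).trans (Nat.div_mul_le_self _ _))
    have := pow_size_le_two_mul hN
    omega
  have hval : ((packedSum L X Y : ℤ) : ZMod N).val = C := by
    rw [hCs, Int.cast_natCast, ZMod.val_natCast, Nat.mod_eq_of_lt hCN]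
  have hLpos : 0 < L := by have := ha2 j; omega
  have hdig : C % L ^ (2 * ((j : ℕ) + 1)) / L ^ (2 * (j : ℕ)) = a j * L + b j := by
    rw [mul_add, mul_one, pow_add, Nat.mod_mul_right_div_self, pow_mul]
    exact sum_mul_pow_div_mod _ (fun i => by have := hD i; omega) j
  have hbL : b j < L := by have := hb2 j; omega
  rw [hval, hdig, ha, hb]
  constructor
  · rw [mul_comm, Nat.mul_add_div hLpos, Nat.div_eq_of_lt hbL, add_zero]
  · rw [mul_comm, Nat.mul_add_mod, Nat.mod_eq_of_lt hbL]

/-- The conditions on the parameters for a single security parameter. -/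
structure Params.Valid (P : Params) (κ : ℕ) : Prop where
  one_le_s : 1 ≤ P.s
  s_le : ∀ t : Factors, t.Accepted P.n κ → P.s ≤ t.N.size / (2 * P.L.size)
  ℓ_lt : P.ℓ < P.σ
  le_L : 2 ^ (P.σ + 2) ≤ P.L
  δ_le : P.δ ≤ 2 ^ P.ℓ

namespace Params.Valid

variable {P : Params} {κ : ℕ}

theorem size_L (hP : P.Valid κ) : P.σ + 3 ≤ P.L.size := Nat.lt_size.2 hP.le_L

theorem size_N (hP : P.Valid κ) {t : Factors} (ht : t.Accepted P.n κ) :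
    2 * P.L.size ≤ t.N.size ∧ P.s ≤ t.N.size := by
  have h := hP.s_le t ht
  have h1 := hP.one_le_s
  have h2 := hP.size_L
  have h3 : 1 ≤ t.N.size / (2 * P.L.size) := h1.trans h
  exact ⟨(Nat.one_le_div_iff (by omega)).1 h3, h.trans (Nat.div_le_self _ _)⟩

/-- One pair needs 2|L| bits, and |L| ≥ σ + 3, so N has at least 2σ + 6 bits. -/
theorem two_pow_lt_N (hP : P.Valid κ) {t : Factors} (ht : t.Accepted P.n κ) :
    2 ^ (2 * P.σ + 5) ≤ t.N := by
  refine Nat.lt_size.1 ?_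
  have := hP.size_L
  have := (hP.size_N ht).1
  omega

theorem natAbs_add_lt (hP : P.Valid κ) {z : Fin P.s → ℤ} (hz : Admissible P z) (i : Fin P.s)
    (r : Fin (2 ^ P.σ)) : (z i + (r : ℕ)).natAbs < 2 ^ (P.σ + 1) := by
  obtain ⟨h1, h2, -⟩ := hz i
  have h3 : (2 : ℤ) ^ P.ℓ ≤ 2 ^ P.σ := pow_le_pow_right₀ (by norm_num) hP.ℓ_lt.le
  have h4 : ((r : ℕ) : ℤ) < 2 ^ P.σ := by exact_mod_cast r.isLt
  zify
  rw [abs_lt, pow_succ]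
  constructor <;> linarith [Int.natCast_nonneg (r : ℕ)]

/-- With r + 1 ≤ 2^σ and 2 · 2^ℓ ≤ 2^σ, twice z + δ + r + 1 is at most 2 · (2^σ + 2^σ) = 2^(σ+2) ≤
L. -/
theorem digit_bounds (hP : P.Valid κ) {z : Fin P.s → ℤ} (hz : Admissible P z) (i : Fin P.s)
    (r : Fin (2 ^ P.σ)) :
    0 ≤ z i + P.δ + (r : ℕ) ∧ 2 * (z i + P.δ + (r : ℕ)) + 2 ≤ P.L := by
  obtain ⟨-, h2, h3⟩ := hz i
  have h5 : (2 : ℤ) ^ (P.ℓ + 1) ≤ 2 ^ P.σ := pow_le_pow_right₀ (by norm_num) hP.ℓ_lt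
  have h4 : ((r : ℕ) : ℤ) + 1 ≤ 2 ^ P.σ := by exact_mod_cast r.isLt
  have h6 : (P.δ : ℤ) ≤ 2 ^ P.ℓ := by exact_mod_cast hP.δ_le
  have h7 : (2 : ℤ) ^ (P.σ + 2) ≤ P.L := by exact_mod_cast hP.le_L
  rw [pow_succ] at h5
  rw [pow_add] at h7
  constructor <;> linarith [Int.natCast_nonneg (r : ℕ)]

/-- What the second server sends to the first one. -/
theorem msg₂_msg₁ (hP : P.Valid κ) {t : Factors} (ht : t.Accepted P.n κ) (y₀ : (ZMod t.N)ˣ)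
    (sk₁ : ℕ) {x y : Fin P.s → ℤ} (hx : Admissible P x) (hy : Admissible P y) (w : InCoins P κ)
    (c₁ : S1Coins P κ) (c₂ : S2Coins P κ) (i : Fin P.s) :
    msg₂ P (mkKeys P.η t y₀ sk₁) (msg₁ P (mkKeys P.η t y₀ sk₁)
      (encInput P (mkKeys P.η t y₀ sk₁) x w.1) (encInput P (mkKeys P.η t y₀ sk₁) y w.2) c₁) c₂ i =
    enc (mkKeys P.η t y₀ sk₁).pk ((x i + (c₁.r₁ i : ℕ)) * (y i + (c₁.r₂ i : ℕ))) (c₂ i) := by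
  set k := mkKeys P.η t y₀ sk₁ with hk
  have h := packedSum_unpack (L := P.L) (zero_lt_one.trans ht.one_lt_N) (hP.s_le t ht)
    (fun i => hP.digit_bounds hx i (c₁.r₁ i)) (fun i => hP.digit_bounds hy i (c₁.r₂ i)) i
  have htd := tdec_encPow k.pk ht.one_lt_N (ht.h_pow y₀) ht.coprime
    (packedSum P.L (fun i => x i + P.δ + (c₁.r₁ i : ℕ)) (fun i => y i + P.δ + (c₁.r₂ i : ℕ)))
    (packedSum P.L (fun i => (w.1 i : ℕ) + (c₁.encδ : ℕ) + (c₁.encr₁ i : ℕ))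
        (fun i => (w.2 i : ℕ) + (c₁.encδ : ℕ) + (c₁.encr₂ i : ℕ))) _ _ _
    (mkKeys_sk₁_add_sk₂ P.η t y₀ sk₁)
  rw [← packed_encInput] at htd
  rw [msg₂, unpacked, msg₁]
  simp only
  rw [htd]
  -- The moduli `t.N` and `k.pk.N` agree only after unfolding `mkKeys`.
  erw [h.1, h.2]
  congr 1
  ring

theorem correct (hP : P.Valid κ) : Correct P κ := by
  intro t ht y₀ sk₁ x y hx hy w c₁ c₂ i
  have hm := hP.msg₂_msg₁ ht y₀ sk₁ hx hy w c₁ c₂ i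
  set k := mkKeys P.η t y₀ sk₁ with hk
  have hout : ∃ R, execute P k x y w c₁ c₂ i = encPow k.pk (x i * y i) R := by
    rw [execute, output, hm]
    simp only [encInput, ctδ, enc_eq_encPow, encPow_mul, encPow_zpow]
    refine ⟨_, congrArg₂ _ ?_ rfl⟩
    ring
  obtain ⟨R, hR⟩ := hout
  have hd : dec k.sk (encPow k.pk (x i * y i) R) = ((x i * y i : ℤ) : ZMod k.pk.N) :=
    dec_encPow k.pk ht.one_lt_N (ht.h_pow y₀) ht.coprime _ R
  rw [hR, hd, ZMod.valMinAbs_spec]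
  refine ⟨rfl, ?_⟩
  -- |xy| ≤ 2^(2σ) while N ≥ 32 · 2^(2σ), so the product is its own representative of smallest
  -- absolute value.
  have hN : ((2 : ℤ) ^ (2 * P.σ + 5)) ≤ k.pk.N := by exact_mod_cast hP.two_pow_lt_N ht
  have hb : ∀ z : Fin P.s → ℤ, Admissible P z → |z i| ≤ 2 ^ P.σ := fun z hz =>
    (abs_le.2 ⟨(hz i).1, (hz i).2.1⟩).trans (pow_le_pow_right₀ (by norm_num) hP.ℓ_lt.le)
  have hxy : |x i * y i| ≤ 2 ^ P.σ * 2 ^ P.σ := by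
    rw [abs_mul]
    exact mul_le_mul (hb x hx) (hb y hy) (abs_nonneg _) (by positivity)
  rw [← pow_add, ← two_mul] at hxy
  rw [pow_add] at hN
  have hpos : (0 : ℤ) < 2 ^ (2 * P.σ) := by positivity
  obtain ⟨h1, h2⟩ := abs_le.1 hxy
  constructor <;> linarith

end Params.Valid

/-! ### Results of programs -/

/-- The distribution of the result of a program. -/
noncomputable def Prog.out (f : Prog) (v : Val) : PMF Val := (f.run v).map Prod.fst

/-- Run `step` consecutively `k` times. -/
noncomputable def iterOut (step : Val → PMF Val) : ℕ → Val → PMF Val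
  | 0, v => PMF.pure v
  | k + 1, v => (step v).bind (iterOut step k)

namespace Prog

theorem out_id (v : Val) : Prog.id.out v = PMF.pure v := by simp [out, run, PMF.pure_map]

theorem out_const (z : ℤ) (v : Val) : (const z).out v = PMF.pure (.num z) := by
  simp [out, run, PMF.pure_map]

theorem out_fst (v : Val) : Prog.fst.out v = PMF.pure v.fst := by simp [out, run, PMF.pure_map]

theorem out_snd (v : Val) : Prog.snd.out v = PMF.pure v.snd := by simp [out, run, PMF.pure_map]

theorem out_arith (o : Arith) (v : Val) :
    (arith o).out v = PMF.pure (.num (o.eval v.fst.toInt v.snd.toInt)) := by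
  simp [out, run, PMF.pure_map]

theorem out_coin (v : Val) :
    coin.out v = (PMF.uniformOfFintype Bool).map fun b => .num (if b then 1 else 0) := by
  simp [out, run, PMF.map_comp, Function.comp_def]

theorem out_pair (f g : Prog) (v : Val) :
    (pair f g).out v = (f.out v).bind fun a => (g.out v).map (Val.pair a) := by
  simp [out, run, PMF.map_comp, PMF.map_bind, PMF.bind_map, Function.comp_def]

theorem out_comp (f g : Prog) (v : Val) : (comp f g).out v = (f.out v).bind g.out := by
  have : g.out = fun v => (g.run v).map Prod.fst := rfl
  rw [this]
  simp [out, run, PMF.map_comp, PMF.map_bind, PMF.bind_map, Function.comp_def]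

theorem out_ifPos (c f g : Prog) (v : Val) :
    (ifPos c f g).out v = (c.out v).bind fun a => if 0 < a.toInt then f.out v else g.out v := by
  simp only [out, run, PMF.map_comp, PMF.map_bind, PMF.bind_map, Function.comp_def]
  congr 1
  funext a
  split_ifs <;> rfl

theorem iterate_map_fst (step : Val → PMF (Val × ℕ)) (k : ℕ) (v : Val) :
    (iterate step k v).map Prod.fst = iterOut (fun v => (step v).map Prod.fst) k v := by
  induction k generalizing v with
  | zero => simp [iterate, iterOut, PMF.pure_map]
  | succ k ih =>
    simp only [iterate, iterOut, PMF.map_bind, PMF.map_comp, PMF.bind_map, Function.comp_def, ← ih]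

theorem out_loop (f : Prog) (v : Val) :
    (loop f).out v = iterOut f.out v.fst.toInt.toNat v.snd := by
  have : f.out = fun v => (f.run v).map Prod.fst := rfl
  rw [this, ← iterate_map_fst]
  simp [out, run, PMF.map_comp, Function.comp_def]

theorem mem_support_out {f : Prog} {v : Val} {o : Val × ℕ} (h : o ∈ (f.run v).support) :
    o.1 ∈ (f.out v).support :=
  (PMF.mem_support_map_iff _ _ _).2 ⟨o, h, rfl⟩

end Prog

/-! ### Running times -/

namespace Val

theorem one_le_size (v : Val) : 1 ≤ v.size := by cases v <;> simp only [size] <;> omega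

theorem size_fst_add_size_snd_le (v : Val) : v.fst.size + v.snd.size ≤ v.size + 1 := by
  cases v with
  | num z => simp [fst, snd, size]
  | pair a b => simp only [fst, snd, size]; omega

theorem size_toInt_le (v : Val) : 1 + v.toInt.natAbs.size ≤ v.size := by
  cases v with
  | num z => simp [toInt, size]
  | pair a b => simp only [toInt, size, Int.natAbs_zero, Nat.size_zero]; omega

end Val

/-- The worst cases are the product, whose bits add up, and the carry of a sum. The total is covered
by the instruction's charge for its operand pair. -/
theorem Arith.size_eval_le (o : Arith) (a b : ℤ) :
    (o.eval a b).natAbs.size ≤ a.natAbs.size + b.natAbs.size + 1 := by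
  have ha := Nat.lt_size_self a.natAbs
  have hb := Nat.lt_size_self b.natAbs
  set x := a.natAbs.size
  set y := b.natAbs.size
  have hx : 1 ≤ 2 ^ x := Nat.one_le_two_pow
  have hy : 1 ≤ 2 ^ y := Nat.one_le_two_pow
  rw [Nat.size_le, pow_succ, pow_add]
  have hsum : a.natAbs + b.natAbs < 2 ^ x * 2 ^ y * 2 := by nlinarith
  cases o with
  | add => exact (Int.natAbs_add_le a b).trans_lt hsum
  | sub => exact (Int.natAbs_sub_le a b).trans_lt hsum
  | mul =>
    rw [eval, Int.natAbs_mul]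
    exact (Nat.mul_lt_mul'' ha hb).trans_le (Nat.le_mul_of_pos_right _ (by norm_num))
  | div => exact ((Int.natAbs_ediv_le_natAbs a b).trans (Nat.le_add_right _ _)).trans_lt hsum
  | mod =>
    rw [eval]
    split_ifs with h
    · simp
    · have h1 := Int.emod_nonneg a h
      have h2 := Int.emod_lt_abs a h
      have : (a % b).natAbs < b.natAbs := by zify; rwa [abs_of_nonneg h1]
      omega

/-- The size of v is needed for the case of no rounds, which costs nothing. -/
theorem size_le_cost_iterate {step : Val → PMF (Val × ℕ)}
    (h : ∀ v, ∀ o ∈ (step v).support, o.1.size ≤ o.2) (k : ℕ) (v : Val) :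
    ∀ o ∈ (iterate step k v).support, o.1.size ≤ v.size + o.2 := by
  induction k generalizing v with
  | zero => simp [iterate]
  | succ k ih =>
    intro o ho
    simp only [iterate, PMF.mem_support_bind_iff, PMF.mem_support_map_iff] at ho
    obtain ⟨a, ha, b, hb, rfl⟩ := ho
    have := h v a ha
    have := ih a.1 b hb
    simp only
    omega

/-- Every instruction is charged for its data, hence for what it writes. Consequently a time bound
for a program is a size bound for the input of the program that follows it. -/
theorem Prog.size_le_cost (f : Prog) (v : Val) : ∀ o ∈ (f.run v).support, o.1.size ≤ o.2 := by
  have hv := v.one_le_size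
  have hfs := v.size_fst_add_size_snd_le
  induction f generalizing v with
  | id => intro o ho; simp only [run, PMF.mem_support_pure_iff] at ho; subst ho; simp
  | const z =>
    intro o ho; simp only [run, PMF.mem_support_pure_iff] at ho; subst ho
    simp only [Val.size]; omega
  | fst =>
    intro o ho; simp only [run, PMF.mem_support_pure_iff] at ho; subst ho
    have := v.snd.one_le_size
    simp only; omega
  | snd =>
    intro o ho; simp only [run, PMF.mem_support_pure_iff] at ho; subst ho
    have := v.fst.one_le_size
    simp only; omega
  | isPair =>
    intro o ho; simp only [run, PMF.mem_support_pure_iff] at ho; subst ho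
    have := Nat.size_one
    cases v <;> simp only [Val.isPair, Val.size, Int.natAbs_zero, Int.natAbs_one, Nat.size_zero] <;>
      omega
  | arith a =>
    intro o ho; simp only [run, PMF.mem_support_pure_iff] at ho; subst ho
    have h1 := a.size_eval_le v.fst.toInt v.snd.toInt
    have h2 := v.fst.size_toInt_le
    have h3 := v.snd.size_toInt_le
    simp only [Val.size]
    omega
  | coin =>
    intro o ho
    simp only [run, PMF.mem_support_map_iff] at ho
    obtain ⟨b, -, rfl⟩ := ho
    have := Nat.size_one
    cases b <;> simp only [Val.size, Bool.false_eq_true, if_true, if_false, Int.natAbs_zero,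
      Int.natAbs_one, Nat.size_zero] <;> omega
  | pair f g ihf ihg =>
    intro o ho
    simp only [run, PMF.mem_support_bind_iff, PMF.mem_support_map_iff] at ho
    obtain ⟨a, ha, b, hb, rfl⟩ := ho
    have := ihf v hv hfs a ha
    have := ihg v hv hfs b hb
    simp only [Val.size]
    omega
  | comp f g ihf ihg =>
    intro o ho
    simp only [run, PMF.mem_support_bind_iff, PMF.mem_support_map_iff] at ho
    obtain ⟨a, ha, b, hb, rfl⟩ := ho
    have := ihg a.1 a.1.one_le_size a.1.size_fst_add_size_snd_le b hb
    simp only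
    omega
  | ifPos c f g ihc ihf ihg =>
    intro o ho
    simp only [run, PMF.mem_support_bind_iff, PMF.mem_support_map_iff] at ho
    obtain ⟨a, ha, b, hb, rfl⟩ := ho
    have : b.1.size ≤ b.2 := by
      split_ifs at hb
      · exact ihf v hv hfs b hb
      · exact ihg v hv hfs b hb
    simp only
    omega
  | loop f ih =>
    intro o ho
    simp only [run, PMF.mem_support_map_iff] at ho
    obtain ⟨b, hb, rfl⟩ := ho
    have := size_le_cost_iterate
      (fun v => ih v v.one_le_size v.size_fst_add_size_snd_le) _ _ b hb
    have := v.fst.one_le_size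
    simp only
    omega

/-! ### Closure properties of polynomially bounded functions. -/

namespace PolyBounded

variable {f g : ℕ → ℕ}

theorem mono (hg : PolyBounded g) (h : ∀ m, f m ≤ g m) : PolyBounded f :=
  hg.imp fun _ hp m => (h m).trans (hp m)

theorem const (c : ℕ) : PolyBounded fun _ => c := ⟨Polynomial.C c, fun m => by simp⟩

theorem id : PolyBounded fun m => m := ⟨Polynomial.X, fun m => by simp⟩

theorem add (hf : PolyBounded f) (hg : PolyBounded g) : PolyBounded fun m => f m + g m := by
  obtain ⟨p, hp⟩ := hf
  obtain ⟨q, hq⟩ := hg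
  exact ⟨p + q, fun m => by rw [Polynomial.eval_add]; exact add_le_add (hp m) (hq m)⟩

theorem mul (hf : PolyBounded f) (hg : PolyBounded g) : PolyBounded fun m => f m * g m := by
  obtain ⟨p, hp⟩ := hf
  obtain ⟨q, hq⟩ := hg
  exact ⟨p * q, fun m => by rw [Polynomial.eval_mul]; exact Nat.mul_le_mul (hp m) (hq m)⟩

theorem eval_mono (p : Polynomial ℕ) {a b : ℕ} (h : a ≤ b) : p.eval a ≤ p.eval b := by
  rw [Polynomial.eval_eq_sum, Polynomial.eval_eq_sum]
  exact Finset.sum_le_sum fun i _ => Nat.mul_le_mul_left _ (Nat.pow_le_pow_left h i)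

theorem eval_comp (p : Polynomial ℕ) (hf : PolyBounded f) : PolyBounded fun m => p.eval (f m) := by
  obtain ⟨q, hq⟩ := hf
  exact ⟨p.comp q, fun m => by rw [Polynomial.eval_comp]; exact eval_mono p (hq m)⟩

/-- The finitely many exceptional values are absorbed by a constant. -/
theorem of_eventually (hg : PolyBounded g) (h : ∀ᶠ m in Filter.atTop, f m ≤ g m) :
    PolyBounded f := by
  obtain ⟨n, hn⟩ := Filter.eventually_atTop.1 h
  refine (hg.add (const (∑ i ∈ Finset.range n, f i))).mono fun m => ?_
  rcases le_or_gt n m with hm | hm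
  · exact (hn m hm).trans (Nat.le_add_right _ _)
  · exact (Finset.single_le_sum (f := f) (fun _ _ => Nat.zero_le _)
      (Finset.mem_range.2 hm)).trans (Nat.le_add_left _ _)

end PolyBounded

/-- The data in `I m` have size polynomial in `m`. -/
def SizeBdd (I : ℕ → Set Val) : Prop := ∃ B, PolyBounded B ∧ ∀ m, ∀ v ∈ I m, v.size ≤ B m

/-- On inputs in `I m` the program runs in time polynomial in `m`. -/
def PolyOn (f : Prog) (I : ℕ → Set Val) : Prop :=
  ∃ T, PolyBounded T ∧ ∀ m, ∀ v ∈ I m, ∀ o ∈ (f.run v).support, o.2 ≤ T m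

/-- Every possible result on an input in `I m` is in `J m`. -/
def MapsInto (f : Prog) (I J : ℕ → Set Val) : Prop :=
  ∀ m, ∀ v ∈ I m, ∀ w ∈ (f.out v).support, w ∈ J m

/-- Programs without loops. -/
def Prog.LoopFree : Prog → Prop
  | .pair f g => f.LoopFree ∧ g.LoopFree
  | .comp f g => f.LoopFree ∧ g.LoopFree
  | .ifPos c f g => c.LoopFree ∧ f.LoopFree ∧ g.LoopFree
  | .loop _ => False
  | _ => True

theorem SizeBdd.mono {I J : ℕ → Set Val} (h : SizeBdd J) (hIJ : ∀ m, I m ⊆ J m) : SizeBdd I :=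
  h.imp fun _ hB => ⟨hB.1, fun m v hv => hB.2 m v (hIJ m hv)⟩

/-! ### Rules for polynomial running time. -/

namespace PolyOn

variable {I J : ℕ → Set Val} {f g c : Prog}

theorem comp (hf : PolyOn f I) (hfJ : MapsInto f I J) (hg : PolyOn g J) :
    PolyOn (.comp f g) I := by
  obtain ⟨T, hT, hfT⟩ := hf
  obtain ⟨U, hU, hgU⟩ := hg
  refine ⟨_, ((PolyBounded.const 1).add hT).add hU, fun m v hv o ho => ?_⟩
  simp only [Prog.run, PMF.mem_support_bind_iff, PMF.mem_support_map_iff] at ho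
  obtain ⟨a, ha, b, hb, rfl⟩ := ho
  have := hfT m v hv a ha
  have := hgU m a.1 (hfJ m v hv _ (Prog.mem_support_out ha)) b hb
  simp only
  omega

theorem pair (hI : SizeBdd I) (hf : PolyOn f I) (hg : PolyOn g I) : PolyOn (.pair f g) I := by
  obtain ⟨B, hB, hIB⟩ := hI
  obtain ⟨T, hT, hfT⟩ := hf
  obtain ⟨U, hU, hgU⟩ := hg
  refine ⟨_, (((PolyBounded.const 1).add hB).add hT).add hU, fun m v hv o ho => ?_⟩
  simp only [Prog.run, PMF.mem_support_bind_iff, PMF.mem_support_map_iff] at ho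
  obtain ⟨a, ha, b, hb, rfl⟩ := ho
  have := hIB m v hv
  have := hfT m v hv a ha
  have := hgU m v hv b hb
  simp only
  omega

theorem ifPos (hI : SizeBdd I) (hc : PolyOn c I) (hf : PolyOn f I) (hg : PolyOn g I) :
    PolyOn (.ifPos c f g) I := by
  obtain ⟨B, hB, hIB⟩ := hI
  obtain ⟨S, hS, hcS⟩ := hc
  obtain ⟨T, hT, hfT⟩ := hf
  obtain ⟨U, hU, hgU⟩ := hg
  refine ⟨_, (((PolyBounded.const 1).add hB).add hS).add (hT.add hU), fun m v hv o ho => ?_⟩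
  simp only [Prog.run, PMF.mem_support_bind_iff, PMF.mem_support_map_iff] at ho
  obtain ⟨a, ha, b, hb, rfl⟩ := ho
  have := hIB m v hv
  have := hcS m v hv a ha
  have : b.2 ≤ T m + U m := by
    split_ifs at hb
    · exact (hfT m v hv b hb).trans (Nat.le_add_right _ _)
    · exact (hgU m v hv b hb).trans (Nat.le_add_left _ _)
  simp only
  omega

theorem sizeBdd_out (hf : PolyOn f I) :
    SizeBdd fun m => {w | ∃ v ∈ I m, w ∈ (f.out v).support} := by
  obtain ⟨T, hT, hfT⟩ := hf
  refine ⟨T, hT, ?_⟩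
  rintro m w ⟨v, hv, hw⟩
  obtain ⟨o, ho, rfl⟩ := (PMF.mem_support_map_iff _ _ _).1 hw
  exact (f.size_le_cost v o ho).trans (hfT m v hv o ho)

/-- The natural form of `PolyOn.comp` when nothing but the size of the intermediate result
matters. -/
theorem comp' (hf : PolyOn f I) (hg : ∀ J, SizeBdd J → PolyOn g J) : PolyOn (.comp f g) I :=
  hf.comp (J := fun m => {w | ∃ v ∈ I m, w ∈ (f.out v).support})
    (fun _ v hv _ hw => ⟨v, hv, hw⟩) (hg _ hf.sizeBdd_out)

/-- Each basic instruction takes time linear in its input, and a fixed nesting of instructions only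
composes polynomials. -/
theorem of_loopFree (hf : f.LoopFree) (hI : SizeBdd I) : PolyOn f I := by
  have base : ∀ {f : Prog} {I : ℕ → Set Val} (c : ℕ), SizeBdd I →
      (∀ v, ∀ o ∈ (f.run v).support, o.2 ≤ 1 + v.size + c) → PolyOn f I := by
    rintro f I c ⟨B, hB, hIB⟩ h
    exact ⟨_, ((PolyBounded.const 1).add hB).add (PolyBounded.const c), fun m v hv o ho =>
      (h v o ho).trans (by have := hIB m v hv; omega)⟩
  induction f generalizing I with
  | id =>
    refine base 0 hI fun v o ho => ?_
    simp only [Prog.run, PMF.mem_support_pure_iff] at ho; subst ho; simp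
  | const z =>
    refine base (Nat.size z.natAbs) hI fun v o ho => ?_
    simp only [Prog.run, PMF.mem_support_pure_iff] at ho; subst ho; simp
  | fst =>
    refine base 0 hI fun v o ho => ?_
    simp only [Prog.run, PMF.mem_support_pure_iff] at ho; subst ho; simp
  | snd =>
    refine base 0 hI fun v o ho => ?_
    simp only [Prog.run, PMF.mem_support_pure_iff] at ho; subst ho; simp
  | isPair =>
    refine base 0 hI fun v o ho => ?_
    simp only [Prog.run, PMF.mem_support_pure_iff] at ho; subst ho; simp
  | arith a =>
    refine base 0 hI fun v o ho => ?_
    simp only [Prog.run, PMF.mem_support_pure_iff] at ho; subst ho; simp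
  | coin =>
    refine base 0 hI fun v o ho => ?_
    simp only [Prog.run, PMF.mem_support_map_iff] at ho
    obtain ⟨b, -, rfl⟩ := ho
    simp
  | pair f g ihf ihg => exact pair hI (ihf hf.1 hI) (ihg hf.2 hI)
  | comp f g ihf ihg => exact comp' (ihf hf.1 hI) fun J hJ => ihg hf.2 hJ
  | ifPos c f g ihc ihf ihg => exact ifPos hI (ihc hf.1 hI) (ihf hf.2.1 hI) (ihg hf.2.2 hI)
  | loop f ih => exact hf.elim

/-- Loops: `K m t` contains the states that are possible after `t` rounds. -/
theorem loop {K : ℕ → ℕ → Set Val} {q : ℕ → ℕ} (hq : PolyBounded q) (hI : SizeBdd I)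
    (hcount : ∀ m, ∀ v ∈ I m, v.fst.toInt.toNat ≤ q m ∧ v.snd ∈ K m 0)
    (hmaps : ∀ m t, ∀ v ∈ K m t, ∀ w ∈ (f.out v).support, w ∈ K m (t + 1))
    (hf : PolyOn f fun m => {v | ∃ t < q m, v ∈ K m t}) : PolyOn (.loop f) I := by
  obtain ⟨B, hB, hIB⟩ := hI
  obtain ⟨T, hT, hfT⟩ := hf
  -- t rounds are done and k remain; as t + k ≤ q m, every state met lies in the set on which one
  -- round costs at most `T m`.
  have key : ∀ m k t v, t + k ≤ q m → v ∈ K m t → ∀ o ∈ (iterate f.run k v).support,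
      o.2 ≤ k * T m := by
    intro m k
    induction k with
    | zero =>
      intro t v _ _ o ho
      simp only [iterate, PMF.mem_support_pure_iff] at ho
      simp [ho]
    | succ k ih =>
      intro t v ht hv o ho
      simp only [iterate, PMF.mem_support_bind_iff, PMF.mem_support_map_iff] at ho
      obtain ⟨a, ha, b, hb, rfl⟩ := ho
      have h1 := hfT m v ⟨t, by omega, hv⟩ a ha
      have h2 := ih (t + 1) a.1 (by omega) (hmaps m t v hv _ (Prog.mem_support_out ha)) b hb
      simp only [add_mul, one_mul]
      omega
  refine ⟨_, ((PolyBounded.const 1).add hB).add (hq.mul hT), fun m v hv o ho => ?_⟩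
  simp only [Prog.run, PMF.mem_support_map_iff] at ho
  obtain ⟨b, hb, rfl⟩ := ho
  obtain ⟨h1, h2⟩ := hcount m v hv
  have h3 := key m _ 0 _ (by omega) h2 b hb
  have h4 := Nat.mul_le_mul_right (T m) h1
  have := hIB m v hv
  simp only
  omega

end PolyOn

theorem MapsInto.comp {I J K : ℕ → Set Val} {f g : Prog} (hf : MapsInto f I J)
    (hg : MapsInto g J K) : MapsInto (.comp f g) I K := by
  intro m v hv w hw
  rw [Prog.out_comp, PMF.mem_support_bind_iff] at hw
  obtain ⟨u, hu, hw⟩ := hw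
  exact hg m u (hf m v hv u hu) w hw

/-! ### Uniform distributions -/

section Uniform

variable {α β γ : Type*} [Fintype α] [Nonempty α] [Fintype β] [Nonempty β]

theorem uniform_map_equiv (e : α ≃ β) :
    (PMF.uniformOfFintype α).map e = PMF.uniformOfFintype β := by
  classical
  ext b
  rw [PMF.map_apply, tsum_eq_single (e.symm b)]
  · simp [Fintype.card_congr e]
  · intro a ha
    rw [if_neg]
    rintro rfl
    simp at ha

theorem uniform_bind_map_mk :
    ((PMF.uniformOfFintype α).bind fun a => (PMF.uniformOfFintype β).map (Prod.mk a)) =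
      PMF.uniformOfFintype (α × β) := by
  classical
  ext ⟨a, b⟩
  rw [PMF.bind_apply, tsum_eq_single a]
  · rw [PMF.map_apply, tsum_eq_single b]
    · simp only [PMF.uniformOfFintype_apply, if_true, Fintype.card_prod, Nat.cast_mul]
      rw [ENNReal.mul_inv] <;> simp
    · intro b' hb
      rw [if_neg]
      simpa using hb.symm
  · intro a' ha
    have : ((PMF.uniformOfFintype β).map (Prod.mk a')) (a, b) = 0 := by
      rw [PMF.apply_eq_zero_iff, PMF.mem_support_map_iff]
      rintro ⟨b', -, h⟩
      exact ha (Prod.ext_iff.1 h).1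
    rw [this, mul_zero]

theorem uniform_bind_bind (F : α → β → PMF γ) :
    ((PMF.uniformOfFintype α).bind fun a => (PMF.uniformOfFintype β).bind (F a)) =
      (PMF.uniformOfFintype (α × β)).bind fun p => F p.1 p.2 := by
  rw [← uniform_bind_map_mk]
  simp [PMF.bind_bind, PMF.bind_map, Function.comp_def]

theorem uniform_bind_map (F : α → β → γ) :
    ((PMF.uniformOfFintype α).bind fun a => (PMF.uniformOfFintype β).map (F a)) =
      (PMF.uniformOfFintype (α × β)).map fun p => F p.1 p.2 := by
  rw [← uniform_bind_map_mk]
  simp [PMF.map_bind, PMF.map_comp, Function.comp_def]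

theorem uniform_bind_equiv (e : α ≃ β) (F : β → PMF γ) :
    (PMF.uniformOfFintype β).bind F = (PMF.uniformOfFintype α).bind fun a => F (e a) := by
  rw [← uniform_map_equiv e, PMF.bind_map]
  rfl

theorem uniform_bind_fst (F : α → PMF γ) :
    ((PMF.uniformOfFintype (α × β)).bind fun p => F p.1) = (PMF.uniformOfFintype α).bind F := by
  rw [← uniform_bind_bind fun a (_ : β) => F a]
  simp

/-- Drawing a coordinate of a uniformly distributed tuple again does not change anything. -/
theorem uniform_resample {J : Type*} [Fintype J] [DecidableEq J] (j : J) (F : (J → α) → PMF γ) :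
    ((PMF.uniformOfFintype (J → α)).bind fun f => (PMF.uniformOfFintype α).bind fun r =>
      F (Function.update f j r)) = (PMF.uniformOfFintype (J → α)).bind F := by
  -- Exchanging coordinate j with the extra draw is an involution, hence preserves the uniform
  -- distribution.
  let e : (J → α) × α ≃ (J → α) × α :=
    { toFun := fun p => (Function.update p.1 j p.2, p.1 j)
      invFun := fun p => (Function.update p.1 j p.2, p.1 j)
      left_inv := fun p => by simp
      right_inv := fun p => by simp }
  rw [uniform_bind_bind fun f r => F (Function.update f j r), ← uniform_bind_fst (β := α) F,
    uniform_bind_equiv e fun p => F p.1]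
  rfl

/-- The value drawn first is placed last, as in a loop that prepends each new result to a list. -/
theorem uniform_snoc (n : ℕ) :
    ((PMF.uniformOfFintype α).bind fun a => (PMF.uniformOfFintype (Fin n → α)).map fun f =>
      (Fin.snoc f a : Fin (n + 1) → α)) = PMF.uniformOfFintype (Fin (n + 1) → α) := by
  rw [uniform_bind_map fun a f => (Fin.snoc f a : Fin (n + 1) → α)]
  exact uniform_map_equiv (Fin.snocEquiv fun _ : Fin (n + 1) => α)

theorem uniform_fin_pow_succ (k : ℕ) :
    ((PMF.uniformOfFintype Bool).bind fun b => (PMF.uniformOfFintype (Fin (2 ^ k))).map fun (r : Fin (2 ^ k)) =>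
      (if b then 1 else 0) * (2 : ℤ) ^ k + (r : ℕ)) =
    (PMF.uniformOfFintype (Fin (2 ^ (k + 1)))).map fun (r : Fin (2 ^ (k + 1))) => ((r : ℕ) : ℤ) := by
  rw [uniform_bind_map fun (b : Bool) (r : Fin (2 ^ k)) => (if b then 1 else 0) * (2 : ℤ) ^ k + (r : ℕ)]
  let e : Bool × Fin (2 ^ k) ≃ Fin (2 ^ (k + 1)) :=
    ((finTwoEquiv.symm.prodCongr (Equiv.refl _)).trans finProdFinEquiv).trans
      (finCongr (by rw [pow_succ, mul_comm]))
  rw [← uniform_map_equiv e, PMF.map_comp]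
  congr 1
  funext ⟨b, r⟩
  cases b <;> simp [e, finTwoEquiv, add_comm]

end Uniform

theorem bind_congr_support {α β : Type*} {p : PMF α} {F G : α → PMF β}
    (h : ∀ a ∈ p.support, F a = G a) : p.bind F = p.bind G := by
  ext b
  rw [PMF.bind_apply, PMF.bind_apply]
  refine tsum_congr fun a => ?_
  by_cases ha : a ∈ p.support
  · rw [h a ha]
  · rw [(PMF.apply_eq_zero_iff p a).2 ha, zero_mul, zero_mul]

/-! ### Probability of acceptance -/

/-- The probability that the test `a` accepts a sample of `X`. -/
noncomputable def accept {α : Type*} (a : α → PMF Bool) (X : PMF α) : ℝ := (X.bind a true).toReal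

section accept

variable {α β : Type*} (a : β → PMF Bool)

theorem accept_nonneg (X : PMF β) : 0 ≤ accept a X := ENNReal.toReal_nonneg

theorem accept_le_one (X : PMF β) : accept a X ≤ 1 :=
  ENNReal.toReal_le_of_le_ofReal zero_le_one (by rw [ENNReal.ofReal_one]; exact PMF.coe_le_one _ _)

/-- The acceptance probability of a mixture is the weighted average of those of its components, so a
bound for the components survives averaging. -/
theorem accept_bind_le {X : PMF α} {F G : α → PMF β} {ε : ℝ}
    (h : ∀ x ∈ X.support, accept a (F x) ≤ accept a (G x) + ε) :
    accept a (X.bind F) ≤ accept a (X.bind G) + ε := by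
  have hε : 0 ≤ ε ∨ ε < 0 := le_or_gt 0 ε
  have hint : ∀ H : α → PMF β, HasSum (fun x => (X x).toReal * accept a (H x))
      (accept a (X.bind H)) := by
    intro H
    have h1 : (X.bind H).bind a true = ∑' x, X x * (H x).bind a true := by
      rw [PMF.bind_bind, PMF.bind_apply]
    have hfin : ∑' x, X x * (H x).bind a true ≠ ⊤ := h1 ▸ PMF.apply_ne_top _ _
    rw [accept, h1, ENNReal.tsum_toReal_eq fun x => ENNReal.ne_top_of_tsum_ne_top hfin x]
    simpa [accept] using (ENNReal.summable_toReal hfin).hasSum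
  have hone : HasSum (fun x => (X x).toReal) 1 := by
    have h1 := X.tsum_coe
    have h2 : ∑' x, X x ≠ ⊤ := by rw [h1]; exact ENNReal.one_ne_top
    have h3 := (ENNReal.summable_toReal h2).hasSum
    rwa [← ENNReal.tsum_toReal_eq fun x => ENNReal.ne_top_of_tsum_ne_top h2 x, h1,
      ENNReal.toReal_one] at h3
  have hsum := (hint G).add (hone.mul_right ε)
  rw [one_mul] at hsum
  refine hasSum_le (fun x => ?_) (hint F) hsum
  by_cases hx : x ∈ X.support
  · rw [← mul_add]
    exact mul_le_mul_of_nonneg_left (h x hx) ENNReal.toReal_nonneg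
  · simp [(PMF.apply_eq_zero_iff X x).2 hx]

theorem abs_accept_bind_sub_le {X : PMF α} {F G : α → PMF β} {ε : ℝ}
    (h : ∀ x ∈ X.support, |accept a (F x) - accept a (G x)| ≤ ε) :
    |accept a (X.bind F) - accept a (X.bind G)| ≤ ε := by
  rw [abs_le]
  have h1 := accept_bind_le a (X := X) (F := F) (G := G) (ε := ε)
    fun x hx => by linarith [(abs_le.1 (h x hx)).2]
  have h2 := accept_bind_le a (X := X) (F := G) (G := F) (ε := ε)
    fun x hx => by linarith [(abs_le.1 (h x hx)).1]
  constructor <;> linarith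

theorem accept_uniform_bind [Fintype α] [Nonempty α] (F : α → PMF β) :
    accept a ((PMF.uniformOfFintype α).bind F) = (∑ x, accept a (F x)) / Fintype.card α := by
  rw [accept, PMF.bind_bind, PMF.bind_apply, tsum_fintype, ENNReal.toReal_sum]
  · simp [accept, ENNReal.toReal_mul, div_eq_inv_mul, Finset.mul_sum]
  · exact fun x _ => ENNReal.mul_ne_top (PMF.apply_ne_top _ _) (PMF.apply_ne_top _ _)

end accept

/-- The hybrid argument. -/
theorem abs_sub_le_sum_of_insert {J : Type*} [Fintype J] [DecidableEq J] (p : Finset J → ℝ)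
    (ε : J → ℝ) (h : ∀ S, ∀ j ∉ S, |p S - p (insert j S)| ≤ ε j) :
    |p ∅ - p Finset.univ| ≤ ∑ j, ε j := by
  suffices ∀ S, |p ∅ - p S| ≤ ∑ j ∈ S, ε j from this _
  intro S
  induction S using Finset.induction_on with
  | empty => simp
  | insert j S hj ih =>
    rw [Finset.sum_insert hj]
    linarith [abs_sub_le (p ∅) (p S) (p (insert j S)), h S j hj]

/-! ### Statistical masking -/

/-- A shift by one makes the difference of the sums telescope to g(y + M) - g(y), which lies in [-1,
1]; a shift by x consists of |x| such steps. -/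
theorem abs_sum_shift_sub_le (g : ℤ → ℝ) (h0 : ∀ z, 0 ≤ g z) (h1 : ∀ z, g z ≤ 1) (M : ℕ) (x : ℤ) :
    |∑ c : Fin M, g (x + (c : ℕ)) - ∑ c : Fin M, g (c : ℕ)| ≤ |(x : ℝ)| := by
  have step : ∀ y : ℤ, |∑ c : Fin M, g (y + 1 + (c : ℕ)) - ∑ c : Fin M, g (y + (c : ℕ))| ≤ 1 := by
    intro y
    rw [Fin.sum_univ_eq_sum_range (fun c => g (y + 1 + (c : ℕ))),
      Fin.sum_univ_eq_sum_range (fun c => g (y + (c : ℕ))), ← Finset.sum_sub_distrib]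
    have : ∀ c : ℕ, g (y + 1 + c) - g (y + c) = g (y + (c + 1 : ℕ)) - g (y + c) := fun c => by
      push_cast; ring_nf
    rw [Finset.sum_congr rfl fun c _ => this c, Finset.sum_range_sub fun c : ℕ => g (y + c), abs_le]
    constructor <;> linarith [h0 (y + M), h1 (y + M), h0 (y + (0 : ℕ)), h1 (y + (0 : ℕ))]
  have nonneg : ∀ (n : ℕ) (y : ℤ),
      |∑ c : Fin M, g (y + n + (c : ℕ)) - ∑ c : Fin M, g (y + (c : ℕ))| ≤ n := by
    intro n y
    induction n with
    | zero => simp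
    | succ n ih =>
      have := step (y + n)
      have h2 : ∀ c : Fin M, y + n + 1 + ((c : ℕ) : ℤ) = y + (n + 1 : ℕ) + (c : ℕ) := fun c => by
        push_cast; ring
      simp only [h2] at this
      push_cast
      push_cast at this
      exact (abs_sub_le _ _ _).trans (by linarith)
  rcases le_total 0 x with hx | hx
  · obtain ⟨n, rfl⟩ := Int.eq_ofNat_of_zero_le hx
    simpa using nonneg n 0
  · obtain ⟨n, hn⟩ := Int.eq_ofNat_of_zero_le (neg_nonneg.2 hx)
    obtain rfl : x = -n := by omega
    have := nonneg n (-n)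
    rw [abs_sub_comm] at this
    simpa using this

/-- A uniformly distributed summand from a large interval hides the other summand. -/
theorem abs_accept_mask_le {β J : Type*} (a : β → PMF Bool) [Fintype J] [DecidableEq J]
    (M : ℕ) [NeZero M] (x : J → ℤ) (F : (J → ℤ) → PMF β) :
    |accept a ((PMF.uniformOfFintype (J → Fin M)).bind fun r => F fun j => x j + (r j : ℕ)) -
      accept a ((PMF.uniformOfFintype (J → Fin M)).bind fun r => F fun j => (r j : ℕ))| ≤
    ∑ j, |(x j : ℝ)| / M := by
  -- Hybrid over the coordinates: S is the set of those whose summand has already been removed.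
  have h := abs_sub_le_sum_of_insert
    (fun S : Finset J => accept a ((PMF.uniformOfFintype (J → Fin M)).bind fun r =>
      F fun j => (if j ∈ S then 0 else x j) + (r j : ℕ))) (fun j => |(x j : ℝ)| / M) ?_
  · simpa using h
  intro S j hj
  -- Drawing coordinate j last and fixing the others reduces the step to a shift by x j of one
  -- uniform variable.
  rw [← uniform_resample j, ← uniform_resample j fun r : J → Fin M =>
    F fun i => (if i ∈ insert j S then 0 else x i) + (r i : ℕ)]
  refine abs_accept_bind_sub_le a fun r _ => ?_
  rw [accept_uniform_bind, accept_uniform_bind, ← sub_div, abs_div, Fintype.card_fin, Nat.abs_cast]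
  refine div_le_div_of_nonneg_right ?_ (Nat.cast_nonneg M)
  have := abs_sum_shift_sub_le (fun z => accept a (F fun i => if i = j then z else
    (if i ∈ S then 0 else x i) + (r i : ℕ))) (fun _ => accept_nonneg _ _)
    (fun _ => accept_le_one _ _) M (x j)
  convert this using 6 <;> rename_i c _ <;> congr 1 <;> funext i <;>
    by_cases hi : i = j
  · subst hi; simp [hj]
  · simp [hi]
  · subst hi; simp
  · simp [hi]

/-! ### A small library of programs -/

theorem iterOut_pure {α : Type*} {step : Val → PMF Val} (e : α → Val) (g : α → α)
    (h : ∀ s, step (e s) = PMF.pure (e (g s))) (k : ℕ) (s : α) :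
    iterOut step k (e s) = PMF.pure (e (g^[k] s)) := by
  induction k generalizing s with
  | zero => simp [iterOut]
  | succ k ih => simp [iterOut, h, ih]

namespace Prog

/-- Apply an arithmetic instruction to the results of two programs. -/
def op (o : Arith) (f g : Prog) : Prog := comp (pair f g) (arith o)

theorem out_op {o : Arith} {f g : Prog} {v a b : Val} (hf : f.out v = PMF.pure a)
    (hg : g.out v = PMF.pure b) :
    (op o f g).out v = PMF.pure (.num (o.eval a.toInt b.toInt)) := by
  simp [op, out_comp, out_pair, hf, hg, PMF.pure_map, out_arith, Val.fst, Val.snd]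

theorem out_pair_pure {f g : Prog} {v a b : Val} (hf : f.out v = PMF.pure a)
    (hg : g.out v = PMF.pure b) : (pair f g).out v = PMF.pure (.pair a b) := by
  simp [out_pair, hf, hg, PMF.pure_map]

theorem out_comp_pure {f g : Prog} {v a : Val} (hf : f.out v = PMF.pure a) :
    (comp f g).out v = g.out a := by
  simp [out_comp, hf]

end Prog

theorem mem_support_out_pair {f g : Prog} {v w : Val} (h : w ∈ ((Prog.pair f g).out v).support) :
    ∃ a ∈ (f.out v).support, ∃ b ∈ (g.out v).support, w = .pair a b := by
  rw [Prog.out_pair, PMF.mem_support_bind_iff] at h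
  obtain ⟨a, ha, h⟩ := h
  obtain ⟨b, hb, rfl⟩ := (PMF.mem_support_map_iff _ _ _).1 h
  exact ⟨a, ha, b, hb, rfl⟩

theorem PolyOn.op {I : ℕ → Set Val} {f g : Prog} (o : Arith) (hI : SizeBdd I) (hf : PolyOn f I)
    (hg : PolyOn g I) : PolyOn (Prog.op o f g) I :=
  (PolyOn.pair hI hf hg).comp' fun _ hJ => PolyOn.of_loopFree trivial hJ

/-! #### Modular exponentiation -/

/-- Remainder, with value `0` for the modulus `0`. -/
def modZ (a b : ℤ) : ℤ := Arith.mod.eval a b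

theorem modZ_of_pos {a b : ℤ} (hb : 0 < b) : modZ a b = a % b := by
  simp [modZ, Arith.eval, hb.ne']

theorem natAbs_modZ_le (a b : ℤ) : (modZ a b).natAbs ≤ b.natAbs := by
  rw [modZ, Arith.eval]
  split_ifs with h
  · simp
  · have h1 := Int.emod_nonneg a h
    have h2 := Int.emod_lt_abs a h
    zify
    rw [abs_of_nonneg h1]
    exact h2.le

/-- One round of square and multiply: accumulator, base, exponent. -/
def powState (M : ℤ) (s : ℤ × ℤ × ℤ) : ℤ × ℤ × ℤ :=
  (if 0 < modZ s.2.2 2 then modZ (s.1 * s.2.1) M else s.1, modZ (s.2.1 * s.2.1) M, s.2.2 / 2)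

/-- `b ^ e mod M`, if `e` has at most `k` bits. -/
def powZ (b e M : ℤ) (k : ℕ) : ℤ := modZ ((powState M)^[k] (1, b, e)).1 M

/-- A round squares the base and halves the exponent, moving an odd factor into the accumulator.
This preserves a · b^e modulo M, and an exponent below 2^k has become 0 after k rounds. -/
theorem powState_iterate {M : ℤ} (hM : 0 < M) (k : ℕ) : ∀ (a b : ℤ) (e : ℕ), e < 2 ^ k →
    ((powState M)^[k] (a, b, e)).1 ≡ a * b ^ e [ZMOD M] := by
  induction k with
  | zero =>
    intro a b e he
    obtain rfl : e = 0 := by simpa using he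
    simp [Int.ModEq.refl]
  | succ k ih =>
    intro a b e he
    rw [pow_succ] at he
    have h2 : ((e : ℤ) / 2) = ((e / 2 : ℕ) : ℤ) := by simp
    rw [Function.iterate_succ_apply, powState]
    simp only [h2]
    refine (ih _ _ (e / 2) (by omega)).trans ?_
    have hb : (modZ (b * b) M) ^ (e / 2) ≡ (b * b) ^ (e / 2) [ZMOD M] := by
      rw [modZ_of_pos hM]
      exact (Int.mod_modEq _ _).pow _
    rw [modZ_of_pos (by norm_num : (0 : ℤ) < 2)]
    rcases Nat.even_or_odd' e with ⟨c, rfl | rfl⟩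
    · have h3 : ¬ 0 < ((2 * c : ℕ) : ℤ) % 2 := by omega
      rw [if_neg h3]
      refine ((Int.ModEq.refl a).mul hb).trans ?_
      rw [Nat.mul_div_cancel_left _ (by norm_num), pow_mul, ← sq]
    · have h3 : 0 < ((2 * c + 1 : ℕ) : ℤ) % 2 := by omega
      rw [if_pos h3, modZ_of_pos hM]
      refine ((Int.mod_modEq _ _).mul hb).trans ?_
      rw [show (2 * c + 1) / 2 = c by omega, pow_succ, pow_mul, ← sq]
      exact congrArg (· % M) (by ring)

theorem powZ_eq {M : ℤ} (hM : 0 < M) (b : ℤ) {e k : ℕ} (he : e < 2 ^ k) :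
    powZ b e M k = b ^ e % M := by
  rw [powZ, modZ_of_pos hM]
  have := powState_iterate hM k 1 b e he
  rwa [one_mul] at this

namespace Prog

/-- The body of the loop of `powP`. -/
def powStep : Prog :=
  pair (pair
    (ifPos (op .mod (comp snd fst) (const 2))
      (op .mod (op .mul (comp fst fst) (comp fst snd)) (comp snd snd)) (comp fst fst))
    (op .mod (op .mul (comp fst snd) (comp fst snd)) (comp snd snd)))
    (pair (op .div (comp snd fst) (const 2)) (comp snd snd))

/-- Modular exponentiation with base, exponent and modulus computed by `b`, `e`, `M`, and a bound
for the number of bits of the exponent computed by `k`. -/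
def powP (b e M k : Prog) : Prog :=
  comp (comp (pair k (pair (pair (const 1) (op .add b (const 0)))
    (pair (op .add e (const 0)) (op .add M (const 0))))) (loop powStep))
    (op .mod (comp fst fst) (comp snd snd))

end Prog

/-- The state of the loop of `powP`. -/
def powVal (M : ℤ) (s : ℤ × ℤ × ℤ) : Val :=
  .pair (.pair (.num s.1) (.num s.2.1)) (.pair (.num s.2.2) (.num M))

theorem out_powStep (M : ℤ) (s : ℤ × ℤ × ℤ) :
    Prog.powStep.out (powVal M s) = PMF.pure (powVal M (powState M s)) := by
  have h1 : ∀ f : Prog, (Prog.comp Prog.fst f).out (powVal M s) =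
      f.out (.pair (.num s.1) (.num s.2.1)) := fun f => by
    simp [Prog.out_comp, Prog.out_fst, powVal, Val.fst]
  have h2 : ∀ f : Prog, (Prog.comp Prog.snd f).out (powVal M s) =
      f.out (.pair (.num s.2.2) (.num M)) := fun f => by
    simp [Prog.out_comp, Prog.out_snd, powVal, Val.snd]
  refine Prog.out_pair_pure (Prog.out_pair_pure ?_ (Prog.out_op (Prog.out_op
    ((h1 _).trans (Prog.out_snd _)) ((h1 _).trans (Prog.out_snd _))) ((h2 _).trans (Prog.out_snd _))))
    (Prog.out_pair_pure (Prog.out_op ((h2 _).trans (Prog.out_fst _)) (Prog.out_const _ _))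
      ((h2 _).trans (Prog.out_snd _)))
  rw [Prog.out_ifPos, Prog.out_op ((h2 _).trans (Prog.out_fst _)) (Prog.out_const _ _),
    PMF.pure_bind, h1, Prog.out_fst, Prog.out_op (Prog.out_op ((h1 _).trans (Prog.out_fst _))
      ((h1 _).trans (Prog.out_snd _))) ((h2 _).trans (Prog.out_snd _)), ← apply_ite]
  by_cases h3 : 0 < modZ s.2.2 2
  · rw [powState, if_pos h3]
    exact congrArg _ (if_pos h3)
  · rw [powState, if_neg h3]
    exact congrArg _ (if_neg h3)

theorem out_powP {b e M k : Prog} {v vb ve vM vk : Val} (hb : b.out v = PMF.pure vb)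
    (he : e.out v = PMF.pure ve) (hM : M.out v = PMF.pure vM) (hk : k.out v = PMF.pure vk) :
    (Prog.powP b e M k).out v =
      PMF.pure (.num (powZ vb.toInt ve.toInt vM.toInt vk.toInt.toNat)) := by
  -- Adding 0 turns any datum into an integer leaf, so the initial state has the shape `powVal`
  -- whatever the subprograms return.
  have h0 : ∀ {f : Prog} {w : Val}, f.out v = PMF.pure w →
      (Prog.op .add f (.const 0)).out v = PMF.pure (.num w.toInt) := fun h => by
    rw [Prog.out_op h (Prog.out_const _ _)]
    simp [Arith.eval, Val.toInt]
  rw [Prog.powP, Prog.out_comp_pure (a := powVal vM.toInt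
    ((powState vM.toInt)^[vk.toInt.toNat] (1, vb.toInt, ve.toInt)))]
  · refine Prog.out_op (a := .num _) (b := .num _) ?_ ?_
    · rw [Prog.out_comp_pure (Prog.out_fst _), Prog.out_fst]; rfl
    · rw [Prog.out_comp_pure (Prog.out_snd _), Prog.out_snd]; rfl
  · rw [Prog.out_comp_pure (Prog.out_pair_pure hk (Prog.out_pair_pure (Prog.out_pair_pure
      (Prog.out_const _ _) (h0 hb)) (Prog.out_pair_pure (h0 he) (h0 hM)))), Prog.out_loop]
    exact iterOut_pure (powVal vM.toInt) (powState vM.toInt) (out_powStep _) _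
      (1, vb.toInt, ve.toInt)

/-- The state does not grow: base and accumulator become remainders modulo M, and the exponent only
shrinks. The number of rounds is the value, not the size, of what `k` returns, and therefore needs
the separate bound q. -/
theorem polyOn_powP {I : ℕ → Set Val} {b e M k : Prog} {q : ℕ → ℕ} (hI : SizeBdd I)
    (hb : PolyOn b I) (he : PolyOn e I) (hM : PolyOn M I) (hk : PolyOn k I) (hq : PolyBounded q)
    (hkq : ∀ m, ∀ v ∈ I m, ∀ w ∈ (k.out v).support, w.toInt.toNat ≤ q m) :
    PolyOn (Prog.powP b e M k) I := by
  have hc : ∀ z, PolyOn (.const z) I := fun z => PolyOn.of_loopFree trivial hI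
  have hin := PolyOn.pair hI (.pair hI (hc 1) (.op .add hI hb (hc 0)))
    (.pair hI (.op .add hI he (hc 0)) (.op .add hI hM (hc 0)))
  obtain ⟨B, hB, hIB⟩ := hin.sizeBdd_out
  obtain ⟨C, hC, hIC⟩ := (PolyOn.pair hI hk hin).sizeBdd_out
  let S : ℕ → Set Val := fun m => {u | ∃ M s, u = powVal M s ∧ s.1.natAbs.size ≤ B m ∧
    s.2.1.natAbs.size ≤ B m ∧ s.2.2.natAbs.size ≤ B m ∧ M.natAbs.size ≤ B m}
  have hS : SizeBdd S := by
    refine ⟨fun m => 7 + 4 * B m, (PolyBounded.const 7).add ((PolyBounded.const 4).mul hB), ?_⟩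
    rintro m _ ⟨M, s, rfl, h1, h2, h3, h4⟩
    simp only [powVal, Val.size]
    omega
  have hout : ∀ {f : Prog} {v w : Val}, w ∈ ((Prog.op .add f (.const 0)).out v).support →
      ∃ z, w = .num z := by
    intro f v w hw
    rw [Prog.op, Prog.out_comp, PMF.mem_support_bind_iff] at hw
    obtain ⟨u, -, hw⟩ := hw
    rw [Prog.out_arith, PMF.mem_support_pure_iff] at hw
    exact ⟨_, hw⟩
  refine PolyOn.comp' (PolyOn.comp (J := fun m => {w | w.size ≤ C m ∧ w.fst.toInt.toNat ≤ q m ∧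
    w.snd ∈ S m}) (.pair hI hk hin) ?_ ?_) fun J hJ => PolyOn.of_loopFree (by simp [Prog.LoopFree, Prog.op]) hJ
  · intro m v hv w hw
    refine ⟨hIC m w ⟨v, hv, hw⟩, ?_⟩
    obtain ⟨a, ha, b', hb', rfl⟩ := mem_support_out_pair hw
    refine ⟨hkq m v hv a ha, ?_⟩
    have hsz := hIB m b' ⟨v, hv, hb'⟩
    obtain ⟨c, hc, d, hd, rfl⟩ := mem_support_out_pair hb'
    obtain ⟨c1, hc1, c2, hc2, rfl⟩ := mem_support_out_pair hc
    obtain ⟨d1, hd1, d2, hd2, rfl⟩ := mem_support_out_pair hd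
    rw [Prog.out_const, PMF.mem_support_pure_iff] at hc1
    subst hc1
    obtain ⟨z2, rfl⟩ := hout hc2
    obtain ⟨z3, rfl⟩ := hout hd1
    obtain ⟨z4, rfl⟩ := hout hd2
    simp only [Val.size] at hsz
    exact ⟨z4, (1, z2, z3), rfl, by simp only; omega, by simp only; omega, by simp only; omega,
      by omega⟩
  · refine PolyOn.loop (K := fun m _ => S m) hq ⟨C, hC, fun m v hv => hv.1⟩
      (fun m v hv => hv.2) ?_ ?_
    · rintro m t _ ⟨M, s, rfl, h1, h2, h3, h4⟩ w hw
      rw [out_powStep, PMF.mem_support_pure_iff] at hw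
      subst hw
      have hmod : ∀ a, (modZ a M).natAbs.size ≤ B m := fun a =>
        (Nat.size_le_size (natAbs_modZ_le a M)).trans h4
      refine ⟨M, _, rfl, ?_, hmod _, ?_, h4⟩
      · simp only [powState]
        split_ifs
        · exact hmod _
        · exact h1
      · exact (Nat.size_le_size (Int.natAbs_ediv_le_natAbs _ _)).trans h3
    · exact PolyOn.of_loopFree (by simp [Prog.LoopFree, Prog.op, Prog.powStep])
        (hS.mono fun m v hv => hv.choose_spec.2)

/-! #### Encryption -/

/-- Encryption in terms of integers. -/
def encZ (h N m r : ℤ) (kr kN : ℕ) : ℤ :=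
  modZ ((1 + m * N) * powZ (powZ h r N kr) N (N * N) kN) (N * N)

/-- The inner power is the canonical representative of h^r modulo N, which is exactly the lift that
`enc` raises to the N-th power. The bit counts merely have to be large enough for the exponents r
and N. -/
theorem encZ_eq (pk : PublicKey) [NeZero pk.N] (m : ℤ) {r kr kN : ℕ} (hr : r < 2 ^ kr)
    (hN : pk.N < 2 ^ kN) :
    encZ ((pk.h : ZMod pk.N).val : ℕ) pk.N m r kr kN =
      ((enc pk m r : ZMod (pk.N ^ 2)).val : ℕ) := by
  have hNpos : (0 : ℤ) < pk.N := by exact_mod_cast NeZero.pos pk.N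
  have hval : ∀ (n : ℕ) [NeZero n] (z : ℤ) (c : ZMod n), (z : ZMod n) = c →
      z % (n : ℤ) = (c.val : ℕ) := by
    intro n _ z c h
    rw [← h, ZMod.val_intCast]
  rw [encZ, powZ_eq hNpos _ hr, powZ_eq (mul_pos hNpos hNpos) _ hN, modZ_of_pos (mul_pos hNpos hNpos)]
  have hu : (((pk.h : ZMod pk.N).val : ℕ) : ℤ) ^ r % (pk.N : ℤ) =
      (((pk.h ^ r : (ZMod pk.N)ˣ) : ZMod pk.N).val : ℕ) := by
    refine hval _ _ _ ?_
    push_cast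
    rw [ZMod.natCast_val, ZMod.cast_id]
  have hNN : (pk.N : ℤ) * pk.N = ((pk.N ^ 2 : ℕ) : ℤ) := by push_cast; ring
  rw [hu, hNN]
  refine hval _ _ _ ?_
  rw [Int.cast_mul, ZMod.intCast_mod]
  push_cast
  rw [enc, Units.val_mul, coe_onePlusN_zpow, Units.val_pow_eq_pow_val]
  congr 1

namespace Prog

/-- Encryption of `m` with randomness `r` under the public key `(h, N)`; bounds for the numbers of
bits of `r` and `N` are computed by `kr` and `kN`. -/
def encP (h N m r kr kN : Prog) : Prog :=
  op .mod (op .mul (op .add (const 1) (op .mul m N))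
    (powP (powP h r N kr) N (op .mul N N) kN)) (op .mul N N)

theorem out_encP {h N m r kr kN : Prog} {v vh vN vm vr vkr vkN : Val} (hh : h.out v = PMF.pure vh)
    (hN : N.out v = PMF.pure vN) (hm : m.out v = PMF.pure vm) (hr : r.out v = PMF.pure vr)
    (hkr : kr.out v = PMF.pure vkr) (hkN : kN.out v = PMF.pure vkN) :
    (encP h N m r kr kN).out v = PMF.pure (.num (encZ vh.toInt vN.toInt vm.toInt vr.toInt
      vkr.toInt.toNat vkN.toInt.toNat)) :=
  out_op (out_op (out_op (out_const _ _) (out_op hm hN))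
    (out_powP (out_powP hh hr hN hkr) hN (out_op hN hN) hkN)) (out_op hN hN)

end Prog

theorem polyOn_encP {I : ℕ → Set Val} {h N m r kr kN : Prog} {q : ℕ → ℕ} (hI : SizeBdd I)
    (hh : PolyOn h I) (hN : PolyOn N I) (hm : PolyOn m I) (hr : PolyOn r I) (hkr : PolyOn kr I)
    (hkN : PolyOn kN I) (hq : PolyBounded q)
    (hkrq : ∀ m, ∀ v ∈ I m, ∀ w ∈ (kr.out v).support, w.toInt.toNat ≤ q m)
    (hkNq : ∀ m, ∀ v ∈ I m, ∀ w ∈ (kN.out v).support, w.toInt.toNat ≤ q m) :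
    PolyOn (Prog.encP h N m r kr kN) I := by
  have hNN := PolyOn.op .mul hI hN hN
  exact .op _ hI (.op _ hI (.op _ hI (PolyOn.of_loopFree trivial hI) (.op _ hI hm hN))
    (polyOn_powP hI (polyOn_powP hI hh hr hN hkr hq hkrq) hN hNN hkN hq hkNq)) hNN

/-! #### Sampling -/

namespace Prog

/-- A uniformly distributed integer with as many bits as `k` computes. -/
def uniP (k : Prog) : Prog :=
  comp (pair k (const 0)) (loop (op .add (op .add id id) coin))

end Prog

theorem out_uniStep (z : ℤ) : (Prog.op .add (.op .add .id .id) .coin).out (.num z) =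
    (PMF.uniformOfFintype Bool).map fun b => .num (2 * z + if b then 1 else 0) := by
  rw [Prog.op, Prog.out_comp, Prog.out_pair, Prog.out_op (Prog.out_id _) (Prog.out_id _),
    PMF.pure_bind, Prog.out_coin, PMF.map_comp, PMF.bind_map, ← PMF.bind_pure_comp]
  congr 1
  funext b
  simp only [Function.comp_apply, Prog.out_arith, Val.fst, Val.snd, Val.toInt, Arith.eval, two_mul]

/-- The first coin b is followed by k doublings, so it becomes the most significant bit: (2z + b) ·
2^k = z · 2^(k+1) + b · 2^k. -/
theorem iterOut_uniStep (k : ℕ) (z : ℤ) :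
    iterOut (Prog.op .add (.op .add .id .id) .coin).out k (.num z) =
      (PMF.uniformOfFintype (Fin (2 ^ k))).map fun r => .num (z * 2 ^ k + (r : ℕ)) := by
  induction k generalizing z with
  | zero =>
    have : ∀ r : Fin (2 ^ 0), Val.num (z * 2 ^ 0 + (r : ℕ)) = .num z := fun r => by
      simp
    simp only [this, iterOut]
    exact (PMF.map_const _ _).symm
  | succ k ih =>
    have h := congrArg (PMF.map fun x => Val.num (z * 2 ^ (k + 1) + x)) (uniform_fin_pow_succ k)
    simp only [PMF.map_bind, PMF.map_comp, Function.comp_def] at h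
    rw [← h, iterOut, out_uniStep, PMF.bind_map]
    congr 1
    funext b
    rw [Function.comp_apply, ih]
    congr 1
    funext r
    rw [pow_succ]
    ring_nf

theorem out_uniP {k : Prog} {v : Val} {n : ℕ} (hk : k.out v = PMF.pure (.ofNat n)) :
    (Prog.uniP k).out v = (PMF.uniformOfFintype (Fin (2 ^ n))).map fun r => .ofNat r := by
  rw [Prog.uniP, Prog.out_comp_pure (Prog.out_pair_pure hk (Prog.out_const _ _)), Prog.out_loop]
  have := iterOut_uniStep n 0
  simpa [Val.fst, Val.snd, Val.ofNat, Val.toInt] using this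

theorem polyOn_uniP {I : ℕ → Set Val} {k : Prog} {q : ℕ → ℕ} (hI : SizeBdd I) (hk : PolyOn k I)
    (hq : PolyBounded q) (hkq : ∀ m, ∀ v ∈ I m, ∀ w ∈ (k.out v).support, w.toInt.toNat ≤ q m) :
    PolyOn (Prog.uniP k) I := by
  have hc : PolyOn (.const 0) I := PolyOn.of_loopFree trivial hI
  obtain ⟨B, hB, hIB⟩ := (PolyOn.pair hI hk hc).sizeBdd_out
  refine PolyOn.comp (J := fun m => {w | w.size ≤ B m ∧ w.fst.toInt.toNat ≤ q m ∧ w.snd = .num 0})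
    (.pair hI hk hc) ?_ ?_
  · intro m v hv w hw
    refine ⟨hIB m w ⟨v, hv, hw⟩, ?_⟩
    obtain ⟨a, ha, b, hb, rfl⟩ := mem_support_out_pair hw
    rw [Prog.out_const, PMF.mem_support_pure_iff] at hb
    exact ⟨hkq m v hv a ha, hb⟩
  -- After t rounds the number has at most t bits, so the size stays linear in the number of rounds.
  · refine PolyOn.loop (K := fun _ t => {v | ∃ z : ℕ, z < 2 ^ t ∧ v = .num z}) hq
      ⟨B, hB, fun m v hv => hv.1⟩ (fun m v hv => ⟨hv.2.1, 0, by simp, by simpa using hv.2.2⟩) ?_ ?_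
    · rintro m t _ ⟨z, hz, rfl⟩ w hw
      rw [out_uniStep, PMF.mem_support_map_iff] at hw
      obtain ⟨b, -, rfl⟩ := hw
      refine ⟨2 * z + if b then 1 else 0, ?_, ?_⟩
      · rw [pow_succ]; split_ifs <;> omega
      · push_cast; rfl
    · refine PolyOn.of_loopFree (by simp [Prog.LoopFree, Prog.op]) ⟨_, (PolyBounded.const 1).add hq, ?_⟩
      rintro m _ ⟨t, ht, z, hz, rfl⟩
      simp only [Val.size, Int.natAbs_natCast]
      have := Nat.size_le.2 hz
      omega

/-! #### Lists -/

namespace Val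

theorem size_fst_le (v : Val) : v.fst.size ≤ v.size := by
  have := v.size_fst_add_size_snd_le
  have := v.snd.one_le_size
  omega

theorem size_snd_le (v : Val) : v.snd.size ≤ v.size := by
  have := v.size_fst_add_size_snd_le
  have := v.fst.one_le_size
  omega

theorem size_ofList_le {l : List Val} {b : ℕ} (h : ∀ a ∈ l, a.size ≤ b) :
    (ofList l).size ≤ 1 + l.length * (b + 1) := by
  induction l with
  | nil => simp [ofList, size]
  | cons a l ih =>
    have h1 := h a (by simp)
    have h2 := ih fun a' ha' => h a' (by simp [ha'])
    simp only [ofList, size, List.length_cons, add_mul, one_mul]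
    omega

end Val

namespace Prog

/-- The body of the loop of `mapP`. -/
def mapStep (g : Prog) : Prog :=
  pair (pair (comp (comp fst fst) snd) (comp fst snd))
    (pair (comp (pair (comp (comp fst fst) fst) (comp fst snd)) g) snd)

/-- Apply `g` to the elements of a list, together with a fixed context; the results are listed in
reverse order. -/
def mapP (cnt tape ctx g : Prog) : Prog :=
  comp (comp (pair cnt (pair (pair tape ctx) (const 0))) (loop (mapStep g))) snd

theorem out_mapStep (g : Prog) (tape ctx acc : Val) :
    (mapStep g).out (.pair (.pair tape ctx) acc) =
      (g.out (.pair tape.fst ctx)).map fun e => .pair (.pair tape.snd ctx) (.pair e acc) := by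
  simp [mapStep, out_pair, out_comp, out_fst, out_snd, Val.fst, Val.snd,
    ← PMF.bind_pure_comp, Function.comp_def]

theorem out_mapP {cnt tape ctx g : Prog} {v vt vc : Val} {s : ℕ}
    (hcnt : cnt.out v = PMF.pure (.ofNat s)) (ht : tape.out v = PMF.pure vt)
    (hc : ctx.out v = PMF.pure vc) :
    (mapP cnt tape ctx g).out v =
      (iterOut (mapStep g).out s (.pair (.pair vt vc) (.num 0))).map Val.snd := by
  rw [mapP, out_comp, out_comp_pure (out_pair_pure hcnt (out_pair_pure (out_pair_pure ht hc)
    (out_const _ _))), out_loop, ← PMF.bind_pure_comp]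
  congr 1
  funext w
  exact out_snd w

end Prog

theorem iterOut_mapStep_ofList {g : Prog} {ctx : Val} {E : Val → Val}
    (hg : ∀ e, g.out (.pair e ctx) = PMF.pure (E e)) (l a : List Val) :
    iterOut g.mapStep.out l.length (.pair (.pair (.ofList l) ctx) (.ofList a)) =
      PMF.pure (.pair (.pair (.num 0) ctx) (.ofList ((l.map E).reverse ++ a))) := by
  induction l generalizing a with
  | nil => simp [iterOut, Val.ofList]
  | cons e l ih =>
    rw [List.length_cons, iterOut, Prog.out_mapStep]
    simp only [Val.ofList, Val.fst, Val.snd, hg, PMF.pure_map, PMF.pure_bind]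
    exact (ih (E e :: a)).trans (by simp)

/-- Both components of `num 0` are `num 0` again, so this tape never runs out: each round feeds the
same element to `g` and yields an independent sample. -/
theorem iterOut_mapStep_uniform {α : Type*} [Fintype α] [Nonempty α] {g : Prog} {ctx : Val}
    {φ : α → Val} (hg : g.out (.pair (.num 0) ctx) = (PMF.uniformOfFintype α).map φ) (s : ℕ)
    (a : List Val) :
    iterOut g.mapStep.out s (.pair (.pair (.num 0) ctx) (.ofList a)) =
      (PMF.uniformOfFintype (Fin s → α)).map fun f =>
        .pair (.pair (.num 0) ctx) (.ofList (List.ofFn (fun i => φ (f i)) ++ a)) := by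
  induction s generalizing a with
  | zero =>
    simp only [iterOut, List.ofFn_zero, List.nil_append]
    exact (PMF.map_const _ _).symm
  | succ s ih =>
    rw [iterOut, Prog.out_mapStep, Val.fst, Val.snd, hg, PMF.map_comp, PMF.bind_map,
      ← uniform_snoc, PMF.map_bind]
    congr 1
    funext x
    rw [PMF.map_comp]
    refine (ih (φ x :: a)).trans ?_
    congr 1
    funext f
    rw [Function.comp_apply, List.ofFn_succ']
    simp

theorem out_mapP_ofList {cnt tape ctx g : Prog} {v vc : Val} {l : List Val} {E : Val → Val}
    (hcnt : cnt.out v = PMF.pure (.ofNat l.length)) (ht : tape.out v = PMF.pure (.ofList l))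
    (hc : ctx.out v = PMF.pure vc) (hg : ∀ e, g.out (.pair e vc) = PMF.pure (E e)) :
    (Prog.mapP cnt tape ctx g).out v = PMF.pure (.ofList (l.map E).reverse) := by
  have := iterOut_mapStep_ofList hg l []
  rw [Prog.out_mapP hcnt ht hc, ← Val.ofList, this, PMF.pure_map, List.append_nil]
  rfl

theorem out_mapP_uniform {α : Type*} [Fintype α] [Nonempty α] {cnt tape ctx g : Prog} {v vc : Val}
    {s : ℕ} {φ : α → Val} (hcnt : cnt.out v = PMF.pure (.ofNat s))
    (ht : tape.out v = PMF.pure (.num 0)) (hc : ctx.out v = PMF.pure vc)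
    (hg : g.out (.pair (.num 0) vc) = (PMF.uniformOfFintype α).map φ) :
    (Prog.mapP cnt tape ctx g).out v =
      (PMF.uniformOfFintype (Fin s → α)).map fun f => .ofList (List.ofFn fun i => φ (f i)) := by
  have := iterOut_mapStep_uniform hg s []
  rw [Prog.out_mapP hcnt ht hc]
  rw [Val.ofList] at this
  rw [this, PMF.map_comp]
  simp [Function.comp_def, Val.snd]

/-- The body `g` never reads the accumulator, so one bound `G m` for its results holds in all rounds
and the list grows linearly. The set `C` transports what is known about the context, such as bounds
for bit counts stored in it, to the calls of `g`. -/
theorem polyOn_mapP {I C : ℕ → Set Val} {cnt tape ctx g : Prog} {q : ℕ → ℕ} (hI : SizeBdd I)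
    (hcnt : PolyOn cnt I) (htape : PolyOn tape I) (hctx : PolyOn ctx I) (hq : PolyBounded q)
    (hcq : ∀ m, ∀ v ∈ I m, ∀ w ∈ (cnt.out v).support, w.toInt.toNat ≤ q m)
    (hC : MapsInto ctx I C)
    (hg : ∀ B, PolyBounded B → PolyOn g fun m => {u | u.size ≤ B m ∧ u.snd ∈ C m}) :
    PolyOn (Prog.mapP cnt tape ctx g) I := by
  have hin := PolyOn.pair hI (.pair hI htape hctx) (PolyOn.of_loopFree (f := .const 0) trivial hI)
  have hin' := PolyOn.pair hI hcnt hin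
  obtain ⟨B, hB, hIB⟩ := hin'.sizeBdd_out
  have hg' := hg (fun m => 1 + 2 * B m) ((PolyBounded.const 1).add ((PolyBounded.const 2).mul hB))
  obtain ⟨G, hG, hgG⟩ := hg'.sizeBdd_out
  have hfin : ∀ J, SizeBdd J → PolyOn .snd J := fun J hJ => PolyOn.of_loopFree trivial hJ
  let K : ℕ → ℕ → Set Val := fun m t => {u | ∃ tp cx acc, u = .pair (.pair tp cx) acc ∧
    tp.size ≤ B m ∧ cx.size ≤ B m ∧ cx ∈ C m ∧ acc.size ≤ 1 + t * (1 + G m)}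
  have hsize : SizeBdd fun m => {v | ∃ t < q m, v ∈ K m t} := by
    refine ⟨fun m => 3 + 2 * B m + q m * (1 + G m), ((PolyBounded.const 3).add
      ((PolyBounded.const 2).mul hB)).add (hq.mul ((PolyBounded.const 1).add hG)), ?_⟩
    rintro m _ ⟨t, ht, tp, cx, acc, rfl, h1, h2, -, h4⟩
    have := Nat.mul_le_mul_right (1 + G m) ht.le
    simp only [Val.size]
    omega
  have hdom : ∀ m, ∀ tp cx : Val, tp.size ≤ B m → cx.size ≤ B m → cx ∈ C m →
      Val.pair tp.fst cx ∈ {u : Val | u.size ≤ 1 + 2 * B m ∧ u.snd ∈ C m} := by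
    intro m tp cx h1 h2 h3
    refine ⟨?_, h3⟩
    have := tp.size_fst_le
    simp only [Val.size]
    omega
  refine PolyOn.comp' (PolyOn.comp (J := fun m => {w | w.size ≤ B m ∧ w.fst.toInt.toNat ≤ q m ∧
    w.snd ∈ K m 0}) hin' ?_ ?_) hfin
  · intro m v hv w hw
    have hsz := hIB m w ⟨v, hv, hw⟩
    refine ⟨hsz, ?_⟩
    obtain ⟨a, ha, b, hb, rfl⟩ := mem_support_out_pair hw
    refine ⟨hcq m v hv a ha, ?_⟩
    obtain ⟨c, hc, d, hd, rfl⟩ := mem_support_out_pair hb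
    obtain ⟨tp, htp, cx, hcx, rfl⟩ := mem_support_out_pair hc
    rw [Prog.out_const, PMF.mem_support_pure_iff] at hd
    simp only [Val.size] at hsz
    exact ⟨tp, cx, d, rfl, by omega, by omega, hC m v hv cx hcx, by simp [hd, Val.size]⟩
  · refine PolyOn.loop (K := K) hq ⟨B, hB, fun m v hv => hv.1⟩ (fun m v hv => hv.2) ?_ ?_
    · rintro m t _ ⟨tp, cx, acc, rfl, h1, h2, h3, h4⟩ w hw
      rw [Prog.out_mapStep, PMF.mem_support_map_iff] at hw
      obtain ⟨e, he, rfl⟩ := hw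
      have := hgG m e ⟨_, hdom m tp cx h1 h2 h3, he⟩
      refine ⟨_, _, _, rfl, tp.size_snd_le.trans h1, h2, h3, ?_⟩
      simp only [Val.size, add_mul, one_mul]
      omega
    · refine .pair hsize (PolyOn.of_loopFree (by simp [Prog.LoopFree]) hsize) (.pair hsize ?_
        (PolyOn.of_loopFree trivial hsize))
      refine PolyOn.comp (PolyOn.of_loopFree (by simp [Prog.LoopFree]) hsize) ?_ hg'
      rintro m _ ⟨t, ht, tp, cx, acc, rfl, h1, h2, h3, h4⟩ w hw
      have : (Prog.pair (.comp (.comp .fst .fst) .fst) (.comp .fst .snd)).out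
          (.pair (.pair tp cx) acc) = PMF.pure (.pair tp.fst cx) := by
        simp [Prog.out_pair, Prog.out_comp, Prog.out_fst, Prog.out_snd, Val.fst, Val.snd,
          PMF.pure_map]
      rw [this, PMF.mem_support_pure_iff] at hw
      rw [hw]
      exact hdom m tp cx h1 h2 h3

/-! ### Assembling the view of the first server -/

namespace Prog

/-- The public key in a context `(c, ((h, N), (kr, kN)))`. -/
def ctxPk : Prog := comp snd (comp snd fst)

/-- A ciphertext of a view: the challenge in the context, or an encryption, according to the
slot `(flag, (m, r))` that is computed by `S`. -/
def slotP (S : Prog) : Prog :=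
  ifPos (comp S fst) (comp snd fst)
    (encP (comp ctxPk fst) (comp ctxPk snd) (comp S (comp snd fst)) (comp S (comp snd snd))
      (comp snd (comp snd (comp snd fst))) (comp snd (comp snd (comp snd snd))))

/-- The part of the view of the first server that belongs to one pair of plaintexts. -/
def entryP : Prog :=
  pair (slotP (comp fst (comp fst fst))) <|
  pair (slotP (comp fst (comp fst (comp snd fst)))) <|
  pair (comp fst (comp snd fst)) <|
  pair (comp fst (comp snd (comp snd fst))) <|
  pair (comp fst (comp snd (comp snd (comp snd fst)))) <|
  pair (comp fst (comp snd (comp snd (comp snd (comp snd fst))))) <|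
  pair (comp fst (comp snd (comp snd (comp snd (comp snd (comp snd fst)))))) <|
  pair (comp fst (comp snd (comp snd (comp snd (comp snd (comp snd snd)))))) <|
  pair (slotP (comp fst (comp fst (comp snd snd)))) (const 0)

/-- The view of the first server from a template `((sk₁, r), (s, entries))` and a context. -/
def assembleP : Prog :=
  pair ctxPk <| pair (comp fst (comp fst fst)) <| pair (comp fst (comp fst snd)) <|
  pair (mapP (comp fst (comp snd fst)) (comp fst (comp snd snd)) snd entryP) (const 0)

end Prog

/-- The value of a slot. -/
def slotV (S ctx : Val) : Val :=
  if 0 < S.fst.toInt then ctx.fst else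
    .num (encZ ctx.snd.fst.fst.toInt ctx.snd.fst.snd.toInt S.snd.fst.toInt S.snd.snd.toInt
      ctx.snd.snd.fst.toInt.toNat ctx.snd.snd.snd.toInt.toNat)

/-- The value of `entryP`. -/
def entryV (ctx e : Val) : Val :=
  .ofList [slotV e.fst.fst ctx, slotV e.fst.snd.fst ctx, e.snd.fst, e.snd.snd.fst,
    e.snd.snd.snd.fst, e.snd.snd.snd.snd.fst, e.snd.snd.snd.snd.snd.fst, e.snd.snd.snd.snd.snd.snd,
    slotV e.fst.snd.snd ctx]

theorem out_comp_fst {f : Prog} {v : Val} : (Prog.comp .fst f).out v = f.out v.fst :=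
  Prog.out_comp_pure (Prog.out_fst v)

theorem out_comp_snd {f : Prog} {v : Val} : (Prog.comp .snd f).out v = f.out v.snd :=
  Prog.out_comp_pure (Prog.out_snd v)

theorem out_ctxPk (v : Val) : Prog.ctxPk.out v = PMF.pure v.snd.snd.fst := by
  rw [Prog.ctxPk, out_comp_snd, out_comp_snd, Prog.out_fst]

theorem out_slotP {S : Prog} {e ctx vS : Val} (hS : S.out (.pair e ctx) = PMF.pure vS) :
    (Prog.slotP S).out (.pair e ctx) = PMF.pure (slotV vS ctx) := by
  rw [Prog.slotP, Prog.out_ifPos, Prog.out_comp_pure hS, Prog.out_fst, PMF.pure_bind, slotV,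
    out_comp_snd, Prog.out_fst, apply_ite PMF.pure]
  congr 1
  refine (Prog.out_encP ((Prog.out_comp_pure (out_ctxPk _)).trans (Prog.out_fst _))
    ((Prog.out_comp_pure (out_ctxPk _)).trans (Prog.out_snd _))
    ((Prog.out_comp_pure hS).trans (out_comp_snd.trans (Prog.out_fst _)))
    ((Prog.out_comp_pure hS).trans (out_comp_snd.trans (Prog.out_snd _)))
    (out_comp_snd.trans (out_comp_snd.trans (out_comp_snd.trans (Prog.out_fst _))))
    (out_comp_snd.trans (out_comp_snd.trans (out_comp_snd.trans (Prog.out_snd _)))))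

theorem out_entryP (e ctx : Val) :
    Prog.entryP.out (.pair e ctx) = PMF.pure (entryV ctx e) := by
  have h : ∀ f : Prog, (Prog.comp .fst f).out (.pair e ctx) = f.out e := fun f => out_comp_fst
  refine Prog.out_pair_pure (out_slotP ?_) <| Prog.out_pair_pure (out_slotP ?_) <|
    Prog.out_pair_pure ?_ <| Prog.out_pair_pure ?_ <| Prog.out_pair_pure ?_ <|
    Prog.out_pair_pure ?_ <| Prog.out_pair_pure ?_ <| Prog.out_pair_pure ?_ <|
    Prog.out_pair_pure (out_slotP ?_) (Prog.out_const _ _) <;>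
  simp only [h, out_comp_fst, out_comp_snd, Prog.out_fst, Prog.out_snd]

/-- The value of `assembleP`. -/
def assembleV (sk r ctx : Val) (l : List Val) : Val :=
  .ofList [ctx.snd.fst, sk, r, .ofList (l.map (entryV ctx)).reverse]

theorem out_assembleP (sk r ctx : Val) (l : List Val) :
    Prog.assembleP.out
      (.pair (.pair (.pair sk r) (.pair (.ofNat l.length) (.ofList l))) ctx) =
      PMF.pure (assembleV sk r ctx l) := by
  refine Prog.out_pair_pure (out_ctxPk _) <| Prog.out_pair_pure ?_ <| Prog.out_pair_pure ?_ <|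
    Prog.out_pair_pure (out_mapP_ofList ?_ ?_ (Prog.out_snd _) fun e => out_entryP e ctx)
      (Prog.out_const _ _) <;>
  simp only [out_comp_fst, out_comp_snd, Prog.out_fst, Prog.out_snd, Val.fst, Val.snd]

theorem polyOn_entryP {q : ℕ → ℕ} (hq : PolyBounded q) {I : ℕ → Set Val} (hI : SizeBdd I)
    (h : ∀ m, ∀ v ∈ I m, v.snd.snd.snd.fst.toInt.toNat ≤ q m ∧
      v.snd.snd.snd.snd.toInt.toNat ≤ q m) : PolyOn Prog.entryP I := by
  have hlf : ∀ f : Prog, f.LoopFree → PolyOn f I := fun f hf => .of_loopFree hf hI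
  have hslot : ∀ S : Prog, S.LoopFree → PolyOn (Prog.slotP S) I := by
    intro S hS
    refine .ifPos hI (hlf _ ⟨hS, trivial⟩) (hlf _ (by simp [Prog.LoopFree]))
      (polyOn_encP hI (hlf _ (by simp [Prog.LoopFree, Prog.ctxPk]))
        (hlf _ (by simp [Prog.LoopFree, Prog.ctxPk])) (hlf _ (by simp [Prog.LoopFree, hS]))
        (hlf _ (by simp [Prog.LoopFree, hS])) (hlf _ (by simp [Prog.LoopFree]))
        (hlf _ (by simp [Prog.LoopFree])) hq ?_ ?_)
    · intro m v hv w hw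
      rw [out_comp_snd, out_comp_snd, out_comp_snd, Prog.out_fst, PMF.mem_support_pure_iff] at hw
      rw [hw]
      exact (h m v hv).1
    · intro m v hv w hw
      rw [out_comp_snd, out_comp_snd, out_comp_snd, Prog.out_snd, PMF.mem_support_pure_iff] at hw
      rw [hw]
      exact (h m v hv).2
  refine .pair hI (hslot _ ?_) <| .pair hI (hslot _ ?_) <| .pair hI (hlf _ ?_) <|
    .pair hI (hlf _ ?_) <| .pair hI (hlf _ ?_) <| .pair hI (hlf _ ?_) <| .pair hI (hlf _ ?_) <|
    .pair hI (hlf _ ?_) <| .pair hI (hslot _ ?_) (hlf _ ?_) <;> simp [Prog.LoopFree]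

theorem polyOn_assembleP {q : ℕ → ℕ} (hq : PolyBounded q) {I : ℕ → Set Val} (hI : SizeBdd I)
    (h : ∀ m, ∀ v ∈ I m, v.snd.snd.snd.fst.toInt.toNat ≤ q m ∧
      v.snd.snd.snd.snd.toInt.toNat ≤ q m)
    (hs : ∀ m, ∀ v ∈ I m, v.fst.snd.fst.toInt.toNat ≤ q m) : PolyOn Prog.assembleP I := by
  have hlf : ∀ f : Prog, f.LoopFree → PolyOn f I := fun f hf => .of_loopFree hf hI
  refine .pair hI (hlf _ ?_) <| .pair hI (hlf _ ?_) <| .pair hI (hlf _ ?_) <| .pair hI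
    (polyOn_mapP (C := fun m => {c | c.snd.snd.fst.toInt.toNat ≤ q m ∧
      c.snd.snd.snd.toInt.toNat ≤ q m}) hI (hlf _ ?_) (hlf _ ?_) (hlf _ trivial) hq ?_ ?_ ?_)
    (hlf _ trivial)
  · simp [Prog.LoopFree, Prog.ctxPk]
  · simp [Prog.LoopFree]
  · simp [Prog.LoopFree]
  · simp [Prog.LoopFree]
  · simp [Prog.LoopFree]
  · intro m v hv w hw
    rw [out_comp_fst, out_comp_snd, Prog.out_fst, PMF.mem_support_pure_iff] at hw
    rw [hw]
    exact hs m v hv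
  · intro m v hv w hw
    rw [Prog.out_snd, PMF.mem_support_pure_iff] at hw
    rw [hw]
    exact h m v hv
  · intro B hB
    exact polyOn_entryP hq ⟨B, hB, fun m v hv => hv.1⟩ fun m v hv => hv.2

/-! ### Public keys -/

/-- Public keys with the distribution of `keyGen`. -/
noncomputable def pkGen (P : Params) (κ : ℕ) : PMF PublicKey :=
  (nGen P.n κ).bind fun t => (PMF.uniformOfFintype (ZMod t.N)ˣ).map fun y => ⟨t.N, -y ^ (2 * t.β)⟩

theorem do_pure_eq_map {α β : Type} (p : PMF α) (f : α → β) :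
    (do let a ← p; pure (f a)) = p.map f := rfl

/-- The public key and sk₁ are drawn independently; whatever depends on the keys only through these
two can be sampled from `pkGen` and a uniform sk₁. -/
theorem keyGen_bind {γ : Type*} (P : Params) (κ : ℕ) (F : PublicKey → ℕ → PMF γ) {G : Keys → PMF γ}
    (hG : ∀ η t y sk₁, G (mkKeys η t y sk₁) = F ⟨t.N, -y ^ (2 * t.β)⟩ sk₁) :
    (keyGen P κ).bind G = (pkGen P κ).bind fun pk =>
      (PMF.uniformOfFintype (Fin (2 ^ P.σ))).bind fun sk₁ => F pk sk₁ := by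
  simp only [keyGen, pkGen, do_pure_eq_map, PMF.map_comp, PMF.bind_bind, PMF.bind_map,
    Function.comp_def, hG]

theorem accepted_of_mem_support {n κ : ℕ} (h : ∃ t : Factors, t.Accepted n κ) {t : Factors}
    (ht : t ∈ (nGen n κ).support) : t.Accepted n κ := by
  obtain ⟨t₀, h₀⟩ := h
  have hne : (Factors.finite_accepted n κ).toFinset.Nonempty := ⟨t₀, by simpa using h₀⟩
  rw [nGen, dif_pos hne, PMF.mem_support_uniformOfFinset_iff] at ht
  simpa using ht

theorem exists_accepted_of_mem_support {P : Params} {κ : ℕ} (h : ∃ t : Factors, t.Accepted P.n κ)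
    {pk : PublicKey} (hpk : pk ∈ (pkGen P κ).support) :
    ∃ t : Factors, t.Accepted P.n κ ∧ pk.N = t.N := by
  rw [pkGen, PMF.mem_support_bind_iff] at hpk
  obtain ⟨t, ht, hpk⟩ := hpk
  obtain ⟨y, -, rfl⟩ := (PMF.mem_support_map_iff _ _ _).1 hpk
  exact ⟨t, accepted_of_mem_support h ht, rfl⟩

theorem encEnsemble_eq (P : Params) (κ : ℕ) (m : ℤ) :
    encEnsemble P κ m = (pkGen P κ).bind fun pk => (PMF.uniformOfFintype (EncCoin κ)).map fun (r : EncCoin κ) =>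
      .pair pk.toVal (ctVal (enc pk m r)) := by
  simp only [encEnsemble, do_pure_eq_map, PMF.map_comp]
  rw [keyGen_bind P κ (fun pk _ => (PMF.uniformOfFintype (EncCoin κ)).map fun (r : EncCoin κ) =>
      .pair pk.toVal (ctVal (enc pk m r))) fun _ _ _ _ => rfl]
  simp

theorem uniform_map_of_equiv {α β γ : Type*} [Fintype α] [Nonempty α] [Fintype β] [Nonempty β]
    (e : α ≃ β) (F : β → γ) :
    (PMF.uniformOfFintype β).map F = (PMF.uniformOfFintype α).map fun a => F (e a) := by
  rw [← uniform_map_equiv e, PMF.map_comp]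
  rfl

/-! ### The view of the first server -/

/-- The randomness of the first server for one pair of plaintexts. -/
abbrev S1Lits (P : Params) (κ : ℕ) : Type :=
  Fin (2 ^ P.σ) × Fin (2 ^ P.σ) × EncCoin κ × EncCoin κ × EncCoin κ × EncCoin κ

/-- The positions of the input ciphertexts and of the message to the first server. -/
abbrev Slot (P : Params) : Type := Fin P.s × Fin 3

/-- Everything random in the view of the first server except for the public key: its key, its
randomness, and the randomness of the ciphertexts. -/
abbrev S1Rand (P : Params) (κ : ℕ) : Type :=
  (Fin (2 ^ P.σ) × EncCoin κ × (Fin P.s → S1Lits P κ)) × (Slot P → EncCoin κ)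

/-- The view of the first server when the ciphertexts are encryptions of `m`. -/
def s1View {P : Params} {κ : ℕ} (pk : PublicKey) (m : Slot P → ℤ) (ω : S1Rand P κ) : Val :=
  .ofList [pk.toVal, .ofNat ω.1.1, .ofNat ω.1.2.1, .ofList (List.ofFn fun i => .ofList
    [ctVal (enc pk (m (i, 0)) (ω.2 (i, 0))), ctVal (enc pk (m (i, 1)) (ω.2 (i, 1))),
      .ofNat (ω.1.2.2 i).1, .ofNat (ω.1.2.2 i).2.1, .ofNat (ω.1.2.2 i).2.2.1,
      .ofNat (ω.1.2.2 i).2.2.2.1, .ofNat (ω.1.2.2 i).2.2.2.2.1, .ofNat (ω.1.2.2 i).2.2.2.2.2,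
      ctVal (enc pk (m (i, 2)) (ω.2 (i, 2)))])]

/-- The plaintexts of the ciphertexts in the view of the first server. -/
def s1Msg {P : Params} {κ : ℕ} (x y : Fin P.s → ℤ) (l : Fin P.s → S1Lits P κ) (j : Slot P) : ℤ :=
  ![x j.1, y j.1, (x j.1 + ((l j.1).1 : ℕ)) * (y j.1 + ((l j.1).2.1 : ℕ))] j.2

/-- By `msg₂_msg₁` the reply of S₂ is a fresh encryption of the masked product, so nothing else of
the unpacking survives in the view. -/
theorem view₁_eq {P : Params} {κ : ℕ} (hP : P.Valid κ) {t : Factors} (ht : t.Accepted P.n κ)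
    (y₀ : (ZMod t.N)ˣ) (sk₁ : Fin (2 ^ P.σ)) {x y : Fin P.s → ℤ} (hx : Admissible P x)
    (hy : Admissible P y) (w : InCoins P κ) (c₁ : S1Coins P κ) (c₂ : S2Coins P κ) :
    view₁ P (mkKeys P.η t y₀ sk₁) x y w c₁ c₂ = s1View (mkKeys P.η t y₀ sk₁).pk
      (s1Msg (κ := κ) x y fun i => ⟨c₁.r₁ i, c₁.r₂ i, c₁.encr₁ i, c₁.encr₂ i, c₁.encProd i, c₁.encSum i⟩)
      ((sk₁, c₁.encδ, fun i => ⟨c₁.r₁ i, c₁.r₂ i, c₁.encr₁ i, c₁.encr₂ i, c₁.encProd i,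
        c₁.encSum i⟩), fun j => ![w.1 j.1, w.2 j.1, c₂ j.1] j.2) := by
  rw [view₁]
  simp only [hP.msg₂_msg₁ ht y₀ sk₁ hx hy w c₁ c₂]
  rfl

/-- The randomness of the view of the first server in terms of that of the protocol. -/
def s1RandEquiv (P : Params) (κ : ℕ) : S1Rand P κ ≃ Fin (2 ^ P.σ) × InCoins P κ ×
    (EncCoin κ × (Fin P.s → Fin (2 ^ P.σ)) × (Fin P.s → Fin (2 ^ P.σ)) ×
    (Fin P.s → EncCoin κ) × (Fin P.s → EncCoin κ) × (Fin P.s → EncCoin κ) ×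
    (Fin P.s → EncCoin κ)) × S2Coins P κ where
  toFun ω := (ω.1.1, (fun i => ω.2 (i, 0), fun i => ω.2 (i, 1)), (ω.1.2.1, fun i => (ω.1.2.2 i).1,
    fun i => (ω.1.2.2 i).2.1, fun i => (ω.1.2.2 i).2.2.1, fun i => (ω.1.2.2 i).2.2.2.1,
    fun i => (ω.1.2.2 i).2.2.2.2.1, fun i => (ω.1.2.2 i).2.2.2.2.2), fun i => ω.2 (i, 2))
  invFun c := ((c.1, c.2.2.1.1, fun i => (c.2.2.1.2.1 i, c.2.2.1.2.2.1 i, c.2.2.1.2.2.2.1 i,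
    c.2.2.1.2.2.2.2.1 i, c.2.2.1.2.2.2.2.2.1 i, c.2.2.1.2.2.2.2.2.2 i)),
    fun j => ![c.2.1.1 j.1, c.2.1.2 j.1, c.2.2.2 j.1] j.2)
  left_inv ω := by
    refine Prod.ext rfl (funext fun ⟨i, a⟩ => ?_)
    fin_cases a <;> rfl
  right_inv c := rfl

theorem realView_S1 {P : Params} {κ : ℕ} (hP : P.Valid κ) (h : ∃ t : Factors, t.Accepted P.n κ)
    {x y : Fin P.s → ℤ} (hx : Admissible P x) (hy : Admissible P y) :
    realView .S1 P κ x y = (pkGen P κ).bind fun pk => (PMF.uniformOfFintype (S1Rand P κ)).map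
      fun ω => s1View pk (s1Msg x y ω.1.2.2) ω := by
  simp only [realView, keyGen, pkGen, do_pure_eq_map, PMF.map_comp, PMF.bind_bind, PMF.bind_map,
    Function.comp_def]
  refine bind_congr_support fun t ht => ?_
  congr 1
  funext y₀
  simp only [s1CoinsDist, PMF.bind_map, Function.comp_def,
    view₁_eq hP (accepted_of_mem_support h ht) y₀ _ hx hy]
  rw [uniform_map_of_equiv (s1RandEquiv P κ).symm, ← uniform_bind_map_mk (α := Fin (2 ^ P.σ)),
    PMF.map_bind]
  congr 1
  funext sk₁
  rw [PMF.map_comp, ← uniform_bind_map_mk (α := InCoins P κ), PMF.map_bind]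
  congr 1
  funext w
  rw [PMF.map_comp, ← uniform_bind_map_mk (β := S2Coins P κ), PMF.map_bind]
  congr 1
  funext c
  rw [PMF.map_comp]
  rfl

/-! ### Templates for the view of the first server -/

/-- A slot of a template. -/
def slotT (flag m : ℤ) (r : ℕ) : Val := .pair (.num flag) (.pair (.num m) (.ofNat r))

/-- An entry of a template. -/
def entryT {P : Params} {κ : ℕ} (S : Fin 3 → Val) (l : S1Lits P κ) : Val :=
  .pair (.pair (S 0) (.pair (S 1) (S 2))) (.pair (.ofNat l.1) (.pair (.ofNat l.2.1)
    (.pair (.ofNat l.2.2.1) (.pair (.ofNat l.2.2.2.1)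
      (.pair (.ofNat l.2.2.2.2.1) (.ofNat l.2.2.2.2.2))))))

/-- The entries of a template in the order in which they are processed. -/
def entriesT {P : Params} {κ : ℕ} (S : Slot P → Val) (l : Fin P.s → S1Lits P κ) : List Val :=
  List.ofFn fun i => entryT (fun a => S (i.rev, a)) (l i.rev)

/-- The context for a challenge `c`. -/
def ctxT (n κ : ℕ) (pk : Val) (c : Val) : Val :=
  .pair c (.pair pk (.pair (.ofNat (4 * κ)) (.ofNat n)))

/-- Template entries are stored backwards to compensate for the reversal in `mapP`. -/
theorem reverse_map_ofFn_rev {α β : Type*} {n : ℕ} (f : Fin n → α) (g : α → β) :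
    ((List.ofFn fun i => f i.rev).map g).reverse = List.ofFn fun i => g (f i) := by
  refine List.ext_getElem (by simp) fun i h1 h2 => ?_
  simp only [List.length_ofFn] at h2
  simp only [List.getElem_reverse, List.getElem_map, List.getElem_ofFn, List.length_map,
    List.length_ofFn]
  congr 2
  ext
  simp only [Fin.val_rev]
  omega

theorem slotV_of_flag_eq_one (m : ℤ) (r n κ : ℕ) (pk c : Val) :
    slotV (slotT 1 m r) (ctxT n κ pk c) = c := by
  simp [slotV, slotT, ctxT, Val.fst, Val.toInt]

theorem slotV_of_flag_eq_zero {n κ : ℕ} (pk : PublicKey) [NeZero pk.N] (hN : pk.N < 2 ^ n) (m : ℤ)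
    (r : EncCoin κ) (c : Val) :
    slotV (slotT 0 m r) (ctxT n κ pk.toVal c) = ctVal (enc pk m r) := by
  rw [slotV, if_neg (by simp [slotT, Val.fst, Val.toInt]), ctVal, Val.ofNat,
    ← encZ_eq pk m r.isLt hN]
  rfl

/-- Used for both the simulator, whose slots all hold zero messages, and the reduction, where one
slot holds the challenge. -/
theorem assembleV_entriesT {P : Params} {κ : ℕ} (n : ℕ) (pk : PublicKey) (c : Val)
    (S : Slot P → Val) (m : Slot P → ℤ) (ω : S1Rand P κ)
    (h : ∀ j, slotV (S j) (ctxT n κ pk.toVal c) = ctVal (enc pk (m j) (ω.2 j))) :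
    assembleV (.ofNat ω.1.1) (.ofNat ω.1.2.1) (ctxT n κ pk.toVal c) (entriesT S ω.1.2.2) =
      s1View pk m ω := by
  rw [assembleV, entriesT, reverse_map_ofFn_rev (fun i => entryT (fun a => S (i, a)) (ω.1.2.2 i)),
    s1View]
  simp only [← h]
  rfl

/-! ### Simulators -/

theorem out_pair_uniform {α β : Type*} [Fintype α] [Nonempty α] [Fintype β] [Nonempty β]
    {f g : Prog} {v : Val} {φ : α → Val} {ψ : β → Val}
    (hf : f.out v = (PMF.uniformOfFintype α).map φ) (hg : g.out v = (PMF.uniformOfFintype β).map ψ) :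
    (Prog.pair f g).out v =
      (PMF.uniformOfFintype (α × β)).map fun p => .pair (φ p.1) (ψ p.2) := by
  rw [Prog.out_pair, hf, hg, PMF.bind_map, ← uniform_bind_map fun a b => Val.pair (φ a) (ψ b)]
  simp only [PMF.map_comp, Function.comp_def]

theorem out_pair_pure_uniform {β : Type*} [Fintype β] [Nonempty β] {f g : Prog} {v a : Val}
    {ψ : β → Val} (hf : f.out v = PMF.pure a) (hg : g.out v = (PMF.uniformOfFintype β).map ψ) :
    (Prog.pair f g).out v = (PMF.uniformOfFintype β).map fun b => .pair a (ψ b) := by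
  rw [Prog.out_pair, hf, hg, PMF.pure_bind, PMF.map_comp]
  rfl

theorem out_pair_uniform_pure {α : Type*} [Fintype α] [Nonempty α] {f g : Prog} {v b : Val}
    {φ : α → Val} (hf : f.out v = (PMF.uniformOfFintype α).map φ) (hg : g.out v = PMF.pure b) :
    (Prog.pair f g).out v = (PMF.uniformOfFintype α).map fun a => .pair (φ a) b := by
  rw [Prog.out_pair, hf, hg]
  simp only [PMF.pure_map]
  rw [PMF.bind_map, ← PMF.bind_pure_comp]
  rfl

theorem out_comp_uniform {α : Type*} [Fintype α] [Nonempty α] {f g : Prog} {v : Val}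
    {φ ψ : α → Val} (hf : f.out v = (PMF.uniformOfFintype α).map φ)
    (hg : ∀ a, g.out (φ a) = PMF.pure (ψ a)) :
    (Prog.comp f g).out v = (PMF.uniformOfFintype α).map ψ := by
  rw [Prog.out_comp, hf, PMF.bind_map, ← PMF.bind_pure_comp]
  congr 1
  funext a
  exact hg a

/-- The input of a simulator, with the security parameter. -/
def simIn (P : Params) (κ : ℕ) (pk sk : Val) : Val :=
  .pair (.ofNat κ) (.ofList [.ofNat P.n, .ofNat P.ℓ, .ofNat P.σ, .ofNat P.L, .ofNat P.δ, .ofNat P.s,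
    pk, sk])

theorem simView_eq (Sim : Prog) (S : Server) (P : Params) (κ : ℕ) :
    simView Sim S P κ = (keyGen P κ).bind fun k =>
      Sim.out (simIn P κ k.pk.toVal (.num (S.key k))) := rfl

/-- The inputs of simulators, by size. -/
def simDom (par : ℕ → Params) (m : ℕ) : Set Val :=
  {v | ∃ κ pk sk, v = simIn (par κ) κ pk sk ∧ κ ≤ m ∧ v.size ≤ 3 + 2 * m}

theorem sizeBdd_simDom (par : ℕ → Params) : SizeBdd (simDom par) :=
  ⟨_, (PolyBounded.const 3).add ((PolyBounded.const 2).mul PolyBounded.id),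
    fun _ _ ⟨_, _, _, _, _, h⟩ => h⟩

theorem size_ofNat_le (n : ℕ) : (Val.ofNat n).size ≤ 1 + n := by
  have : n.size ≤ n := Nat.size_le.2 n.lt_two_pow_self
  simp only [Val.ofNat, Val.size, Int.natAbs_natCast]
  omega

/-- The parameter m is κ plus the size of the input proper, so `PolyTimeOn` follows from a bound in
the single variable m. -/
theorem polyTimeOn_of_polyOn {par : ℕ → Params} {Sim : Prog} (S : Server)
    (h : PolyOn Sim (simDom par)) :
    PolyTimeOn Sim (fun κ => {v | ∃ k ∈ (keyGen (par κ) κ).support, v = simInput S (par κ) k}) := by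
  obtain ⟨T, ⟨p, hp⟩, hT⟩ := h
  refine ⟨p, ?_⟩
  rintro κ _ ⟨k, -, rfl⟩ o ho
  refine (hT _ _ ⟨κ, k.pk.toVal, .num (S.key k), rfl, Nat.le_add_right _ _, ?_⟩ o ho).trans (hp _)
  have h1 := size_ofNat_le κ
  have h2 : (simIn (par κ) κ k.pk.toVal (.num (S.key k))).size =
    1 + (Val.ofNat κ).size + (simInput S (par κ) k).size := rfl
  omega

/-- For a given m, inputs belonging to every κ ≤ m have to be bounded at once. -/
theorem PolyBounded.exists_monotone {f : ℕ → ℕ} (hf : PolyBounded f) :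
    ∃ g, PolyBounded g ∧ Monotone g ∧ ∀ κ, f κ ≤ g κ := by
  obtain ⟨p, hp⟩ := hf
  exact ⟨fun κ => p.eval κ, ⟨p, fun _ => le_rfl⟩, fun _ _ h => PolyBounded.eval_mono p h, hp⟩

namespace Prog

/-- The elements of a list. -/
def nth : ℕ → Prog
  | 0 => fst
  | j + 1 => comp snd (nth j)

/-- The parts of the input of a simulator. -/
def item (j : ℕ) : Prog := comp snd (nth j)

/-- The number of bits of the randomness of encryptions. -/
def coinBits : Prog := op .mul (const 4) fst

theorem loopFree_nth (j : ℕ) : (nth j).LoopFree := by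
  induction j with
  | zero => trivial
  | succ j ih => exact ⟨trivial, ih⟩

theorem loopFree_item (j : ℕ) : (item j).LoopFree := ⟨trivial, loopFree_nth j⟩

theorem out_nth (j : ℕ) (l : List Val) :
    (nth j).out (.ofList l) = PMF.pure (l.getD j (.num 0)) := by
  induction j generalizing l with
  | zero => cases l <;> rw [nth, out_fst] <;> rfl
  | succ j ih =>
    rw [nth, out_comp_snd]
    cases l with
    | nil => exact ih []
    | cons a l => simpa [Val.ofList, Val.snd] using ih l

theorem out_item (j : ℕ) (k : Val) (l : List Val) :
    (item j).out (.pair k (.ofList l)) = PMF.pure (l.getD j (.num 0)) := by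
  rw [item, out_comp_snd, Val.snd, out_nth]

theorem out_coinBits (κ : ℕ) (v : Val) :
    coinBits.out (.pair (.ofNat κ) v) = PMF.pure (.ofNat (4 * κ)) := by
  rw [coinBits, out_op (out_const _ _) (out_fst _)]
  simp [Arith.eval, Val.fst, Val.ofNat, Val.toInt]

/-- A slot of a template, for an encryption of `0` with fresh randomness. -/
def slotS : Prog := pair (const 0) (pair (const 0) (uniP (comp snd snd)))

/-- An entry of a template with fresh randomness. -/
def entryS : Prog :=
  pair (pair slotS (pair slotS slotS)) <|
  pair (uniP (comp snd fst)) <| pair (uniP (comp snd fst)) <| pair (uniP (comp snd snd)) <|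
  pair (uniP (comp snd snd)) <| pair (uniP (comp snd snd)) (uniP (comp snd snd))

/-- The simulator for the first server. -/
def sim₁ : Prog :=
  comp (pair
    (pair (pair (item 7) (uniP coinBits))
      (pair (item 5) (mapP (item 5) (const 0) (pair (item 2) coinBits) entryS)))
    (pair (const 0) (pair (item 6) (pair coinBits (item 0))))) assembleP

end Prog

theorem out_slotS (κ : ℕ) (e a : Val) :
    Prog.slotS.out (.pair e (.pair a (.ofNat (4 * κ)))) =
      (PMF.uniformOfFintype (EncCoin κ)).map fun (r : EncCoin κ) => slotT 0 0 r :=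
  out_pair_pure_uniform (Prog.out_const _ _) <| out_pair_pure_uniform (Prog.out_const _ _) <|
    out_uniP (out_comp_snd.trans (Prog.out_snd _))

theorem out_entryS (P : Params) (κ : ℕ) (e : Val) :
    Prog.entryS.out (.pair e (.pair (.ofNat P.σ) (.ofNat (4 * κ)))) =
      (PMF.uniformOfFintype ((EncCoin κ × EncCoin κ × EncCoin κ) × S1Lits P κ)).map fun w =>
        entryT (fun a => slotT 0 0 (![w.1.1, w.1.2.1, w.1.2.2] a : EncCoin κ)) w.2 := by
  have h1 := out_uniP (k := .comp .snd .fst) (v := .pair e (.pair (.ofNat P.σ) (.ofNat (4 * κ))))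
    (out_comp_snd.trans (Prog.out_fst _))
  have h2 := out_uniP (k := .comp .snd .snd) (v := .pair e (.pair (.ofNat P.σ) (.ofNat (4 * κ))))
    (out_comp_snd.trans (Prog.out_snd _))
  have h3 := out_slotS κ e (.ofNat P.σ)
  exact out_pair_uniform (out_pair_uniform h3 (out_pair_uniform h3 h3)) <| out_pair_uniform h1 <|
    out_pair_uniform h1 <| out_pair_uniform h2 <| out_pair_uniform h2 <| out_pair_uniform h2 h2

/-- The randomness of the view of the first server in the order in which the simulator draws it. -/
def s1SimEquiv (P : Params) (κ : ℕ) : S1Rand P κ ≃ Fin (2 ^ P.σ) × EncCoin κ ×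
    (Fin P.s → (EncCoin κ × EncCoin κ × EncCoin κ) × S1Lits P κ) where
  toFun ω := (ω.1.1, ω.1.2.1, fun i =>
    ((ω.2 (i.rev, 0), ω.2 (i.rev, 1), ω.2 (i.rev, 2)), ω.1.2.2 i.rev))
  invFun c := ((c.1, c.2.1, fun i => (c.2.2 i.rev).2),
    fun j => ![(c.2.2 j.1.rev).1.1, (c.2.2 j.1.rev).1.2.1, (c.2.2 j.1.rev).1.2.2] j.2)
  left_inv ω := by
    refine Prod.ext (by simp) (funext fun ⟨i, a⟩ => ?_)
    fin_cases a <;> simp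
  right_inv c := by simp

theorem out_sim₁ (P : Params) (κ : ℕ) (pk sk : Val) :
    Prog.sim₁.out (simIn P κ pk sk) = (PMF.uniformOfFintype (EncCoin κ ×
      (Fin P.s → (EncCoin κ × EncCoin κ × EncCoin κ) × S1Lits P κ))).map fun w =>
        assembleV sk (.ofNat w.1) (ctxT P.n κ pk (.num 0)) (List.ofFn fun i =>
          entryT (fun a => slotT 0 0
            (![(w.2 i).1.1, (w.2 i).1.2.1, (w.2 i).1.2.2] a : EncCoin κ)) (w.2 i).2) := by
  have hi : ∀ j, (Prog.item j).out (simIn P κ pk sk) = _ := fun j => Prog.out_item j _ _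
  have hc : Prog.coinBits.out (simIn P κ pk sk) = _ := Prog.out_coinBits κ _
  have hm := out_mapP_uniform (hi 5) (Prog.out_const 0 _) (Prog.out_pair_pure (hi 2) hc)
    (out_entryS P κ _)
  refine out_comp_uniform (out_pair_uniform_pure (out_pair_uniform
    (out_pair_pure_uniform (hi 7) (out_uniP hc)) (out_pair_pure_uniform (hi 5) hm))
    (Prog.out_pair_pure (Prog.out_const _ _) (Prog.out_pair_pure (hi 6)
      (Prog.out_pair_pure hc (hi 0))))) fun w => ?_
  have := out_assembleP sk (.ofNat w.1) (ctxT P.n κ pk (.num 0)) (List.ofFn fun i =>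
          entryT (fun a => slotT 0 0
            (![(w.2 i).1.1, (w.2 i).1.2.1, (w.2 i).1.2.2] a : EncCoin κ)) (w.2 i).2)
  rw [List.length_ofFn] at this
  exact this

theorem simView_sim₁ {P : Params} {κ : ℕ} (h : ∃ t : Factors, t.Accepted P.n κ) :
    simView Prog.sim₁ .S1 P κ = (pkGen P κ).bind fun pk =>
      (PMF.uniformOfFintype (S1Rand P κ)).map fun ω => s1View pk 0 ω := by
  rw [simView_eq, keyGen_bind P κ (fun pk sk => Prog.sim₁.out (simIn P κ pk.toVal (.ofNat sk)))
    fun _ _ _ _ => rfl]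
  refine bind_congr_support fun pk hpk => ?_
  obtain ⟨t, ht, hN⟩ := exists_accepted_of_mem_support h hpk
  have : NeZero pk.N := ⟨by rw [hN]; exact (zero_lt_one.trans ht.one_lt_N).ne'⟩
  have hNn : pk.N < 2 ^ P.n := by rw [hN]; exact Nat.size_le.1 ht.size_N_le
  simp only [out_sim₁]
  rw [uniform_bind_map fun (b : Fin (2 ^ P.σ)) (w : EncCoin κ ×
      (Fin P.s → (EncCoin κ × EncCoin κ × EncCoin κ) × S1Lits P κ)) =>
        assembleV (.ofNat b) (.ofNat w.1) (ctxT P.n κ pk.toVal (.num 0)) (List.ofFn fun i =>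
          entryT (fun a => slotT 0 0
            (![(w.2 i).1.1, (w.2 i).1.2.1, (w.2 i).1.2.2] a : EncCoin κ)) (w.2 i).2),
    uniform_map_of_equiv (s1SimEquiv P κ)]
  congr 1
  funext ω
  -- No slot is flagged, so the dummy challenge `num 0` is never inserted.
  rw [← assembleV_entriesT P.n pk (.num 0) (fun j => slotT 0 0 (ω.2 j)) 0 ω
    fun j => slotV_of_flag_eq_zero pk hNn 0 _ _]
  congr 1

theorem polyOn_sim₁ {par : ℕ → Params} (hn : PolyBounded fun κ => (par κ).n)
    (hσ : PolyBounded fun κ => (par κ).σ) (hs : PolyBounded fun κ => (par κ).s) :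
    PolyOn Prog.sim₁ (simDom par) := by
  -- 4κ, n, σ and s are the quantities that serve as loop counts, hence must be bounded by value.
  obtain ⟨q, hq, hmono, hle⟩ := (((PolyBounded.const 4).mul PolyBounded.id).add
    (hn.add (hσ.add hs))).exists_monotone
  have hI := sizeBdd_simDom par
  have hlf : ∀ f : Prog, f.LoopFree → PolyOn f (simDom par) := fun f hf => .of_loopFree hf hI
  have hcb : PolyOn Prog.coinBits (simDom par) := hlf _ (by simp [Prog.coinBits, Prog.op, Prog.LoopFree])
  have hit : ∀ j, PolyOn (Prog.item j) (simDom par) := fun j => hlf _ (Prog.loopFree_item j)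
  have hcq : ∀ m, ∀ v ∈ simDom par m, ∀ w ∈ (Prog.coinBits.out v).support, w.toInt.toNat ≤ q m := by
    rintro m _ ⟨κ, pk, sk, rfl, hκ, -⟩ w hw
    rw [simIn, Prog.out_coinBits, PMF.mem_support_pure_iff] at hw
    subst hw
    have := (hle κ).trans (hmono hκ)
    simp only [Val.ofNat, Val.toInt, Int.toNat_natCast]
    omega
  have hsq : ∀ m, ∀ v ∈ simDom par m, ∀ w ∈ ((Prog.item 5).out v).support, w.toInt.toNat ≤ q m := by
    rintro m _ ⟨κ, pk, sk, rfl, hκ, -⟩ w hw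
    rw [simIn, Prog.out_item, PMF.mem_support_pure_iff] at hw
    subst hw
    have := (hle κ).trans (hmono hκ)
    simp only [List.getD_cons_succ, List.getD_cons_zero, Val.ofNat, Val.toInt, Int.toNat_natCast]
    omega
  have hentry : ∀ I, SizeBdd I → (∀ m, ∀ v ∈ I m, v.snd.fst.toInt.toNat ≤ q m ∧
      v.snd.snd.toInt.toNat ≤ q m) → PolyOn Prog.entryS I := by
    intro I hI h
    have h1 : PolyOn (.uniP (.comp .snd .fst)) I := polyOn_uniP hI
      (.of_loopFree ⟨trivial, trivial⟩ hI) hq fun m v hv w hw => by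
        rw [out_comp_snd, Prog.out_fst, PMF.mem_support_pure_iff] at hw
        exact hw ▸ (h m v hv).1
    have h2 : PolyOn (.uniP (.comp .snd .snd)) I := polyOn_uniP hI
      (.of_loopFree ⟨trivial, trivial⟩ hI) hq fun m v hv w hw => by
        rw [out_comp_snd, Prog.out_snd, PMF.mem_support_pure_iff] at hw
        exact hw ▸ (h m v hv).2
    have h0 : PolyOn (.const 0) I := .of_loopFree trivial hI
    have h3 : PolyOn .slotS I := .pair hI h0 (.pair hI h0 h2)
    exact .pair hI (.pair hI h3 (.pair hI h3 h3)) <| .pair hI h1 <| .pair hI h1 <| .pair hI h2 <|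
      .pair hI h2 <| .pair hI h2 h2
  have hmap : PolyOn (.mapP (.item 5) (.const 0) (.pair (.item 2) .coinBits) .entryS)
      (simDom par) := by
    refine polyOn_mapP (C := fun m => {c | c.fst.toInt.toNat ≤ q m ∧ c.snd.toInt.toNat ≤ q m}) hI
      (hit 5) (hlf _ trivial) (.pair hI (hit 2) hcb) hq hsq ?_
      fun B hB => hentry _ ⟨B, hB, fun m v hv => hv.1⟩ fun m v hv => hv.2
    rintro m v hv w hw
    obtain ⟨a, ha, b, hb, rfl⟩ := mem_support_out_pair hw
    refine ⟨?_, hcq m v hv b hb⟩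
    obtain ⟨κ, pk, sk, rfl, hκ, -⟩ := hv
    rw [simIn, Prog.out_item, PMF.mem_support_pure_iff] at ha
    subst ha
    have := (hle κ).trans (hmono hκ)
    simp only [List.getD_cons_succ, List.getD_cons_zero, Val.fst, Val.ofNat, Val.toInt,
      Int.toNat_natCast]
    omega
  have htmpl := PolyOn.pair hI (.pair hI (.pair hI (hit 7) (polyOn_uniP hI hcb hq hcq))
    (.pair hI (hit 5) hmap)) (.pair hI (hlf (.const 0) trivial) (.pair hI (hit 6)
      (.pair hI hcb (hit 0))))
  obtain ⟨B, hB, hIB⟩ := htmpl.sizeBdd_out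
  refine htmpl.comp (J := fun m => {w | w.size ≤ B m ∧ (w.snd.snd.snd.fst.toInt.toNat ≤ q m ∧
    w.snd.snd.snd.snd.toInt.toNat ≤ q m) ∧ w.fst.snd.fst.toInt.toNat ≤ q m}) ?_
    (polyOn_assembleP hq ⟨B, hB, fun m v hv => hv.1⟩ (fun m v hv => hv.2.1) fun m v hv => hv.2.2)
  intro m v hv w hw
  refine ⟨hIB m w ⟨v, hv, hw⟩, ?_⟩
  obtain ⟨a, ha, b, hb, rfl⟩ := mem_support_out_pair hw
  obtain ⟨-, -, a2, ha2, rfl⟩ := mem_support_out_pair ha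
  obtain ⟨a3, ha3, -, -, rfl⟩ := mem_support_out_pair ha2
  obtain ⟨-, -, b2, hb2, rfl⟩ := mem_support_out_pair hb
  obtain ⟨-, -, b3, hb3, rfl⟩ := mem_support_out_pair hb2
  obtain ⟨b4, hb4, b5, hb5, rfl⟩ := mem_support_out_pair hb3
  refine ⟨⟨hcq m v hv b4 hb4, ?_⟩, hsq m v hv a3 ha3⟩
  obtain ⟨κ, pk, sk, rfl, hκ, -⟩ := hv
  rw [simIn, Prog.out_item, PMF.mem_support_pure_iff] at hb5
  subst hb5
  have := (hle κ).trans (hmono hκ)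
  simp only [List.getD_cons_zero, Val.snd, Val.ofNat, Val.toInt, Int.toNat_natCast]
  omega

/-! ### Reduction to the security of the cryptosystem -/

/-- The test that an adversary applies to a sample, for a given advice. -/
noncomputable def Prog.test (f : Prog) (κ : ℕ) (adv v : Val) : PMF Bool :=
  (f.out (.pair (.ofNat κ) (.pair adv v))).map Val.isOne

theorem Adversary.prob_eq (A : Adversary) (κ : ℕ) (X : PMF Val) :
    A.prob κ X = accept (A.prog.test κ (A.advice κ)) X := by
  have : A.prog.test κ (A.advice κ) = fun v =>
      (A.prog.run (.pair (.ofNat κ) (.pair (A.advice κ) v))).map fun o => o.1.isOne := by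
    funext v
    rw [Prog.test, Prog.out, PMF.map_comp]
    rfl
  rw [accept, this]
  rfl

namespace Prog

/-- Insert a challenge into the template that is given as advice and apply `f` to the result. -/
def reduce (f : Prog) : Prog :=
  comp (pair fst (pair (comp snd (comp fst fst)) (comp
    (pair (comp snd (comp fst (comp snd fst))) (pair (comp snd (comp snd snd))
      (pair (comp snd (comp snd fst)) (comp snd (comp fst (comp snd snd))))))
    assembleP))) f

end Prog

/-- A template for the view of the first server. -/
def template {P : Params} {κ : ℕ} (S : Slot P → Val) (ω : S1Rand P κ) : Val :=
  .pair (.pair (.ofNat ω.1.1) (.ofNat ω.1.2.1)) (.pair (.ofNat P.s) (.ofList (entriesT S ω.1.2.2)))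

/-- The advice of the reduction. -/
def reduceAdvice (n κ : ℕ) (adv T : Val) : Val :=
  .pair adv (.pair T (.pair (.ofNat (4 * κ)) (.ofNat n)))

/-- The sample supplies the public key and the challenge, the advice everything else; together they
form the input of `assembleP`, whose result is handed to `f`. -/
theorem test_reduce (f : Prog) {P : Params} {κ : ℕ} (adv : Val) (S : Slot P → Val) (ω : S1Rand P κ)
    (pk c : Val) :
    f.reduce.test κ (reduceAdvice P.n κ adv (template S ω)) (.pair pk c) =
      f.test κ adv (assembleV (.ofNat ω.1.1) (.ofNat ω.1.2.1) (ctxT P.n κ pk c)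
        (entriesT S ω.1.2.2)) := by
  have h := out_assembleP (.ofNat ω.1.1) (.ofNat ω.1.2.1) (ctxT P.n κ pk c) (entriesT S ω.1.2.2)
  have hl : (entriesT S ω.1.2.2).length = P.s := List.length_ofFn
  rw [hl] at h
  rw [Prog.test, Prog.test, Prog.reduce]
  congr 1
  refine Prog.out_comp_pure (Prog.out_pair_pure (Prog.out_fst _) (Prog.out_pair_pure ?_
    ((Prog.out_comp_pure (Prog.out_pair_pure ?_ (Prog.out_pair_pure ?_
      (Prog.out_pair_pure ?_ ?_)))).trans h))) <;>
  simp only [out_comp_fst, out_comp_snd, Prog.out_fst, Prog.out_snd] <;> rfl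

/-- The reduction. -/
def Adversary.reduce (A : Adversary) (n : ℕ → ℕ) (T : ℕ → Val) (hn : PolyBounded n)
    (hT : PolyBounded fun κ => (T κ).size)
    (hs : PolyBounded fun κ => (T κ).snd.fst.toInt.toNat) : Adversary where
  prog := A.prog.reduce
  advice κ := reduceAdvice (n κ) κ (A.advice κ) (T κ)
  polyAdvice := by
    refine ((A.polyAdvice.add hT).add ((hn.add ((PolyBounded.const 4).mul PolyBounded.id)).add
      (PolyBounded.const 5))).mono fun κ => ?_
    have h1 := size_ofNat_le (4 * κ)
    have h2 := size_ofNat_le (n κ)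
    simp only [reduceAdvice, Val.size]
    omega
  polyTime := by
    obtain ⟨a, ha, hamono, hale⟩ := A.polyAdvice.exists_monotone
    obtain ⟨b, hb, hbmono, hble⟩ := hT.exists_monotone
    obtain ⟨q, hq, hqmono, hqle⟩ := (((PolyBounded.const 4).mul PolyBounded.id).add
      (hn.add hs)).exists_monotone
    -- The time bound must hold for every v, not only for a key with a ciphertext. This works since
    -- all loop counts of the assembly are read from the advice.
    let I : ℕ → Set Val := fun m => {u | ∃ κ v, κ + v.size ≤ m ∧
      u = .pair (.ofNat κ) (.pair (reduceAdvice (n κ) κ (A.advice κ) (T κ)) v)}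
    have hI : SizeBdd I := by
      refine ⟨fun m => 10 + a m + b m + q m + 3 * m, ((((PolyBounded.const 10).add ha).add hb).add
        hq).add ((PolyBounded.const 3).mul PolyBounded.id), ?_⟩
      rintro m _ ⟨κ, v, hm, rfl⟩
      have h1 := size_ofNat_le (4 * κ)
      have h2 := size_ofNat_le (n κ)
      have h3 := size_ofNat_le κ
      have hκ : κ ≤ m := by omega
      have h4 := (hale κ).trans (hamono hκ)
      have h5 := (hble κ).trans (hbmono hκ)
      have h6 := (hqle κ).trans (hqmono hκ)
      simp only [reduceAdvice, Val.size]
      omega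
    have hlf : ∀ f : Prog, f.LoopFree → PolyOn f I := fun f hf => .of_loopFree hf hI
    have harr : PolyOn (.pair (.comp .snd (.comp .fst (.comp .snd .fst)))
        (.pair (.comp .snd (.comp .snd .snd)) (.pair (.comp .snd (.comp .snd .fst))
          (.comp .snd (.comp .fst (.comp .snd .snd)))))) I := hlf _ (by simp [Prog.LoopFree])
    obtain ⟨B, hB, hIB⟩ := harr.sizeBdd_out
    have hasm := harr.comp (J := fun m => {w | w.size ≤ B m ∧ (w.snd.snd.snd.fst.toInt.toNat ≤ q m ∧
      w.snd.snd.snd.snd.toInt.toNat ≤ q m) ∧ w.fst.snd.fst.toInt.toNat ≤ q m}) (g := .assembleP) ?_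
      (polyOn_assembleP hq ⟨B, hB, fun m v hv => hv.1⟩ (fun m v hv => hv.2.1) fun m v hv => hv.2.2)
    · have hin := PolyOn.pair hI (hlf .fst trivial) (.pair hI
        (hlf (.comp .snd (.comp .fst .fst)) (by simp [Prog.LoopFree])) hasm)
      obtain ⟨C, hC, hIC⟩ := hin.sizeBdd_out
      obtain ⟨p, hp⟩ := A.polyTime
      have hA : PolyOn A.prog fun m => {u | ∃ κ v, κ ≤ m ∧ v.size ≤ C m ∧
          u = .pair (.ofNat κ) (.pair (A.advice κ) v)} := by
        refine ⟨_, PolyBounded.eval_comp p (PolyBounded.id.add hC), ?_⟩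
        rintro m _ ⟨κ, v, hκ, hv, rfl⟩ o ho
        exact (hp κ v o ho).trans (PolyBounded.eval_mono p (add_le_add hκ hv))
      obtain ⟨T', ⟨t, ht⟩, hT'⟩ : PolyOn A.prog.reduce I := by
        refine hin.comp (fun m v hv w hw => ?_) hA
        have hsz := hIC m w ⟨v, hv, hw⟩
        obtain ⟨x, hx, y, hy, rfl⟩ := mem_support_out_pair hw
        obtain ⟨z, hz, u, hu, rfl⟩ := mem_support_out_pair hy
        obtain ⟨κ, v, hm, rfl⟩ := hv
        rw [Prog.out_fst, PMF.mem_support_pure_iff] at hx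
        rw [out_comp_snd, out_comp_fst, Prog.out_fst, PMF.mem_support_pure_iff] at hz
        subst hx hz
        simp only [Val.size] at hsz
        exact ⟨κ, u, by omega, by omega, rfl⟩
      exact ⟨t, fun κ v o ho => (hT' _ _ ⟨κ, v, le_rfl, rfl⟩ o ho).trans (ht _)⟩
    · intro m v hv w hw
      refine ⟨hIB m w ⟨v, hv, hw⟩, ?_⟩
      obtain ⟨κ, v, hm, rfl⟩ := hv
      have h6 := (hqle κ).trans (hqmono (show κ ≤ m by omega))
      obtain ⟨x, hx, y, hy, rfl⟩ := mem_support_out_pair hw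
      obtain ⟨-, -, z, hz, rfl⟩ := mem_support_out_pair hy
      obtain ⟨-, -, u, hu, rfl⟩ := mem_support_out_pair hz
      simp only [out_comp_fst, out_comp_snd, Prog.out_fst, Prog.out_snd,
        PMF.mem_support_pure_iff] at hx hu
      subst hx hu
      simp only [reduceAdvice, Val.fst, Val.snd, Val.ofNat, Val.toInt, Int.toNat_natCast]
      have : (T κ).snd.fst.toInt.toNat ≤ q m := by omega
      exact ⟨⟨by omega, by omega⟩, this⟩

/-! ### The hybrid argument for the first server -/

section Hybrid

variable {P : Params} {κ : ℕ}

/-- The plaintexts in the hybrids: zero in the slots in `S`. -/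
def hybridMsg (x y : Fin P.s → ℤ) (l : Fin P.s → S1Lits P κ) (S : Finset (Slot P)) (j : Slot P) : ℤ :=
  if j ∈ S then 0 else s1Msg x y l j

/-- The template of a hybrid with a challenge in the slot `j`. -/
def hybridTemplate (x y : Fin P.s → ℤ) (c : Finset (Slot P) × Slot P × S1Rand P κ) : Val :=
  template (fun i => slotT (if i = c.2.1 then 1 else 0) (hybridMsg x y c.2.2.1.2.2 c.1 i) (c.2.2.2 i))
    c.2.2

theorem size_slotT_le {flag m : ℤ} {r a b : ℕ} (hf : flag.natAbs ≤ 1) (hm : m.natAbs < 2 ^ a)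
    (hr : r < 2 ^ b) : (slotT flag m r).size ≤ 6 + a + b := by
  have h1 := Nat.size_le.2 hm
  have h2 := Nat.size_le.2 hr
  have h3 : flag.natAbs.size ≤ 1 := Nat.size_le.2 (by omega)
  simp only [slotT, Val.ofNat, Val.size, Int.natAbs_natCast]
  omega

theorem natAbs_s1Msg_lt (hP : P.Valid κ) {x y : Fin P.s → ℤ} (hx : Admissible P x)
    (hy : Admissible P y) (l : Fin P.s → S1Lits P κ) (j : Slot P) :
    (s1Msg x y l j).natAbs < 2 ^ (2 * P.σ + 2) := by
  obtain ⟨i, a⟩ := j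
  have hpow : (2 : ℕ) ^ (P.σ + 1) ≤ 2 ^ (2 * P.σ + 2) := Nat.pow_le_pow_right (by norm_num) (by omega)
  have hx0 := hP.natAbs_add_lt hx i 0
  have hy0 := hP.natAbs_add_lt hy i 0
  rw [Fin.val_zero, Nat.cast_zero, add_zero] at hx0 hy0
  fin_cases a
  · exact hx0.trans_le hpow
  · exact hy0.trans_le hpow
  · have h : (s1Msg x y l (i, 2)).natAbs < 2 ^ (P.σ + 1) * 2 ^ (P.σ + 1) := by
      rw [s1Msg]
      simp only [Matrix.cons_val]
      rw [Int.natAbs_mul]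
      exact Nat.mul_lt_mul'' (hP.natAbs_add_lt hx i (l i).1) (hP.natAbs_add_lt hy i (l i).2.1)
    rwa [← pow_add, show P.σ + 1 + (P.σ + 1) = 2 * P.σ + 2 by ring] at h

theorem natAbs_hybridMsg_lt (hP : P.Valid κ) {x y : Fin P.s → ℤ} (hx : Admissible P x)
    (hy : Admissible P y) (l : Fin P.s → S1Lits P κ) (S : Finset (Slot P)) (j : Slot P) :
    (hybridMsg x y l S j).natAbs < 2 ^ (2 * P.σ + 2) := by
  rw [hybridMsg]
  split_ifs
  · simp
  · exact natAbs_s1Msg_lt hP hx hy l j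

theorem size_ofNat_fin_le {a : ℕ} (r : Fin (2 ^ a)) : (Val.ofNat r).size ≤ 1 + a := by
  have := Nat.size_le.2 r.isLt
  simp only [Val.ofNat, Val.size, Int.natAbs_natCast]
  omega

theorem size_hybridTemplate_le (hP : P.Valid κ) {x y : Fin P.s → ℤ} (hx : Admissible P x)
    (hy : Admissible P y) (c : Finset (Slot P) × Slot P × S1Rand P κ) :
    (hybridTemplate x y c).size ≤ 20 + P.s + P.σ + 4 * κ + P.s * (50 + 10 * P.σ + 40 * κ) := by
  have hslot : ∀ i, (slotT (if i = c.2.1 then 1 else 0) (hybridMsg x y c.2.2.1.2.2 c.1 i)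
      (c.2.2.2 i)).size ≤ 6 + (2 * P.σ + 2) + 4 * κ := fun i =>
    size_slotT_le (by split_ifs <;> simp) (natAbs_hybridMsg_lt hP hx hy _ _ _) (c.2.2.2 i).isLt
  have hl := Val.size_ofList_le (l := entriesT (fun i => slotT (if i = c.2.1 then 1 else 0)
    (hybridMsg x y c.2.2.1.2.2 c.1 i) (c.2.2.2 i)) c.2.2.1.2.2) (b := 49 + 10 * P.σ + 40 * κ) ?_
  · have h1 := size_ofNat_fin_le c.2.2.1.1
    have h2 := size_ofNat_fin_le c.2.2.1.2.1
    have h3 := size_ofNat_le P.s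
    have h4 : (entriesT (fun i => slotT (if i = c.2.1 then 1 else 0)
      (hybridMsg x y c.2.2.1.2.2 c.1 i) (c.2.2.2 i)) c.2.2.1.2.2).length = P.s := List.length_ofFn
    rw [h4, show 49 + 10 * P.σ + 40 * κ + 1 = 50 + 10 * P.σ + 40 * κ by ring] at hl
    simp only [hybridTemplate, template, Val.size]
    omega
  · intro e he
    obtain ⟨i, rfl⟩ := (List.mem_ofFn' _ _).1 he
    have h0 := hslot (i.rev, 0)
    have h1 := hslot (i.rev, 1)
    have h2 := hslot (i.rev, 2)
    have h3 := size_ofNat_fin_le (c.2.2.1.2.2 i.rev).1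
    have h4 := size_ofNat_fin_le (c.2.2.1.2.2 i.rev).2.1
    have h5 := size_ofNat_fin_le (c.2.2.1.2.2 i.rev).2.2.1
    have h6 := size_ofNat_fin_le (c.2.2.1.2.2 i.rev).2.2.2.1
    have h7 := size_ofNat_fin_le (c.2.2.1.2.2 i.rev).2.2.2.2.1
    have h8 := size_ofNat_fin_le (c.2.2.1.2.2 i.rev).2.2.2.2.2
    simp only [entryT, Val.size]
    omega

/-- A fresh ciphertext in the slot of the challenge. -/
theorem accept_challenge (h : ∃ t : Factors, t.Accepted P.n κ) (f : Prog) (adv : Val)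
    (x y : Fin P.s → ℤ) (S : Finset (Slot P)) (j : Slot P) (ω : S1Rand P κ) (m : Slot P → ℤ)
    (hm : ∀ i, i ≠ j → m i = hybridMsg x y ω.1.2.2 S i) :
    accept (f.test κ adv) ((PMF.uniformOfFintype (EncCoin κ)).bind fun r =>
      (pkGen P κ).map fun pk => s1View pk m (ω.1, Function.update ω.2 j r)) =
    accept (f.reduce.test κ (reduceAdvice P.n κ adv (hybridTemplate x y (S, j, ω))))
      (encEnsemble P κ (m j)) := by
  rw [accept, accept, encEnsemble_eq]
  simp only [PMF.bind_bind, PMF.bind_map]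
  -- Key and challenge coin are independent, so the key may be drawn first, as in `encEnsemble`.
  rw [PMF.bind_comm]
  congr 2
  refine bind_congr_support fun pk hpk => ?_
  congr 1
  funext r
  obtain ⟨t, ht, hN⟩ := exists_accepted_of_mem_support h hpk
  have : NeZero pk.N := ⟨by rw [hN]; exact (zero_lt_one.trans ht.one_lt_N).ne'⟩
  have hNn : pk.N < 2 ^ P.n := by rw [hN]; exact Nat.size_le.1 ht.size_N_le
  simp only [Function.comp_apply]
  rw [hybridTemplate, test_reduce]
  congr 1
  refine (assembleV_entriesT P.n pk _ _ m (ω.1, Function.update ω.2 j r) fun i => ?_).symm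
  by_cases hi : i = j
  · subst hi
    simp only [if_true, slotV_of_flag_eq_one, Function.update_self]
  · simp only [if_neg hi, slotV_of_flag_eq_zero pk hNn, Function.update_of_ne hi, hm i hi]

/-- Zeroing one slot j changes only the plaintext of the ciphertext there. With all other coins
fixed, this is a distinguishing experiment for `Prog.reduce`. The bound ε is uniform over S, j and ω
because a worst triple can later serve as advice. -/
theorem abs_accept_hybrid_le (h : ∃ t : Factors, t.Accepted P.n κ) (f : Prog) (adv : Val)
    (x y : Fin P.s → ℤ) {ε : ℝ}
    (hε : ∀ S j (ω : S1Rand P κ), |accept (f.reduce.test κ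
        (reduceAdvice P.n κ adv (hybridTemplate x y (S, j, ω))))
          (encEnsemble P κ (hybridMsg x y ω.1.2.2 S j)) -
      accept (f.reduce.test κ (reduceAdvice P.n κ adv (hybridTemplate x y (S, j, ω))))
          (encEnsemble P κ 0)| ≤ ε) :
    |accept (f.test κ adv) ((pkGen P κ).bind fun pk => (PMF.uniformOfFintype (S1Rand P κ)).map
        fun ω => s1View pk (s1Msg x y ω.1.2.2) ω) -
      accept (f.test κ adv) ((pkGen P κ).bind fun pk => (PMF.uniformOfFintype (S1Rand P κ)).map
        fun ω => s1View pk 0 ω)| ≤ (3 * P.s : ℕ) * ε := by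
  have hyb := abs_sub_le_sum_of_insert (fun S : Finset (Slot P) => accept (f.test κ adv)
    ((pkGen P κ).bind fun pk => (PMF.uniformOfFintype (S1Rand P κ)).map
      fun ω => s1View pk (hybridMsg x y ω.1.2.2 S) ω)) (fun _ => ε) ?_
  · have h0 : ∀ l : Fin P.s → S1Lits P κ, hybridMsg x y l ∅ = s1Msg x y l := fun l => by
      funext j; simp [hybridMsg]
    have h1 : ∀ l : Fin P.s → S1Lits P κ, hybridMsg x y l Finset.univ = 0 := fun l => by
      funext j; simp [hybridMsg]
    simp only [h0, h1] at hyb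
    refine hyb.trans_eq ?_
    simp [mul_comm]
  · intro S j hj
    -- The coin of slot j and the key are moved innermost; the remaining randomness is averaged
    -- over.
    have key : ∀ S' : Finset (Slot P), ((pkGen P κ).bind fun pk =>
        (PMF.uniformOfFintype (S1Rand P κ)).map fun ω => s1View pk (hybridMsg x y ω.1.2.2 S') ω) =
        (PMF.uniformOfFintype (Fin (2 ^ P.σ) × EncCoin κ × (Fin P.s → S1Lits P κ))).bind fun a =>
          (PMF.uniformOfFintype (Slot P → EncCoin κ)).bind fun ρ =>
            (PMF.uniformOfFintype (EncCoin κ)).bind fun r => (pkGen P κ).map fun pk =>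
              s1View pk (hybridMsg x y a.2.2 S') (a, Function.update ρ j r) := by
      intro S'
      have hre : ∀ a : Fin (2 ^ P.σ) × EncCoin κ × (Fin P.s → S1Lits P κ), _ = _ := fun a =>
        uniform_resample j fun ρ => (pkGen P κ).map fun pk =>
          s1View pk (hybridMsg x y a.2.2 S') (a, ρ)
      simp only [hre]
      rw [uniform_bind_bind fun (a : Fin (2 ^ P.σ) × EncCoin κ × (Fin P.s → S1Lits P κ))
        (ρ : Slot P → EncCoin κ) => (pkGen P κ).map fun pk =>
              s1View pk (hybridMsg x y a.2.2 S') (a, ρ)]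
      simp only [← PMF.bind_pure_comp]
      exact PMF.bind_comm _ _ _
    rw [key, key]
    refine abs_accept_bind_sub_le _ fun a _ => abs_accept_bind_sub_le _ fun ρ _ => ?_
    -- The two hybrids agree outside j, so the same template, hence the same advice, serves both.
    rw [accept_challenge h f adv x y S j (a, ρ) (hybridMsg x y a.2.2 S) fun _ _ => rfl,
      accept_challenge h f adv x y S j (a, ρ) (hybridMsg x y a.2.2 (insert j S)) fun i hi => by
        simp [hybridMsg, hi]]
    have hzero : hybridMsg x y a.2.2 (insert j S) j = 0 := by simp [hybridMsg]
    rw [hzero]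
    exact hε S j (a, ρ)

end Hybrid

theorem Negligible.of_eventually_le {f g : ℕ → ℝ} {q : ℕ → ℕ} (hg : Negligible g)
    (hq : PolyBounded q) (hg0 : ∀ᶠ κ in Filter.atTop, 0 ≤ g κ)
    (h : ∀ᶠ κ in Filter.atTop, |f κ| ≤ q κ * g κ) : Negligible f := by
  obtain ⟨p, hp⟩ := hq
  refine (Asymptotics.SuperpolynomialDecay.polynomial_mul hg
    (p.map (Nat.castRingHom ℝ))).trans_eventually_abs_le ?_
  filter_upwards [hg0, h] with κ h0 h1
  have hpe : (p.map (Nat.castRingHom ℝ)).eval (κ : ℝ) = ((p.eval κ : ℕ) : ℝ) := by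
    rw [Polynomial.eval_natCast_map]; rfl
  simp only [Function.comp_apply, hpe]
  rw [abs_of_nonneg (mul_nonneg (Nat.cast_nonneg _) h0)]
  exact h1.trans (mul_le_mul_of_nonneg_right (by exact_mod_cast hp κ) h0)

theorem privateAgainst_S1 {par : ℕ → Params} (hn : PolyBounded fun κ => (par κ).n)
    (hσ : PolyBounded fun κ => (par κ).σ) (hs : PolyBounded fun κ => (par κ).s)
    (hP : ∀ κ, (par κ).Valid κ)
    (hgen : ∀ᶠ κ in Filter.atTop, ∃ t : Factors, t.Accepted (par κ).n κ)
    (hsec : SemanticallySecure par) : PrivateAgainst .S1 par := by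
  refine ⟨Prog.sim₁, polyTimeOn_of_polyOn _ (polyOn_sim₁ hn hσ hs), fun x y hx hy A => ?_⟩
  have hne : ∀ κ, Nonempty (Fin (par κ).s) := fun κ => ⟨⟨0, (hP κ).one_le_s⟩⟩
  -- For each κ there are finitely many triples, so one maximises the advantage of the reduction.
  have hbest : ∀ κ, ∃ c : Finset (Slot (par κ)) × Slot (par κ) × S1Rand (par κ) κ, ∀ c',
      _ ≤ _ := fun κ => Finite.exists_max
    fun c : Finset (Slot (par κ)) × Slot (par κ) × S1Rand (par κ) κ =>
      |accept (A.prog.reduce.test κ (reduceAdvice (par κ).n κ (A.advice κ)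
          (hybridTemplate (x κ) (y κ) c)))
          (encEnsemble (par κ) κ (hybridMsg (x κ) (y κ) c.2.2.1.2.2 c.1 c.2.1)) -
        accept (A.prog.reduce.test κ (reduceAdvice (par κ).n κ (A.advice κ)
          (hybridTemplate (x κ) (y κ) c))) (encEnsemble (par κ) κ 0)|
  choose c hc using hbest
  let T : ℕ → Val := fun κ => hybridTemplate (x κ) (y κ) (c κ)
  have hT : PolyBounded fun κ => (T κ).size := by
    refine ((((PolyBounded.const 20).add hs).add hσ).add ((PolyBounded.const 4).mul
      PolyBounded.id)).add (hs.mul (((PolyBounded.const 50).add ((PolyBounded.const 10).mul hσ)).add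
      ((PolyBounded.const 40).mul PolyBounded.id))) |>.mono fun κ => ?_
    exact size_hybridTemplate_le (hP κ) (hx κ) (hy κ) (c κ)
  let R := A.reduce (fun κ => (par κ).n) T hn hT hs
  let M : ℕ → ℤ := fun κ => hybridMsg (x κ) (y κ) (c κ).2.2.1.2.2 (c κ).1 (c κ).2.1
  classical
  -- The case distinction supplies messages of at most n bits for all κ; that `M κ` is short enough
  -- is known only when an accepted tuple exists.
  have hR := hsec (fun κ => if (M κ).natAbs < 2 ^ (par κ).n then M κ else 0) 0
    (fun κ => by split_ifs with h; exacts [h, by simp]) (fun κ => by simp) R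
  refine hR.of_eventually_le ((PolyBounded.const 3).mul hs) (.of_forall fun κ => abs_nonneg _) ?_
  filter_upwards [hgen] with κ hκ
  have hM : (M κ).natAbs < 2 ^ (par κ).n := by
    obtain ⟨t, ht⟩ := hκ
    refine (natAbs_hybridMsg_lt (hP κ) (hx κ) (hy κ) _ _ _).trans_le
      (Nat.pow_le_pow_right (by norm_num) ?_)
    have := (hP κ).size_L
    have := ((hP κ).size_N ht).1
    have := ht.size_N_le
    omega
  rw [abs_abs, if_pos hM, Adversary.prob_eq, Adversary.prob_eq, Adversary.prob_eq,
    Adversary.prob_eq, realView_S1 (hP κ) hκ (hx κ) (hy κ), simView_sim₁ hκ]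
  exact abs_accept_hybrid_le hκ A.prog (A.advice κ) (x κ) (y κ) fun S j ω => hc κ (S, j, ω)

/-! ### The simulator for the second server -/

/-- One step of the evaluation of `packedSum`. -/
def hornerZ (L a X Y : ℤ) : ℤ := (a * L + X) * L + Y

/-- A round adds a bounded number of bits to a, so the packed numbers stay of polynomial size. -/
theorem size_hornerZ_le (L a X Y : ℤ) : (hornerZ L a X Y).natAbs.size ≤
    a.natAbs.size + 2 * L.natAbs.size + X.natAbs.size + Y.natAbs.size + 4 := by
  have h1 := Arith.mul.size_eval_le a L
  have h2 := Arith.add.size_eval_le (a * L) X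
  have h3 := Arith.mul.size_eval_le (a * L + X) L
  have h4 := Arith.add.size_eval_le ((a * L + X) * L) Y
  simp only [Arith.eval] at h1 h2 h3 h4
  rw [hornerZ]
  omega

/-- The Horner scheme treats the pair of highest index first. -/
theorem packedSum_snoc (L k : ℕ) (X Y : Fin (k + 1) → ℤ) (a : ℤ) :
    hornerZ L a (X (Fin.last k)) (Y (Fin.last k)) * (L : ℤ) ^ (2 * k) +
      packedSum L (fun i => X (Fin.castSucc i)) (fun i => Y (Fin.castSucc i)) =
    a * (L : ℤ) ^ (2 * (k + 1)) + packedSum L X Y := by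
  simp only [packedSum, Fin.sum_univ_castSucc, Fin.val_castSucc, Fin.val_last, hornerZ]
  ring

namespace Prog

/-- The randomness of the ciphertexts and the blinding factors for one pair of plaintexts, drawn
from the context `(L, (δ, (r, (σ, k))))`. -/
def drawS : Prog :=
  pair (pair (uniP (comp snd (comp snd (comp snd fst)))) (uniP (comp snd (comp snd (comp snd fst)))))
    (pair (pair (uniP (comp snd (comp snd (comp snd snd)))) (uniP (comp snd (comp snd (comp snd snd)))))
      (pair (uniP (comp snd (comp snd (comp snd snd)))) (uniP (comp snd (comp snd (comp snd snd))))))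

/-- `hornerZ` for the `L` in the context. -/
def hornerP (a X Y : Prog) : Prog :=
  op .add (op .mul (op .add (op .mul a (comp fst (comp fst fst))) X) (comp fst (comp fst fst))) Y

/-- Update the plaintext and the randomness of the packed ciphertext. -/
def packStep : Prog :=
  comp (pair id (comp fst drawS)) <| pair (comp fst fst) <| pair
    (hornerP (comp fst (comp snd fst))
      (op .add (comp fst (comp fst (comp snd fst))) (comp snd (comp fst fst)))
      (op .add (comp fst (comp fst (comp snd fst))) (comp snd (comp fst snd))))
    (hornerP (comp fst (comp snd snd))
      (op .add (op .add (comp snd (comp snd (comp fst fst)))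
        (comp fst (comp fst (comp snd (comp snd fst))))) (comp snd (comp snd (comp fst snd))))
      (op .add (op .add (comp snd (comp snd (comp snd fst)))
        (comp fst (comp fst (comp snd (comp snd fst))))) (comp snd (comp snd (comp snd snd)))))

/-- The plaintext and the randomness of the packed ciphertext for zero inputs. -/
def packP : Prog :=
  comp (comp (comp (pair id (uniP coinBits)) (pair (comp fst (item 5)) (pair
    (pair (comp fst (item 3)) (pair (comp fst (item 4)) (pair snd
      (pair (comp fst (item 2)) (comp fst coinBits)))))
    (pair (const 0) (const 0))))) (loop packStep)) snd

/-- The simulator for the second server. -/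
def sim₂ : Prog :=
  comp (comp (pair id (pair packP (mapP (item 5) (const 0) coinBits (uniP snd))))
    (pair id (encP (comp fst (comp (item 6) fst)) (comp fst (comp (item 6) snd))
      (comp snd (comp fst fst)) (comp snd (comp fst snd))
      (comp fst (op .add (op .add coinBits (item 0)) (const 3))) (comp fst (item 0)))))
    (pair (comp fst (comp fst (item 6))) <| pair (comp fst (comp fst (item 7))) <|
      pair (comp fst (comp snd snd)) <| pair snd <| pair
        (powP snd (comp fst (comp fst (op .mod (op .sub (const 1) (item 7)) (comp (item 6) snd))))
          (comp fst (comp fst (op .mul (comp (item 6) snd) (comp (item 6) snd))))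
          (comp fst (comp fst (item 2)))) (const 0))

end Prog

/-- The randomness that is drawn by `drawS`. -/
abbrev S2Draw (P : Params) (κ : ℕ) : Type :=
  (Fin (2 ^ P.σ) × Fin (2 ^ P.σ)) × (EncCoin κ × EncCoin κ) × (EncCoin κ × EncCoin κ)

/-- The result of `drawS`. -/
def drawV {P : Params} {κ : ℕ} (d : S2Draw P κ) : Val :=
  .pair (.pair (.ofNat d.1.1) (.ofNat d.1.2)) (.pair (.pair (.ofNat d.2.1.1) (.ofNat d.2.1.2))
    (.pair (.ofNat d.2.2.1) (.ofNat d.2.2.2)))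

/-- The context of the loop of `packP`. -/
def packCtx (P : Params) (κ : ℕ) (r : ℕ) : Val :=
  .pair (.ofNat P.L) (.pair (.ofNat P.δ) (.pair (.ofNat r) (.pair (.ofNat P.σ) (.ofNat (4 * κ)))))

theorem out_drawS (P : Params) (κ r : ℕ) : Prog.drawS.out (packCtx P κ r) =
    (PMF.uniformOfFintype (S2Draw P κ)).map drawV := by
  have h1 := out_uniP (k := .comp .snd (.comp .snd (.comp .snd .fst))) (v := packCtx P κ r)
    (out_comp_snd.trans (out_comp_snd.trans (out_comp_snd.trans (Prog.out_fst _))))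
  have h2 := out_uniP (k := .comp .snd (.comp .snd (.comp .snd .snd))) (v := packCtx P κ r)
    (out_comp_snd.trans (out_comp_snd.trans (out_comp_snd.trans (Prog.out_snd _))))
  exact out_pair_uniform (out_pair_uniform h1 h1) (out_pair_uniform (out_pair_uniform h2 h2)
    (out_pair_uniform h2 h2))

theorem out_hornerP {a X Y : Prog} {v va vX vY : Val} (ha : a.out v = PMF.pure va)
    (hX : X.out v = PMF.pure vX) (hY : Y.out v = PMF.pure vY) :
    (Prog.hornerP a X Y).out v =
      PMF.pure (.num (hornerZ v.fst.fst.fst.toInt va.toInt vX.toInt vY.toInt)) := by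
  have hL : (Prog.comp .fst (.comp .fst .fst)).out v = PMF.pure v.fst.fst.fst := by
    rw [out_comp_fst, out_comp_fst, Prog.out_fst]
  exact Prog.out_op (Prog.out_op (Prog.out_op (Prog.out_op ha hL) hX) hL) hY

theorem out_packStep (ctx : Val) (a b : ℤ) :
    Prog.packStep.out (.pair ctx (.pair (.num a) (.num b))) =
      (Prog.drawS.out ctx).map fun d => .pair ctx (.pair
        (.num (hornerZ ctx.fst.toInt a (ctx.snd.fst.toInt + d.fst.fst.toInt)
          (ctx.snd.fst.toInt + d.fst.snd.toInt)))
        (.num (hornerZ ctx.fst.toInt b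
          (d.snd.fst.fst.toInt + ctx.snd.snd.fst.toInt + d.snd.fst.snd.toInt)
          (d.snd.snd.fst.toInt + ctx.snd.snd.fst.toInt + d.snd.snd.snd.toInt)))) := by
  rw [Prog.packStep, Prog.out_comp, Prog.out_pair, Prog.out_id, PMF.pure_bind, out_comp_fst,
    PMF.bind_map, ← PMF.bind_pure_comp, Val.fst]
  congr 1
  funext d
  rw [Function.comp_apply, Function.comp_apply]
  have hδ : (Prog.comp .fst (.comp .fst (.comp .snd .fst))).out
      (.pair (.pair ctx (.pair (.num a) (.num b))) d) = PMF.pure ctx.snd.fst := by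
    simp only [out_comp_fst, out_comp_snd, Prog.out_fst, Val.fst]
  have hr : (Prog.comp .fst (.comp .fst (.comp .snd (.comp .snd .fst)))).out
      (.pair (.pair ctx (.pair (.num a) (.num b))) d) = PMF.pure ctx.snd.snd.fst := by
    simp only [out_comp_fst, out_comp_snd, Prog.out_fst, Val.fst]
  refine Prog.out_pair_pure (out_comp_fst.trans (Prog.out_fst _)) (Prog.out_pair_pure
    (out_hornerP (va := .num a) ?_ (Prog.out_op hδ ?_) (Prog.out_op hδ ?_))
    (out_hornerP (va := .num b) ?_ (Prog.out_op (Prog.out_op ?_ hr) ?_)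
      (Prog.out_op (Prog.out_op ?_ hr) ?_))) <;>
  simp only [out_comp_fst, out_comp_snd, Prog.out_fst, Prog.out_snd, Val.fst, Val.snd]

/-- The plaintext of the packed ciphertext for zero inputs. -/
def drawMsg {P : Params} {κ s : ℕ} (f : Fin s → S2Draw P κ) : ℤ :=
  packedSum P.L (fun i => (P.δ : ℤ) + ((f i).1.1 : ℕ)) (fun i => (P.δ : ℤ) + ((f i).1.2 : ℕ))

/-- The randomness of the packed ciphertext. -/
def drawCoin {P : Params} {κ s : ℕ} (r : ℕ) (f : Fin s → S2Draw P κ) : ℤ :=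
  packedSum P.L (fun i => (((f i).2.1.1 : ℕ) : ℤ) + r + ((f i).2.1.2 : ℕ))
    (fun i => (((f i).2.2.1 : ℕ) : ℤ) + r + ((f i).2.2.2 : ℕ))

/-- The first draw is the pair of highest index, as the Horner scheme demands, whence
`uniform_snoc`; the coin r of ⟦δ⟧ sits in the context because all pairs share it. -/
theorem iterOut_packStep (P : Params) (κ r s : ℕ) (a b : ℤ) :
    iterOut Prog.packStep.out s (.pair (packCtx P κ r) (.pair (.num a) (.num b))) =
      (PMF.uniformOfFintype (Fin s → S2Draw P κ)).map fun f =>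
        .pair (packCtx P κ r) (.pair (.num (a * (P.L : ℤ) ^ (2 * s) + drawMsg f))
          (.num (b * (P.L : ℤ) ^ (2 * s) + drawCoin r f))) := by
  induction s generalizing a b with
  | zero =>
    simp only [iterOut, drawMsg, drawCoin, packedSum, Finset.univ_eq_empty, Finset.sum_empty,
      mul_zero, pow_zero, mul_one, add_zero]
    exact (PMF.map_const _ _).symm
  | succ s ih =>
    rw [iterOut, out_packStep, out_drawS, PMF.map_comp, PMF.bind_map, ← uniform_snoc, PMF.map_bind]
    congr 1
    funext d
    rw [PMF.map_comp]
    refine (ih _ _).trans ?_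
    congr 1
    funext f
    have h1 := packedSum_snoc P.L s
      (fun i => (P.δ : ℤ) + (((Fin.snoc f d : Fin (s + 1) → S2Draw P κ) i).1.1 : ℕ))
      (fun i => (P.δ : ℤ) + (((Fin.snoc f d : Fin (s + 1) → S2Draw P κ) i).1.2 : ℕ)) a
    have h2 := packedSum_snoc P.L s
      (fun i => ((((Fin.snoc f d : Fin (s + 1) → S2Draw P κ) i).2.1.1 : ℕ) : ℤ) + r +
        (((Fin.snoc f d : Fin (s + 1) → S2Draw P κ) i).2.1.2 : ℕ))
      (fun i => ((((Fin.snoc f d : Fin (s + 1) → S2Draw P κ) i).2.2.1 : ℕ) : ℤ) + r +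
        (((Fin.snoc f d : Fin (s + 1) → S2Draw P κ) i).2.2.2 : ℕ)) b
    simp only [Fin.snoc_last, Fin.snoc_castSucc] at h1 h2
    rw [Function.comp_apply, drawMsg, drawCoin, drawMsg, drawCoin, ← h1, ← h2]
    rfl

theorem out_packP (P : Params) (κ : ℕ) (pk sk : Val) :
    Prog.packP.out (simIn P κ pk sk) =
      (PMF.uniformOfFintype (EncCoin κ × (Fin P.s → S2Draw P κ))).map fun w =>
        .pair (.num (drawMsg w.2)) (.num (drawCoin w.1 w.2)) := by
  have hi : ∀ j, (Prog.item j).out (simIn P κ pk sk) = _ := fun j => Prog.out_item j _ _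
  have hc : Prog.coinBits.out (simIn P κ pk sk) = _ := Prog.out_coinBits κ _
  have hin : ∀ r : ℕ, (Prog.pair (.comp .fst (.item 5)) (.pair (.pair (.comp .fst (.item 3))
      (.pair (.comp .fst (.item 4)) (.pair .snd (.pair (.comp .fst (.item 2)) (.comp .fst .coinBits)))))
      (.pair (.const 0) (.const 0)))).out (.pair (simIn P κ pk sk) (.ofNat r)) =
      PMF.pure (.pair (.ofNat P.s) (.pair (packCtx P κ r) (.pair (.num 0) (.num 0)))) := fun r =>
    Prog.out_pair_pure (out_comp_fst.trans (hi 5)) (Prog.out_pair_pure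
      (Prog.out_pair_pure (out_comp_fst.trans (hi 3)) (Prog.out_pair_pure
        (out_comp_fst.trans (hi 4)) (Prog.out_pair_pure (Prog.out_snd _) (Prog.out_pair_pure
          (out_comp_fst.trans (hi 2)) (out_comp_fst.trans hc)))))
      (Prog.out_pair_pure (Prog.out_const _ _) (Prog.out_const _ _)))
  rw [Prog.packP, Prog.out_comp, Prog.out_comp, Prog.out_comp,
    out_pair_pure_uniform (Prog.out_id _) (out_uniP hc), PMF.bind_map, PMF.bind_bind, PMF.bind_bind,
    ← uniform_bind_map fun (r : EncCoin κ) (f : Fin P.s → S2Draw P κ) =>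
      Val.pair (.num (drawMsg f)) (.num (drawCoin r f))]
  congr 1
  funext r
  simp only [Function.comp_apply]
  rw [hin, PMF.pure_bind, Prog.out_loop]
  simp only [Val.fst, Val.snd, Val.ofNat, Val.toInt, Int.toNat_natCast]
  rw [iterOut_packStep, PMF.bind_map, ← PMF.bind_pure_comp]
  congr 1
  funext f
  rw [Function.comp_apply, Prog.out_snd]
  simp [Val.snd]

/-- The result of `sim₂`. -/
def sim₂V {P : Params} {κ : ℕ} (h N : ℕ) (sk : ℤ) (r : EncCoin κ) (f : Fin P.s → S2Draw P κ)
    (c : S2Coins P κ) : Val :=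
  .ofList [.pair (.ofNat h) (.ofNat N), .num sk, .ofList (List.ofFn fun i => .ofNat (c i)),
    .num (encZ h N (drawMsg f) (drawCoin r f) (4 * κ + P.n + 3) P.n),
    .num (powZ (encZ h N (drawMsg f) (drawCoin r f) (4 * κ + P.n + 3) P.n) (modZ (1 - sk) N) (N * N)
      P.σ)]

theorem out_sim₂ (P : Params) (κ h N : ℕ) (sk : ℤ) :
    Prog.sim₂.out (simIn P κ (.pair (.ofNat h) (.ofNat N)) (.num sk)) =
      (PMF.uniformOfFintype ((EncCoin κ × (Fin P.s → S2Draw P κ)) × S2Coins P κ)).map fun w =>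
        sim₂V h N sk w.1.1 w.1.2 w.2 := by
  set v := simIn P κ (.pair (.ofNat h) (.ofNat N)) (.num sk) with hv
  have hi : ∀ j, (Prog.item j).out v = _ := fun j => Prog.out_item j _ _
  have hc : Prog.coinBits.out v = _ := Prog.out_coinBits κ _
  have hm := out_mapP_uniform (α := EncCoin κ) (φ := fun r => .ofNat r) (hi 5)
    (Prog.out_const 0 _) hc (out_uniP (Prog.out_snd _))
  have h1 := out_pair_pure_uniform (Prog.out_id v) (out_pair_uniform
    (out_packP P κ (.pair (.ofNat h) (.ofNat N)) (.num sk)) hm)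
  have hN : (Prog.comp (Prog.item 6) .snd).out v = PMF.pure (.ofNat N) :=
    (Prog.out_comp_pure (hi 6)).trans (Prog.out_snd _)
  have hh : (Prog.comp (Prog.item 6) .fst).out v = PMF.pure (.ofNat h) :=
    (Prog.out_comp_pure (hi 6)).trans (Prog.out_fst _)
  have hkr := Prog.out_op (o := .add) (Prog.out_op (o := .add) hc (hi 0)) (Prog.out_const 3 v)
  refine out_comp_uniform (out_comp_uniform h1 fun w => Prog.out_pair_pure (Prog.out_id _)
    (Prog.out_encP (out_comp_fst.trans hh) (out_comp_fst.trans hN)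
      (out_comp_snd.trans (out_comp_fst.trans (Prog.out_fst _)))
      (out_comp_snd.trans (out_comp_fst.trans (Prog.out_snd _)))
      (out_comp_fst.trans hkr) (out_comp_fst.trans (hi 0)))) fun w => ?_
  have hkr' : ((4 * κ : ℕ) : ℤ) + P.n + 3 = ((4 * κ + P.n + 3 : ℕ) : ℤ) := by push_cast; ring
  refine (Prog.out_pair_pure (out_comp_fst.trans (out_comp_fst.trans (hi 6))) <|
    Prog.out_pair_pure (out_comp_fst.trans (out_comp_fst.trans (hi 7))) <|
    Prog.out_pair_pure (out_comp_fst.trans (out_comp_snd.trans (Prog.out_snd _))) <|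
    Prog.out_pair_pure (Prog.out_snd _) <| Prog.out_pair_pure (out_powP (Prog.out_snd _)
      (out_comp_fst.trans (out_comp_fst.trans (Prog.out_op (Prog.out_op (Prog.out_const _ _) (hi 7)) hN)))
      (out_comp_fst.trans (out_comp_fst.trans (Prog.out_op hN hN)))
      (out_comp_fst.trans (out_comp_fst.trans (hi 2)))) (Prog.out_const _ _)).trans ?_
  simp only [List.getD_cons_succ, List.getD_cons_zero, Val.fst, Val.snd, Val.ofNat, Val.toInt,
    Arith.eval, hkr', Int.toNat_natCast]
  rfl

/-! ### Running time of the simulator for the second server. -/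

theorem polyOn_drawS {I : ℕ → Set Val} {q : ℕ → ℕ} (hI : SizeBdd I) (hq : PolyBounded q)
    (h : ∀ m, ∀ v ∈ I m, v.snd.snd.snd.fst.toInt.toNat ≤ q m ∧ v.snd.snd.snd.snd.toInt.toNat ≤ q m) :
    PolyOn Prog.drawS I := by
  have h1 : PolyOn (.uniP (.comp .snd (.comp .snd (.comp .snd .fst)))) I := polyOn_uniP hI
    (.of_loopFree (by simp [Prog.LoopFree]) hI) hq fun m v hv w hw => by
      rw [out_comp_snd, out_comp_snd, out_comp_snd, Prog.out_fst, PMF.mem_support_pure_iff] at hw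
      exact hw ▸ (h m v hv).1
  have h2 : PolyOn (.uniP (.comp .snd (.comp .snd (.comp .snd .snd)))) I := polyOn_uniP hI
    (.of_loopFree (by simp [Prog.LoopFree]) hI) hq fun m v hv w hw => by
      rw [out_comp_snd, out_comp_snd, out_comp_snd, Prog.out_snd, PMF.mem_support_pure_iff] at hw
      exact hw ▸ (h m v hv).2
  exact .pair hI (.pair hI h1 h1) (.pair hI (.pair hI h2 h2) (.pair hI h2 h2))

theorem size_add_toInt_le (a b : Val) :
    (a.toInt + b.toInt).natAbs.size ≤ a.size + b.size := by
  have := Arith.add.size_eval_le a.toInt b.toInt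
  have := a.size_toInt_le
  have := b.size_toInt_le
  simp only [Arith.eval] at *
  omega

theorem size_add_add_toInt_le (a b c : Val) :
    (a.toInt + b.toInt + c.toInt).natAbs.size ≤ a.size + b.size + c.size := by
  have := Arith.add.size_eval_le (a.toInt + b.toInt) c.toInt
  have := size_add_toInt_le a b
  have := c.size_toInt_le
  simp only [Arith.eval] at *
  omega

theorem polyOn_loop_packStep {I : ℕ → Set Val} {q : ℕ → ℕ} (hq : PolyBounded q) (hI : SizeBdd I)
    (hcount : ∀ m, ∀ v ∈ I m, v.fst.toInt.toNat ≤ q m)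
    (hstate : ∀ m, ∀ v ∈ I m, v.snd.snd = .pair (.num 0) (.num 0) ∧ v.snd.isPair = .num 1)
    (hctx : ∀ m, ∀ v ∈ I m, v.snd.fst.snd.snd.snd.fst.toInt.toNat ≤ q m ∧
      v.snd.fst.snd.snd.snd.snd.toInt.toNat ≤ q m) : PolyOn (.loop Prog.packStep) I := by
  obtain ⟨B, hB, hIB⟩ := hI
  let Ctx : ℕ → Set Val := fun m => {c | c.size ≤ B m ∧ c.snd.snd.snd.fst.toInt.toNat ≤ q m ∧
    c.snd.snd.snd.snd.toInt.toNat ≤ q m}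
  have hdraw : PolyOn Prog.drawS Ctx := polyOn_drawS ⟨B, hB, fun m v hv => hv.1⟩ hq
    fun m v hv => hv.2
  obtain ⟨D, hD, hCD⟩ := hdraw.sizeBdd_out
  -- G bounds the bits that one Horner step adds, from L, the context and the fresh draw; after t
  -- rounds both numbers have at most t · G bits.
  let G : ℕ → ℕ := fun m => 4 + 6 * B m + 6 * D m
  have hG : PolyBounded G := ((PolyBounded.const 4).add ((PolyBounded.const 6).mul hB)).add
    ((PolyBounded.const 6).mul hD)
  let K : ℕ → ℕ → Set Val := fun m t => {u | ∃ c a b, u = .pair c (.pair (.num a) (.num b)) ∧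
    c ∈ Ctx m ∧ a.natAbs.size ≤ t * G m ∧ b.natAbs.size ≤ t * G m}
  have hsize : SizeBdd fun m => {v | ∃ t < q m, v ∈ K m t} := by
    refine ⟨fun m => 4 + B m + 2 * (q m * G m), ((PolyBounded.const 4).add hB).add
      ((PolyBounded.const 2).mul (hq.mul hG)), ?_⟩
    rintro m _ ⟨t, ht, c, a, b, rfl, hc, ha, hb⟩
    have := Nat.mul_le_mul_right (G m) ht.le
    have := hc.1
    simp only [Val.size]
    omega
  refine PolyOn.loop (K := K) hq ⟨B, hB, hIB⟩ (fun m v hv => ⟨hcount m v hv, ?_⟩) ?_ ?_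
  · obtain ⟨h1, h2⟩ := hstate m v hv
    have hp : v.snd = .pair v.snd.fst v.snd.snd := by
      revert h2
      cases v.snd with
      | num z => simp [Val.isPair]
      | pair a b => simp [Val.fst, Val.snd]
    refine ⟨v.snd.fst, 0, 0, by rw [hp, h1]; rfl, ⟨?_, hctx m v hv⟩, by simp, by simp⟩
    exact (Val.size_fst_le _).trans ((Val.size_snd_le _).trans (hIB m v hv))
  · rintro m t _ ⟨c, a, b, rfl, hc, ha, hb⟩ w hw
    rw [out_packStep, PMF.mem_support_map_iff] at hw
    obtain ⟨d, hd, rfl⟩ := hw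
    have hdD : d.size ≤ D m := hCD m d ⟨c, hc, hd⟩
    have hcB := hc.1
    refine ⟨c, _, _, rfl, hc, ?_, ?_⟩
    · refine (size_hornerZ_le _ _ _ _).trans ?_
      have h1 := size_add_toInt_le c.snd.fst d.fst.fst
      have h2 := size_add_toInt_le c.snd.fst d.fst.snd
      have h3 := c.fst.size_toInt_le
      have h4 := c.size_fst_le
      have h5 := c.snd.size_fst_le
      have h6 := c.size_snd_le
      have h7 := d.size_fst_le
      have h8 := d.fst.size_fst_le
      have h9 := d.fst.size_snd_le
      simp only [G, add_mul, one_mul] at ha ⊢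
      omega
    · refine (size_hornerZ_le _ _ _ _).trans ?_
      have h1 := size_add_add_toInt_le d.snd.fst.fst c.snd.snd.fst d.snd.fst.snd
      have h2 := size_add_add_toInt_le d.snd.snd.fst c.snd.snd.fst d.snd.snd.snd
      have h3 := c.fst.size_toInt_le
      have h4 := c.size_fst_le
      have h5 := c.snd.size_snd_le
      have h6 := c.size_snd_le
      have h7 := c.snd.snd.size_fst_le
      have h8 := d.size_snd_le
      have h9 := d.snd.size_fst_le
      have h10 := d.snd.size_snd_le
      have h11 := d.snd.fst.size_fst_le
      have h12 := d.snd.fst.size_snd_le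
      have h13 := d.snd.snd.size_fst_le
      have h14 := d.snd.snd.size_snd_le
      simp only [G, add_mul, one_mul] at hb ⊢
      omega
  · refine PolyOn.comp' (.pair hsize (.of_loopFree trivial hsize) (.comp (J := Ctx)
      (.of_loopFree trivial hsize) ?_ hdraw))
      fun J hJ => .of_loopFree (by simp [Prog.LoopFree, Prog.hornerP, Prog.op]) hJ
    rintro m _ ⟨t, ht, c, a, b, rfl, hc, ha, hb⟩ w hw
    rw [Prog.out_fst, PMF.mem_support_pure_iff] at hw
    exact hw ▸ hc

theorem polyOn_sim₂ {par : ℕ → Params} (hn : PolyBounded fun κ => (par κ).n)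
    (hσ : PolyBounded fun κ => (par κ).σ) (hs : PolyBounded fun κ => (par κ).s) :
    PolyOn Prog.sim₂ (simDom par) := by
  obtain ⟨q, hq, hmono, hle⟩ := ((((PolyBounded.const 4).mul PolyBounded.id).add
    (hn.add (hσ.add hs))).add (PolyBounded.const 3)).exists_monotone
  have hI := sizeBdd_simDom par
  have hlf : ∀ f : Prog, f.LoopFree → PolyOn f (simDom par) := fun f hf => .of_loopFree hf hI
  have hlcb : Prog.coinBits.LoopFree := by simp [Prog.coinBits, Prog.op, Prog.LoopFree]
  have hit : ∀ j, PolyOn (Prog.item j) (simDom par) := fun j => hlf _ (Prog.loopFree_item j)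
  have hbd : ∀ {m κ z : ℕ}, κ ≤ m →
      z ≤ 4 * κ + ((par κ).n + ((par κ).σ + (par κ).s)) + 3 → z ≤ q m := fun hκ hz =>
    hz.trans ((hle _).trans (hmono hκ))
  have hcq : ∀ m, ∀ v ∈ simDom par m, ∀ w ∈ (Prog.coinBits.out v).support, w.toInt.toNat ≤ q m := by
    rintro m _ ⟨κ, pk, sk, rfl, hκ, -⟩ w hw
    rw [simIn, Prog.out_coinBits, PMF.mem_support_pure_iff] at hw
    subst hw
    refine hbd hκ ?_
    simp only [Val.ofNat, Val.toInt, Int.toNat_natCast]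
    omega
  have hiq : ∀ j, j = 0 ∨ j = 2 ∨ j = 5 → ∀ m, ∀ v ∈ simDom par m,
      ∀ w ∈ ((Prog.item j).out v).support, w.toInt.toNat ≤ q m := by
    rintro j hj m _ ⟨κ, pk, sk, rfl, hκ, -⟩ w hw
    rw [simIn, Prog.out_item, PMF.mem_support_pure_iff] at hw
    subst hw
    refine hbd hκ ?_
    rcases hj with rfl | rfl | rfl <;>
    simp only [List.getD_cons_succ, List.getD_cons_zero, Val.ofNat, Val.toInt, Int.toNat_natCast] <;>
    omega
  have hmap : PolyOn (.mapP (.item 5) (.const 0) .coinBits (.uniP .snd)) (simDom par) := by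
    refine polyOn_mapP (C := fun m => {c | c.toInt.toNat ≤ q m}) hI (hit 5) (hlf _ trivial)
      (hlf _ hlcb) hq (hiq 5 (by simp)) hcq fun B hB => ?_
    have hJ : SizeBdd fun m => {u : Val | u.size ≤ B m ∧ u.snd.toInt.toNat ≤ q m} :=
      ⟨B, hB, fun m v hv => hv.1⟩
    refine polyOn_uniP hJ (.of_loopFree trivial hJ) hq fun m v hv w hw => ?_
    rw [Prog.out_snd, PMF.mem_support_pure_iff] at hw
    exact hw ▸ hv.2
  have hfst : ∀ {g : Prog} {I : ℕ → Set Val}, SizeBdd I → g.LoopFree → PolyOn (.comp .fst g) I :=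
    fun hJ hg => .of_loopFree ⟨trivial, hg⟩ hJ
  have hpack : PolyOn .packP (simDom par) := by
    have h0 := PolyOn.pair hI (hlf .id trivial) (polyOn_uniP hI (hlf _ hlcb) hq hcq)
    obtain ⟨B, hB, hIB⟩ := h0.sizeBdd_out
    let J : ℕ → Set Val := fun m => {w | w.size ≤ B m ∧ ∃ v ∈ simDom par m, ∃ r, w = .pair v r}
    have hJ : SizeBdd J := ⟨B, hB, fun m v hv => hv.1⟩
    have h1 : PolyOn (.pair (.comp .fst (.item 5)) (.pair (.pair (.comp .fst (.item 3))
        (.pair (.comp .fst (.item 4)) (.pair .snd (.pair (.comp .fst (.item 2))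
          (.comp .fst .coinBits))))) (.pair (.const 0) (.const 0)))) J :=
      .of_loopFree (by simp [Prog.LoopFree, Prog.loopFree_item, hlcb]) hJ
    have h2 := h0.comp (J := J) (fun m v hv w hw => ⟨hIB m w ⟨v, hv, hw⟩, by
      obtain ⟨a, ha, r, -, rfl⟩ := mem_support_out_pair hw
      rw [Prog.out_id, PMF.mem_support_pure_iff] at ha
      exact ⟨a, ha ▸ hv, r, rfl⟩⟩) h1
    obtain ⟨C, hC, hJC⟩ := h1.sizeBdd_out
    let K : ℕ → Set Val := fun m => {u | u.size ≤ C m ∧ u.fst.toInt.toNat ≤ q m ∧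
      (u.snd.snd = .pair (.num 0) (.num 0) ∧ u.snd.isPair = .num 1) ∧
      u.snd.fst.snd.snd.snd.fst.toInt.toNat ≤ q m ∧ u.snd.fst.snd.snd.snd.snd.toInt.toNat ≤ q m}
    have h3 : PolyOn (.loop .packStep) K := polyOn_loop_packStep hq ⟨C, hC, fun m v hv => hv.1⟩
      (fun m v hv => hv.2.1) (fun m v hv => hv.2.2.1) fun m v hv => hv.2.2.2
    refine PolyOn.comp' (.comp (J := K) h2 ?_ h3) fun L hL => .of_loopFree trivial hL
    refine MapsInto.comp (J := J) (fun m v hv w hw => ⟨hIB m w ⟨v, hv, hw⟩, by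
      obtain ⟨a, ha, r, -, rfl⟩ := mem_support_out_pair hw
      rw [Prog.out_id, PMF.mem_support_pure_iff] at ha
      exact ⟨a, ha ▸ hv, r, rfl⟩⟩) ?_
    rintro m w hw u hu
    have hsz := hJC m u ⟨w, hw, hu⟩
    obtain ⟨-, v, hv, r, rfl⟩ := hw
    obtain ⟨a, ha, b, hb, rfl⟩ := mem_support_out_pair hu
    obtain ⟨c, hc, d, hd, rfl⟩ := mem_support_out_pair hb
    obtain ⟨_, _, c2, hc2, rfl⟩ := mem_support_out_pair hc
    obtain ⟨_, _, c3, hc3, rfl⟩ := mem_support_out_pair hc2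
    obtain ⟨_, _, c4, hc4, rfl⟩ := mem_support_out_pair hc3
    obtain ⟨c5, hc5, c6, hc6, rfl⟩ := mem_support_out_pair hc4
    obtain ⟨d1, hd1, d2, hd2, rfl⟩ := mem_support_out_pair hd
    rw [out_comp_fst] at ha hc5 hc6
    rw [Prog.out_const, PMF.mem_support_pure_iff] at hd1 hd2
    subst hd1 hd2
    exact ⟨hsz, hiq 5 (by simp) m v hv a ha, ⟨rfl, rfl⟩, hiq 2 (by simp) m v hv c5 hc5,
      hcq m v hv c6 hc6⟩
  have h0 := PolyOn.pair hI (hlf .id trivial) (.pair hI hpack hmap)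
  obtain ⟨B, hB, hIB⟩ := h0.sizeBdd_out
  let J : ℕ → Set Val := fun m => {w | w.size ≤ B m ∧ ∃ v ∈ simDom par m, ∃ r, w = .pair v r}
  have hJ : SizeBdd J := ⟨B, hB, fun m v hv => hv.1⟩
  have h1 : PolyOn (.pair .id (.encP (.comp .fst (.comp (.item 6) .fst))
      (.comp .fst (.comp (.item 6) .snd)) (.comp .snd (.comp .fst .fst))
      (.comp .snd (.comp .fst .snd)) (.comp .fst (.op .add (.op .add .coinBits (.item 0)) (.const 3)))
      (.comp .fst (.item 0)))) J := by
    refine .pair hJ (.of_loopFree trivial hJ) (polyOn_encP hJ (hfst hJ ⟨Prog.loopFree_item _, trivial⟩)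
      (hfst hJ ⟨Prog.loopFree_item _, trivial⟩) (.of_loopFree (by simp [Prog.LoopFree]) hJ)
      (.of_loopFree (by simp [Prog.LoopFree]) hJ)
      (hfst hJ (by simp [Prog.LoopFree, Prog.op, Prog.loopFree_item, hlcb]))
      (hfst hJ (Prog.loopFree_item _)) hq ?_ ?_)
    · rintro m _ ⟨-, _, ⟨κ, pk, sk, rfl, hκ, -⟩, r, rfl⟩ w hw
      rw [out_comp_fst, Val.fst, simIn, Prog.out_op (Prog.out_op (Prog.out_coinBits κ _)
        (Prog.out_item 0 _ _)) (Prog.out_const _ _), PMF.mem_support_pure_iff] at hw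
      subst hw
      refine hbd hκ ?_
      simp only [List.getD_cons_zero, Val.ofNat, Val.toInt, Arith.eval]
      omega
    · rintro m _ ⟨-, v, hv, r, rfl⟩ w hw
      rw [out_comp_fst, Val.fst] at hw
      exact hiq 0 (by simp) m v hv w hw
  obtain ⟨C, hC, hJC⟩ := h1.sizeBdd_out
  let K : ℕ → Set Val := fun m => {u | u.size ≤ C m ∧ ∃ w ∈ J m, ∃ c, u = .pair w c}
  have hK : SizeBdd K := ⟨C, hC, fun m v hv => hv.1⟩
  have hff : ∀ {g : Prog}, g.LoopFree → PolyOn (.comp .fst (.comp .fst g)) K := fun hg =>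
    .of_loopFree ⟨trivial, trivial, hg⟩ hK
  have h6 : (Prog.comp (.item 6) .snd).LoopFree := ⟨Prog.loopFree_item _, trivial⟩
  refine PolyOn.comp (J := K) (PolyOn.comp (J := J) h0 ?_ h1) (MapsInto.comp (J := J) ?_ ?_)
    (.pair hK (hff (Prog.loopFree_item _)) <| .pair hK (hff (Prog.loopFree_item _)) <|
      .pair hK (.of_loopFree (by simp [Prog.LoopFree]) hK) <| .pair hK (.of_loopFree trivial hK) <|
      .pair hK (polyOn_powP hK (.of_loopFree trivial hK)
        (hff (by simp [Prog.LoopFree, Prog.op, Prog.loopFree_item]))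
        (hff (by simp [Prog.LoopFree, Prog.op, Prog.loopFree_item]))
        (hff (Prog.loopFree_item _)) hq ?_) (.of_loopFree trivial hK))
  · intro m v hv w hw
    refine ⟨hIB m w ⟨v, hv, hw⟩, ?_⟩
    obtain ⟨a, ha, r, -, rfl⟩ := mem_support_out_pair hw
    rw [Prog.out_id, PMF.mem_support_pure_iff] at ha
    exact ⟨a, ha ▸ hv, r, rfl⟩
  · intro m v hv w hw
    refine ⟨hIB m w ⟨v, hv, hw⟩, ?_⟩
    obtain ⟨a, ha, r, -, rfl⟩ := mem_support_out_pair hw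
    rw [Prog.out_id, PMF.mem_support_pure_iff] at ha
    exact ⟨a, ha ▸ hv, r, rfl⟩
  · intro m v hv w hw
    refine ⟨hJC m w ⟨v, hv, hw⟩, ?_⟩
    obtain ⟨a, ha, r, -, rfl⟩ := mem_support_out_pair hw
    rw [Prog.out_id, PMF.mem_support_pure_iff] at ha
    exact ⟨a, ha ▸ hv, r, rfl⟩
  · rintro m _ ⟨-, _, ⟨-, v, hv, r, rfl⟩, c, rfl⟩ w hw
    rw [out_comp_fst, Val.fst, out_comp_fst, Val.fst] at hw
    exact hiq 2 (by simp) m v hv w hw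

/-! ### The view of the second server -/

theorem packedSum_bounds {L s : ℕ} (hL : 2 ≤ L) {M : ℤ} {X Y : Fin s → ℤ}
    (hX : ∀ i, 0 ≤ X i ∧ X i ≤ M) (hY : ∀ i, 0 ≤ Y i ∧ Y i ≤ M) :
    0 ≤ packedSum L X Y ∧ packedSum L X Y ≤ M * ((L : ℤ) ^ (2 * s) - 1) := by
  have hL0 : (2 : ℤ) ≤ L := by exact_mod_cast hL
  constructor
  · refine Finset.sum_nonneg fun i _ => add_nonneg ?_ ?_
    · exact mul_nonneg (hX i).1 (by positivity)
    · exact mul_nonneg (hY i).1 (by positivity)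
  · induction s with
    | zero => simp [packedSum]
    | succ s ih =>
      have h := ih (fun i => hX (Fin.castSucc i)) (fun i => hY (Fin.castSucc i))
      have h2 := packedSum_snoc L s X Y 0
      rw [zero_mul, zero_add] at h2
      rw [← h2, hornerZ, zero_mul, zero_add]
      have hM : 0 ≤ M := (hX 0).1.trans (hX 0).2
      have hp : (0 : ℤ) < (L : ℤ) ^ (2 * s) := by positivity
      -- The leading pair contributes at most M(L + 1), and L + 1 ≤ L² - 1 because (L - 2)(L + 1) ≥
      -- 0.
      have h3 : X (Fin.last s) * L + Y (Fin.last s) ≤ M * ((L : ℤ) ^ 2 - 1) := by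
        have hx := mul_le_mul_of_nonneg_right (hX (Fin.last s)).2 (by linarith : (0 : ℤ) ≤ L)
        have hy := (hY (Fin.last s)).2
        nlinarith [mul_nonneg hM (by nlinarith : (0 : ℤ) ≤ (L : ℤ) ^ 2 - L - 2)]
      have h4 := mul_le_mul_of_nonneg_right h3 hp.le
      rw [show 2 * (s + 1) = 2 + 2 * s by ring, pow_add]
      linarith

theorem pow_two_mul_le_two_pow_size {L s N : ℕ} (hs : s ≤ N.size / (2 * L.size)) :
    L ^ (2 * s) ≤ 2 ^ N.size :=
  calc L ^ (2 * s) ≤ (2 ^ L.size) ^ (2 * s) := Nat.pow_le_pow_left (Nat.lt_size_self L).le _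
    _ = 2 ^ (s * (2 * L.size)) := by rw [← pow_mul]; ring_nf
    _ ≤ 2 ^ N.size := Nat.pow_le_pow_right (by norm_num)
      ((Nat.mul_le_mul_right _ hs).trans (Nat.div_mul_le_self _ _))

/-- The second server can compute the key of the first one. -/
theorem one_sub_sk₂_emod {n κ : ℕ} {t : Factors} (ht : t.Accepted n κ) (η : ℤ) (y : (ZMod t.N)ˣ)
    {b : ℕ} (hb : b < t.N) : (1 - (mkKeys η t y b).sk₂) % (t.N : ℤ) = b := by
  have hsum := congrArg (Int.cast : ℤ → ZMod t.N) (mkKeys_sk₁_add_sk₂ η t y b)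
  have hu : ((2 * t.α : ℕ) : ZMod t.N) * ((2 * t.α : ℕ) : ZMod t.N)⁻¹ = 1 :=
    ZMod.coe_mul_inv_eq_one _ ht.coprime
  have hval : ((((2 * t.α : ℕ) : ZMod t.N)⁻¹).val : ZMod t.N) = ((2 * t.α : ℕ) : ZMod t.N)⁻¹ := by
    rw [ZMod.natCast_val, ZMod.cast_id]
  -- Modulo N the key equation reads sk₁ + sk₂ = 1, and sk₁ < N is its own residue.
  have h2 : ((1 - (mkKeys η t y b).sk₂ : ℤ) : ZMod t.N) = ((b : ℤ) : ZMod t.N) := by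
    have hb' : (mkKeys η t y b).sk₁ = (b : ℤ) := rfl
    rw [hb'] at hsum
    push_cast at hsum hu hval ⊢
    rw [hval, CharP.cast_eq_zero (ZMod t.N) t.N] at hsum
    linear_combination -hu - hsum
  rw [(ZMod.intCast_eq_intCast_iff _ _ _).1 h2, Int.emod_eq_of_lt (Int.natCast_nonneg b)
    (by exact_mod_cast hb)]

/-- The randomness of the ciphertexts in the view of the second server. -/
abbrev S2Rand (P : Params) (κ : ℕ) : Type :=
  (Fin P.s → (EncCoin κ × EncCoin κ) × (EncCoin κ × EncCoin κ)) × EncCoin κ × S2Coins P κ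

/-- The randomness of the packed ciphertext. -/
def packedCoin {P : Params} {κ : ℕ} (ρ : S2Rand P κ) : ℤ :=
  packedSum P.L (fun i => ((ρ.1 i).1.1 : ℕ) + (ρ.2.1 : ℕ) + ((ρ.1 i).1.2 : ℕ))
    (fun i => ((ρ.1 i).2.1 : ℕ) + (ρ.2.1 : ℕ) + ((ρ.1 i).2.2 : ℕ))

/-- The packed ciphertext for masked plaintexts `v`. -/
def packedEnc {P : Params} {κ : ℕ} (k : Keys) (v : Fin P.s ⊕ Fin P.s → ℤ) (ρ : S2Rand P κ) :
    Ciphertext k.pk :=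
  enc k.pk (packedSum P.L (fun i => P.δ + v (.inl i)) (fun i => P.δ + v (.inr i)))
    (packedCoin ρ).toNat

/-- The view of the second server for masked plaintexts `v`. -/
def s2View {P : Params} {κ : ℕ} (k : Keys) (v : Fin P.s ⊕ Fin P.s → ℤ) (ρ : S2Rand P κ) : Val :=
  .ofList [k.pk.toVal, .num k.sk₂, .ofList (List.ofFn fun i => .ofNat (ρ.2.2 i)),
    ctVal (packedEnc k v ρ), ctVal (pdec k.sk₁ (packedEnc k v ρ))]

/-! ### Both views of the second server as instances of one distribution. -/

section S2

variable {P : Params} {κ : ℕ}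

/-- Three coins sum to less than 2^(4κ+2), and L^(2s) ≤ 2^|N| ≤ 2^n. Hence the bit count 4κ + n + 3
in `sim₂` covers the packed exponent. -/
theorem packedCoin_bounds (hP : P.Valid κ) {t : Factors} (ht : t.Accepted P.n κ) (ρ : S2Rand P κ) :
    0 ≤ packedCoin ρ ∧ (packedCoin ρ).toNat < 2 ^ (4 * κ + P.n + 3) := by
  have hL : 2 ≤ P.L := le_trans (by
    calc 2 = 2 ^ 1 := rfl
      _ ≤ 2 ^ (P.σ + 2) := Nat.pow_le_pow_right (by norm_num) (by omega)) hP.le_L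
  have hb : ∀ a b c : EncCoin κ, 0 ≤ ((a : ℕ) : ℤ) + (b : ℕ) + (c : ℕ) ∧
      ((a : ℕ) : ℤ) + (b : ℕ) + (c : ℕ) ≤ ((2 ^ (4 * κ + 2) : ℕ) : ℤ) := by
    intro a b c
    have := a.isLt
    have := b.isLt
    have := c.isLt
    have h4 : 2 ^ (4 * κ + 2) = 2 ^ (4 * κ) * 4 := by rw [pow_add]; norm_num
    constructor
    · positivity
    · rw [h4]; omega
  obtain ⟨h0, h1⟩ := packedSum_bounds hL (fun i => hb (ρ.1 i).1.1 ρ.2.1 (ρ.1 i).1.2)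
    (fun i => hb (ρ.1 i).2.1 ρ.2.1 (ρ.1 i).2.2)
  have h2 : P.L ^ (2 * P.s) ≤ 2 ^ P.n := (pow_two_mul_le_two_pow_size (hP.s_le t ht)).trans
    (Nat.pow_le_pow_right (by norm_num) ht.size_N_le)
  refine ⟨h0, ?_⟩
  have h3 : packedCoin ρ ≤ ((2 ^ (4 * κ + 2) * 2 ^ P.n : ℕ) : ℤ) := by
    refine h1.trans ?_
    have : (P.L : ℤ) ^ (2 * P.s) ≤ ((2 ^ P.n : ℕ) : ℤ) := by exact_mod_cast h2
    rw [Nat.cast_mul]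
    exact mul_le_mul_of_nonneg_left (by linarith) (Int.natCast_nonneg _)
  rw [← pow_add] at h3
  have h4 : 2 ^ (4 * κ + 2 + P.n) < 2 ^ (4 * κ + P.n + 3) :=
    Nat.pow_lt_pow_right (by norm_num) (by omega)
  exact (Int.toNat_le.2 h3).trans_lt h4

/-- The packed ciphertext is an honest encryption of the packed plaintext with randomness
`packedCoin`; this integer is nonnegative, so `toNat` loses nothing. -/
theorem view₂_eq (hP : P.Valid κ) {t : Factors} (ht : t.Accepted P.n κ) (y₀ : (ZMod t.N)ˣ) (b : ℕ)
    (x y : Fin P.s → ℤ) (w : InCoins P κ) (c₁ : S1Coins P κ) (c₂ : S2Coins P κ) :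
    view₂ P (mkKeys P.η t y₀ b) x y w c₁ c₂ = s2View (mkKeys P.η t y₀ b)
      (fun j => Sum.elim x y j + ((Sum.elim c₁.r₁ c₁.r₂ j : Fin (2 ^ P.σ)) : ℕ))
      (fun i => ((w.1 i, c₁.encr₁ i), (w.2 i, c₁.encr₂ i)), c₁.encδ, c₂) := by
  have h : packed P (mkKeys P.η t y₀ b) (encInput P _ x w.1) (encInput P _ y w.2) c₁ =
      packedEnc (mkKeys P.η t y₀ b)
      (fun j => Sum.elim x y j + ((Sum.elim c₁.r₁ c₁.r₂ j : Fin (2 ^ P.σ)) : ℕ))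
      (fun i => ((w.1 i, c₁.encr₁ i), (w.2 i, c₁.encr₂ i)), c₁.encδ, c₂) := by
    rw [packed_encInput, packedEnc, enc_eq_encPow, Int.toNat_of_nonneg (packedCoin_bounds hP ht _).1]
    refine congrArg₂ _ ?_ rfl
    congr 1 <;> funext i <;> simp only [Sum.elim_inl, Sum.elim_inr] <;> ring
  rw [view₂, msg₁, h]
  rfl

/-- The simulator recovers sk₁ from sk₂ and repeats the computation of S₁ exactly; the only
difference from the real view is that the masks occur without the plaintexts. -/
theorem sim₂V_eq (hP : P.Valid κ) {t : Factors} (ht : t.Accepted P.n κ) (y₀ : (ZMod t.N)ˣ)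
    (b : Fin (2 ^ P.σ)) (r : EncCoin κ) (f : Fin P.s → S2Draw P κ) (c : S2Coins P κ) :
    sim₂V ((mkKeys P.η t y₀ b).pk.h : ZMod (mkKeys P.η t y₀ b).pk.N).val (mkKeys P.η t y₀ b).pk.N
      (mkKeys P.η t y₀ b).sk₂ r f c = s2View (mkKeys P.η t y₀ b)
      (fun j => ((Sum.elim (fun i => (f i).1.1) (fun i => (f i).1.2) j : Fin (2 ^ P.σ)) : ℕ))
      (fun i => (f i).2, r, c) := by
  have hsk : modZ (1 - (mkKeys P.η t y₀ b).sk₂) (mkKeys P.η t y₀ b).pk.N = ((b : ℕ) : ℤ) := by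
    have hN : b < t.N := b.isLt.trans_le ((Nat.pow_le_pow_right (by norm_num) (by omega)).trans
      (hP.two_pow_lt_N ht))
    exact (modZ_of_pos (by exact_mod_cast zero_lt_one.trans ht.one_lt_N)).trans
      (one_sub_sk₂_emod ht P.η y₀ hN)
  set k := mkKeys P.η t y₀ b with hk
  have hNpos : (0 : ℤ) < k.pk.N := by exact_mod_cast NeZero.pos k.pk.N
  set ρ : S2Rand P κ := (fun i => (f i).2, r, c) with hρ
  set v : Fin P.s ⊕ Fin P.s → ℤ :=
    fun j => ((Sum.elim (fun i => (f i).1.1) (fun i => (f i).1.2) j : Fin (2 ^ P.σ)) : ℕ) with hv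
  obtain ⟨h0, h1⟩ := packedCoin_bounds hP ht ρ
  have hC : encZ ((k.pk.h : ZMod k.pk.N).val : ℕ) k.pk.N (drawMsg f) (drawCoin r f)
      (4 * κ + P.n + 3) P.n = (((packedEnc k v ρ : Ciphertext k.pk) : ZMod (k.pk.N ^ 2)).val : ℕ) := by
    have h := encZ_eq k.pk (drawMsg f) h1 (Nat.size_le.1 ht.size_N_le : k.pk.N < 2 ^ P.n)
    rw [Int.toNat_of_nonneg h0] at h
    exact h
  rw [sim₂V, hsk, hC, powZ_eq (mul_pos hNpos hNpos) _ b.isLt, s2View]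
  have hpow : ((((packedEnc k v ρ : Ciphertext k.pk) : ZMod (k.pk.N ^ 2)).val : ℕ) : ℤ) ^ (b : ℕ) %
      ((k.pk.N : ℤ) * k.pk.N) =
      (((pdec k.sk₁ (packedEnc k v ρ) : Ciphertext k.pk) : ZMod (k.pk.N ^ 2)).val : ℕ) := by
    have hNN : (k.pk.N : ℤ) * k.pk.N = ((k.pk.N ^ 2 : ℕ) : ℤ) := by push_cast; ring
    rw [hNN, ← ZMod.val_intCast]
    congr 2
    push_cast
    rw [ZMod.natCast_val, ZMod.cast_id]
    have : k.sk₁ = ((b : ℕ) : ℤ) := rfl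
    rw [pdec, this, zpow_natCast, Units.val_pow_eq_pow_val]
  rw [hpow]
  rfl

/-- The masks and the randomness of the view of the second server, and what it does not see, in
terms of the randomness of the protocol. -/
def s2RandEquiv (P : Params) (κ : ℕ) :
    ((Fin P.s ⊕ Fin P.s → Fin (2 ^ P.σ)) × S2Rand P κ) ×
      ((Fin P.s → EncCoin κ) × (Fin P.s → EncCoin κ)) ≃ InCoins P κ ×
    (EncCoin κ × (Fin P.s → Fin (2 ^ P.σ)) × (Fin P.s → Fin (2 ^ P.σ)) ×
    (Fin P.s → EncCoin κ) × (Fin P.s → EncCoin κ) × (Fin P.s → EncCoin κ) ×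
    (Fin P.s → EncCoin κ)) × S2Coins P κ where
  toFun p := ((fun i => (p.1.2.1 i).1.1, fun i => (p.1.2.1 i).2.1), (p.1.2.2.1,
    fun i => p.1.1 (.inl i), fun i => p.1.1 (.inr i), fun i => (p.1.2.1 i).1.2,
    fun i => (p.1.2.1 i).2.2, p.2.1, p.2.2), p.1.2.2.2)
  invFun c := ((Sum.elim c.2.1.2.1 c.2.1.2.2.1, fun i => ((c.1.1 i, c.2.1.2.2.2.1 i),
    (c.1.2 i, c.2.1.2.2.2.2.1 i)), c.2.1.1, c.2.2), (c.2.1.2.2.2.2.2.1, c.2.1.2.2.2.2.2.2))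
  left_inv p := by
    refine Prod.ext (Prod.ext (funext fun j => ?_) rfl) rfl
    cases j <;> rfl
  right_inv c := rfl

/-- The masks and the randomness of the view of the second server in the order in which the
simulator draws them. -/
def s2SimEquiv (P : Params) (κ : ℕ) : (Fin P.s ⊕ Fin P.s → Fin (2 ^ P.σ)) × S2Rand P κ ≃
    (EncCoin κ × (Fin P.s → S2Draw P κ)) × S2Coins P κ where
  toFun p := ((p.2.2.1, fun i => ((p.1 (.inl i), p.1 (.inr i)), p.2.1 i)), p.2.2.2)
  invFun c := (Sum.elim (fun i => (c.1.2 i).1.1) (fun i => (c.1.2 i).1.2),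
    fun i => (c.1.2 i).2, c.1.1, c.2)
  left_inv p := by
    refine Prod.ext (funext fun j => ?_) rfl
    cases j <;> rfl
  right_inv c := rfl

theorem mem_support_keyGen (h : ∃ t : Factors, t.Accepted P.n κ) {k : Keys}
    (hk : k ∈ (keyGen P κ).support) : ∃ t : Factors, t.Accepted P.n κ ∧ ∃ (y : (ZMod t.N)ˣ)
      (b : Fin (2 ^ P.σ)), k = mkKeys P.η t y b := by
  simp only [keyGen, do_pure_eq_map, PMF.map_comp, PMF.mem_support_bind_iff,
    PMF.mem_support_map_iff] at hk
  obtain ⟨t, ht, y, -, b, -, rfl⟩ := hk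
  exact ⟨t, accepted_of_mem_support h ht, y, b, rfl⟩

/-- The view of the second server for given keys and inputs. -/
noncomputable def s2Dist (P : Params) (κ : ℕ) (k : Keys) (z : Fin P.s ⊕ Fin P.s → ℤ) : PMF Val :=
  (PMF.uniformOfFintype (Fin P.s ⊕ Fin P.s → Fin (2 ^ P.σ))).bind fun r =>
    (PMF.uniformOfFintype (S2Rand P κ)).map fun ρ => s2View k (fun j => z j + (r j : ℕ)) ρ

/-- The coins `encProd` and `encSum` of S₁ do not reach S₂ and are discarded by `uniform_bind_fst`;
the others are in bijection with the masks and `S2Rand`. -/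
theorem realView_S2 (hP : P.Valid κ) (h : ∃ t : Factors, t.Accepted P.n κ) (x y : Fin P.s → ℤ) :
    realView .S2 P κ x y = (keyGen P κ).bind fun k => s2Dist P κ k (Sum.elim x y) := by
  rw [realView]
  refine bind_congr_support fun k hk => ?_
  obtain ⟨t, ht, y₀, b, rfl⟩ := mem_support_keyGen h hk
  simp only [s1CoinsDist, PMF.bind_map, Function.comp_def, view₂_eq hP ht]
  rw [s2Dist, uniform_bind_map fun (r : Fin P.s ⊕ Fin P.s → Fin (2 ^ P.σ)) (ρ : S2Rand P κ) =>
      s2View (mkKeys P.η t y₀ b) (fun j => Sum.elim x y j + (r j : ℕ)) ρ,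
    ← PMF.bind_pure_comp,
    ← uniform_bind_fst (α := (Fin P.s ⊕ Fin P.s → Fin (2 ^ P.σ)) × S2Rand P κ)
      (β := (Fin P.s → EncCoin κ) × (Fin P.s → EncCoin κ)),
    uniform_bind_equiv (s2RandEquiv P κ).symm, ← uniform_bind_bind (α := InCoins P κ)
      fun w c => (PMF.pure ∘ fun p : (Fin P.s ⊕ Fin P.s → Fin (2 ^ P.σ)) × S2Rand P κ =>
        s2View (mkKeys P.η t y₀ b) (fun j => Sum.elim x y j + (p.1 j : ℕ)) p.2)
          ((s2RandEquiv P κ).symm (w, c)).1]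
  congr 1
  funext w
  rw [← uniform_bind_bind (β := S2Coins P κ) fun c₁ c₂ =>
    (PMF.pure ∘ fun p : (Fin P.s ⊕ Fin P.s → Fin (2 ^ P.σ)) × S2Rand P κ =>
        s2View (mkKeys P.η t y₀ b) (fun j => Sum.elim x y j + (p.1 j : ℕ)) p.2)
          ((s2RandEquiv P κ).symm (w, c₁, c₂)).1]
  congr 1

theorem simView_sim₂ (hP : P.Valid κ) (h : ∃ t : Factors, t.Accepted P.n κ) :
    simView Prog.sim₂ .S2 P κ = (keyGen P κ).bind fun k => s2Dist P κ k 0 := by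
  rw [simView_eq]
  refine bind_congr_support fun k hk => ?_
  obtain ⟨t, ht, y₀, b, rfl⟩ := mem_support_keyGen h hk
  refine (out_sim₂ P κ _ _ _).trans ?_
  have hV : ∀ w : (EncCoin κ × (Fin P.s → S2Draw P κ)) × S2Coins P κ,
    sim₂V ((mkKeys P.η t y₀ b).pk.h : ZMod (mkKeys P.η t y₀ b).pk.N).val (mkKeys P.η t y₀ b).pk.N
      (mkKeys P.η t y₀ b).sk₂ w.1.1 w.1.2 w.2 = _ := fun w => sim₂V_eq hP ht y₀ b w.1.1 w.1.2 w.2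
  rw [s2Dist, uniform_bind_map fun (r : Fin P.s ⊕ Fin P.s → Fin (2 ^ P.σ)) (ρ : S2Rand P κ) =>
      s2View (mkKeys P.η t y₀ b) (fun j => (0 : Fin P.s ⊕ Fin P.s → ℤ) j + (r j : ℕ)) ρ,
    uniform_map_of_equiv (s2SimEquiv P κ).symm]
  refine congrArg (PMF.map · _) (funext fun w => (hV w).trans ?_)
  simp only [Pi.zero_apply, zero_add]
  rfl

/-- The 2s plaintexts are masked by independent r, and the bound holds for every key and every test,
however powerful. -/
theorem abs_accept_s2Dist_le (a : Val → PMF Bool) (k : Keys) {x y : Fin P.s → ℤ}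
    (hx : Admissible P x) (hy : Admissible P y) :
    |accept a (s2Dist P κ k (Sum.elim x y)) - accept a (s2Dist P κ k 0)| ≤
      (2 * P.s : ℕ) * ((2 : ℝ) ^ P.ℓ / 2 ^ P.σ) := by
  have h := abs_accept_mask_le a (2 ^ P.σ) (Sum.elim x y) fun v =>
    (PMF.uniformOfFintype (S2Rand P κ)).map fun ρ => s2View k v ρ
  have h0 : s2Dist P κ k 0 = (PMF.uniformOfFintype (Fin P.s ⊕ Fin P.s → Fin (2 ^ P.σ))).bind
      fun r => (PMF.uniformOfFintype (S2Rand P κ)).map fun ρ => s2View k (fun j => (r j : ℕ)) ρ := by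
    simp [s2Dist]
  rw [h0]
  refine h.trans ((Finset.sum_le_card_nsmul _ _ ((2 : ℝ) ^ P.ℓ / 2 ^ P.σ) fun j _ => ?_).trans_eq ?_)
  · have hz : ∀ z : Fin P.s → ℤ, Admissible P z → ∀ i, |(z i : ℝ)| ≤ 2 ^ P.ℓ := fun z hz i => by
      have := abs_le.2 ⟨(hz i).1, (hz i).2.1⟩
      exact_mod_cast this
    rw [Nat.cast_pow, Nat.cast_ofNat]
    refine div_le_div_of_nonneg_right ?_ (by positivity)
    cases j with
    | inl i => exact hz x hx i
    | inr i => exact hz y hy i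
  · simp [two_mul]

end S2

theorem privateAgainst_S2 {par : ℕ → Params} (hn : PolyBounded fun κ => (par κ).n)
    (hσ : PolyBounded fun κ => (par κ).σ) (hs : PolyBounded fun κ => (par κ).s)
    (hP : ∀ κ, (par κ).Valid κ)
    (hgen : ∀ᶠ κ in Filter.atTop, ∃ t : Factors, t.Accepted (par κ).n κ)
    (hnegl : Negligible fun κ => (2 : ℝ) ^ (par κ).ℓ / 2 ^ (par κ).σ) :
    PrivateAgainst .S2 par := by
  refine ⟨Prog.sim₂, polyTimeOn_of_polyOn _ (polyOn_sim₂ hn hσ hs), fun x y hx hy A => ?_⟩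
  refine hnegl.of_eventually_le ((PolyBounded.const 2).mul hs)
    (.of_forall fun κ => by positivity) ?_
  filter_upwards [hgen] with κ hκ
  rw [abs_abs, Adversary.prob_eq, Adversary.prob_eq, realView_S2 (hP κ) hκ, simView_sim₂ (hP κ) hκ]
  exact abs_accept_bind_sub_le _ fun k _ => abs_accept_s2Dist_le _ k (hx κ) (hy κ)

/-- The number of pairs and the size of the blinding factors are polynomially bounded. -/
theorem polyBounded_s_σ {par : ℕ → Params} (hn : PolyBounded fun κ => (par κ).n)
    (hP : ∀ κ, (par κ).Valid κ)
    (hgen : ∀ᶠ κ in Filter.atTop, ∃ t : Factors, t.Accepted (par κ).n κ) :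
    (PolyBounded fun κ => (par κ).s) ∧ PolyBounded fun κ => (par κ).σ := by
  -- When an accepted tuple exists, s ≤ |N| ≤ n and 2(σ + 3) ≤ 2|L| ≤ |N| ≤ n.
  constructor <;> refine .of_eventually hn ?_ <;> filter_upwards [hgen] with κ ⟨t, ht⟩
  · exact ((hP κ).size_N ht).2.trans ht.size_N_le
  · have h1 := (hP κ).size_L
    have h2 := ((hP κ).size_N ht).1
    have h3 := ht.size_N_le
    omega

end BatchSMUL

theorem corollary1 (par : ℕ → BatchSMUL.Params)
    (hn : BatchSMUL.PolyBounded fun κ => (par κ).n)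
    (hgen : ∀ᶠ κ in Filter.atTop, ∃ t : BatchSMUL.Factors, t.Accepted (par κ).n κ)
    (hs : ∀ κ, 1 ≤ (par κ).s)
    (hsN : ∀ κ, ∀ t : BatchSMUL.Factors, t.Accepted (par κ).n κ →
      (par κ).s ≤ t.N.size / (2 * (par κ).L.size))
    (hℓσ : ∀ κ, (par κ).ℓ < (par κ).σ)
    (hnegl : BatchSMUL.Negligible fun κ => (2 : ℝ) ^ (par κ).ℓ / 2 ^ (par κ).σ)
    (hL : ∀ κ, 2 ^ ((par κ).σ + 2) ≤ (par κ).L)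
    (hδ : ∀ κ, (par κ).δ ≤ 2 ^ (par κ).ℓ)
    (hsec : BatchSMUL.SemanticallySecure par) :
    (∀ κ, BatchSMUL.Correct (par κ) κ) ∧
    BatchSMUL.PrivateAgainst .S1 par ∧ BatchSMUL.PrivateAgainst .S2 par := by
  have hP : ∀ κ, (par κ).Valid κ := fun κ => ⟨hs κ, hsN κ, hℓσ κ, hL κ, hδ κ⟩
  obtain ⟨hs', hσ⟩ := BatchSMUL.polyBounded_s_σ hn hP hgen
  exact ⟨fun κ => (hP κ).correct, BatchSMUL.privateAgainst_S1 hn hσ hs' hP hgen hsec,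
    BatchSMUL.privateAgainst_S2 hn hσ hs' hP hgen hnegl⟩
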